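/- **Setting.** Let $I=[0,1]$, $D\ge 2$, $J\ge 0$, $M\ge 1$ integers, and $\alpha,\beta,F>0$. *Hölder balls.* For a function $f$ on a cube $I^{p}$ whose partial derivatives $\partial^a f$, $|a|\le\lfloor\beta\rfloor$, exist (one-sided on the boundary), put $$\|f\|_{H^\beta}=\max_{|a|\le\lfloor\beta\rfloor}\sup|\partial^a f|+\max_{|a|=\lfloor\beta\rfloor}\ \sup_{x\ne x'}\frac{|\partial^a f(x)-\partial^a f(x')|}{|x-x'|^{\beta-\lfloor\beta\rfloor}},$$ and let $H_F^\beta(I^p)=\{f:\|f\|_{H^\beta}\le F\}$. *Piecewise smooth functions.* Given coordinates $d_1,\dots,d_J\in\{1,\dots,D\}$ and $h_1,\dots,h_J\in H_F^\alpha(I^{D-1})$, let $I_j^{+}=\{x\in I^D: x_{d_j}\ge h_j(x_{-d_j})\}$ and $I_j^{-}=\{x\in I^D: x_{d_j}\le h_j(x_{-d_j})\}$, where $x_{-d}$ is $x$ without its $d$-th coordinate. For $\mathcal T\subset\{+,-\}^J$ let $R_{\mathcal T}=\bigcup_{t\in\mathcal T}\bigcap_{j=1}^J I_j^{t_j}\subset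 I^D$. The class $\mathcal F^{PS}_{\alpha,\beta,M}$ (with $D,F,J$ fixed) consists of all $\sum_{m=1}^M f_m\mathbf 1_{R_{\mathcal T_m}}$ with $f_m\in H_F^\beta(I^D)$ and pieces as above, where $(\mathcal T_1,\dots,\mathcal T_M)$ is a partition of $\{+,-\}^J$ (empty blocks allowed). *Activation.* Let $N\in\mathbb N$ with $N>\max(\alpha,\beta)$ and let $\eta:\mathbb R\to\mathbb R$ satisfy one of the following. (i) The derivatives $\partial^j\eta$, $j=1,\dots,N+1$, exist everywhere and are bounded; there is $x'$ with $\min_{1\le j\le N}|\partial^j\eta(x')|>0$; and there are $q\ge1$, $k\in\{0,1\}$, $\overline c>\underline c\ge0$, $C_K>0$ with $|\eta(x)-\overline c x^k|=O(x^{-q})$ as $x\to\infty$, $|\eta(x)-\underline c|=O(|x|^{-q})$ as $x\to-\infty$, and $|\eta(x)|\le C_K(1+|x|^k)$ for all $x$. (ii) There are $c_1>c_2\ge0$ with $\eta(x)=c_1x$ for $x\ge0$ and $\eta(x)=c_2x$ for $x<0$. *Networks.* $\mathcal G(L,S,B)$ is the set of functions $g=g_{L'}\circ\cdots\circ g_1:\mathbb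 R^D\to\mathbb R$ with $1\le L'\le L$, $g_\ell(z)=\eta(A_\ell z+b_\ell)$ (coordinatewise) for $\ell<L'$ and $g_{L'}(z)=A_{L'}z+b_{L'}$, with arbitrary intermediate dimensions, such that the matrices $A_\ell$ and vectors $b_\ell$ have in total at most $S$ non-zero entries, all entries have absolute value at most $B$, and $|g|\le F$ on $I^D$. **Theorem.** There are positive constants $C_L=C_L(\alpha,\beta,D,F)$, $C_S=C_S(\alpha,\beta,D,F,J)$, $C_B=C_B(F,M,\eta)$ and $c=c(\alpha,\beta)$ such that for all $\varepsilon_1,\varepsilon_2\in(0,1)$ and all natural numbers $L,S,B$ with - $L\ge C_L\bigl(\lfloor\alpha\rfloor+\lfloor\beta\rfloor+\log_2(1/\varepsilon_1)+\log_2(M/\varepsilon_2)+1\bigr)$, - $S\ge C_S\bigl(M\varepsilon_1^{-D/\beta}(\log_2(1/\varepsilon_1))^2+(\varepsilon_2/M)^{-2(D-1)/\alpha}(\log_2(M/\varepsilon_2))^2+1\bigr)$, - $B\ge C_B\,(\min\{\varepsilon_1,\varepsilon_2\})^{-\max\{16,c\}}$, we have $$\sup_{f^*\in\mathcal F^{PS}_{\alpha,\beta,M}}\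 \inf_{f\in\mathcal G(L,S,B)}\|f-f^*\|_{L^2(I^D)}\le\varepsilon_1+\varepsilon_2 .$$ -/

import Mathlib

open scoped NNReal ENNReal
open Filter Asymptotics MeasureTheory

noncomputable section

/-- The cube `I^ι = [0,1]^ι`, where `ι` is the finite index set of the coordinates. -/
def unitCube (ι : Type) : Set (ι → ℝ) := Set.Icc 0 1

/-- Condition (i), smooth activations: the derivatives of order `1, …, N + 1` exist everywhere
and are bounded, those of order `1, …, N` are bounded away from zero at a common point, and `η`
behaves like `cUp * x ^ k` at `+∞` and like the constant `cLow` at `-∞`. -/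
def SmoothActivation (N : ℕ) (η : ℝ → ℝ) : Prop :=
  (∀ j ≤ N, Differentiable ℝ (iteratedDeriv j η)) ∧
  (∀ j, 1 ≤ j → j ≤ N + 1 → ∃ K : ℝ, ∀ x, |iteratedDeriv j η x| ≤ K) ∧
  (∃ x' : ℝ, ∃ c > 0, ∀ j, 1 ≤ j → j ≤ N → c ≤ |iteratedDeriv j η x'|) ∧
  ∃ q : ℝ, 1 ≤ q ∧ ∃ k : ℕ, (k = 0 ∨ k = 1) ∧
    (∃ cUp cLow : ℝ, 0 ≤ cLow ∧ cLow < cUp ∧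
      (fun x => η x - cUp * x ^ k) =O[atTop] (fun x => 1 / x ^ q) ∧
      (fun x => η x - cLow) =O[atBot] (fun x => 1 / |x| ^ q)) ∧
    ∃ CK > 0, ∀ x, |η x| ≤ CK * (1 + |x| ^ k)

/-- Condition (ii), piecewise linear activations such as ReLU and leaky ReLU. -/
def PiecewiseLinearActivation (η : ℝ → ℝ) : Prop :=
  ∃ c₁ c₂ : ℝ, 0 ≤ c₂ ∧ c₂ < c₁ ∧ ∀ x, η x = if 0 ≤ x then c₁ * x else c₂ * x

/-- The assumption on the activation function, with smoothness parameter `N`. -/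
def ActivationAssumption (N : ℕ) (η : ℝ → ℝ) : Prop :=
  SmoothActivation N η ∨ PiecewiseLinearActivation η

/-- The parameters of a network with `m` inputs and `n` outputs: matrices and biases of finitely
many hidden layers, followed by those of an affine output layer. -/
inductive Net : ℕ → ℕ → Type
  | output {m n : ℕ} (A : Matrix (Fin n) (Fin m) ℝ) (b : Fin n → ℝ) : Net m n
  | hidden {m k n : ℕ} (A : Matrix (Fin k) (Fin m) ℝ) (b : Fin k → ℝ) (rest : Net k n) : Net m n

/-- The function realized by a network; `η` acts coordinatewise after each hidden layer. -/
def Net.eval (η : ℝ → ℝ) : {m n : ℕ} → Net m n → (Fin m → ℝ) → (Fin n → ℝ)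
  | _, _, .output A b, x => A.mulVec x + b
  | _, _, .hidden A b rest, x => rest.eval η (fun i => η ((A.mulVec x + b) i))

/-- `L(g)`: the number of layers, including the output layer. -/
def Net.numLayers : {m n : ℕ} → Net m n → ℕ
  | _, _, .output _ _ => 1
  | _, _, .hidden _ _ rest => 1 + rest.numLayers

open Classical in
/-- The number of non-zero entries of a matrix and a vector. -/
def numNonzero {n m : ℕ} (A : Matrix (Fin n) (Fin m) ℝ) (b : Fin n → ℝ) : ℕ :=
  (Finset.univ.filter fun p : Fin n × Fin m => A p.1 p.2 ≠ 0).card +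
    (Finset.univ.filter fun i : Fin n => b i ≠ 0).card

/-- `S(g)`: the number of non-zero parameters. -/
def Net.numParams : {m n : ℕ} → Net m n → ℕ
  | _, _, .output A b => numNonzero A b
  | _, _, .hidden A b rest => numNonzero A b + rest.numParams

/-- The largest absolute value of the entries of a matrix and a vector. -/
def maxAbs {n m : ℕ} (A : Matrix (Fin n) (Fin m) ℝ) (b : Fin n → ℝ) : ℝ≥0 :=
  (Finset.univ.sup fun p : Fin n × Fin m => ‖A p.1 p.2‖₊) ⊔ (Finset.univ.sup fun i => ‖b i‖₊)

/-- `B(g)`: the largest absolute value of the parameters. -/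
def Net.maxParam : {m n : ℕ} → Net m n → ℝ≥0
  | _, _, .output A b => maxAbs A b
  | _, _, .hidden A b rest => maxAbs A b ⊔ rest.maxParam

/-- The class `𝒢(L, S, B)` of real functions of `D` variables realized by networks with
activation `η`, at most `L` layers, at most `S` non-zero parameters, all of absolute value at
most `B`, and bounded by `F` on the cube. -/
def netClass (D : ℕ) (η : ℝ → ℝ) (F : ℝ) (L S B : ℕ) : Set ((Fin D → ℝ) → ℝ) :=
  {g | (∃ Φ : Net D 1, (∀ x, g x = Φ.eval η x 0) ∧
        Φ.numLayers ≤ L ∧ Φ.numParams ≤ S ∧ (Φ.maxParam : ℝ) ≤ B) ∧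
      ∀ x ∈ unitCube (Fin D), |g x| ≤ F}

/-- `H_F^β(I^ι)`: the ball of radius `F` in the Hölder space on the cube. The family `d` consists
of the partial derivatives `∂^a f`, `|a| ≤ ⌊β⌋`, on the cube (one-sided on its boundary), which
`f` determines; `s` bounds all of them, and `t` bounds the Hölder quotients of those of order
`⌊β⌋` (Euclidean distance). So the Hölder norm, the sum of the two maxima, is at most `F`. -/
def holderBall (ι : Type) [Fintype ι] [DecidableEq ι] (β F : ℝ) : Set ((ι → ℝ) → ℝ) :=
  {f | ∃ (d : (ι → ℕ) → (ι → ℝ) → ℝ) (s t : ℝ), 0 ≤ s ∧ 0 ≤ t ∧ s + t ≤ F ∧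
    (∀ x ∈ unitCube ι, d 0 x = f x) ∧
    (∀ a : ι → ℕ, ∑ i, a i < ⌊β⌋₊ → ∀ i, ∀ x ∈ unitCube ι,
      HasDerivWithinAt (fun u : ℝ => d a (Function.update x i u))
        (d (a + Pi.single i 1) x) (Set.Icc 0 1) (x i)) ∧
    (∀ a : ι → ℕ, ∑ i, a i ≤ ⌊β⌋₊ → ∀ x ∈ unitCube ι, |d a x| ≤ s) ∧
    (∀ a : ι → ℕ, ∑ i, a i = ⌊β⌋₊ → ∀ x ∈ unitCube ι, ∀ y ∈ unitCube ι, x ≠ y →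
      |d a x - d a y| ≤ t * √(∑ i, (x i - y i) ^ 2) ^ (β - ⌊β⌋₊))}

/-- The side `I^+` (for `true`) or `I^-` (for `false`) of the graph `x_k = h(x_{-k})` in the
cube, where `x_{-k}` is `x` without its `k`-th coordinate. -/
def graphSide {D : ℕ} (k : Fin D) (h : ({i : Fin D // i ≠ k} → ℝ) → ℝ) (sgn : Bool) :
    Set (Fin D → ℝ) :=
  {x | x ∈ unitCube (Fin D) ∧
    if sgn then h (fun i => x i) ≤ x k else x k ≤ h (fun i => x i)}

/-- The piece `R_T = ⋃_{t ∈ T} ⋂_j I_j^{t_j}` for a set `T` of sign vectors. -/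
def piece {D J : ℕ} (k : Fin J → Fin D) (h : ∀ j, ({i : Fin D // i ≠ k j} → ℝ) → ℝ)
    (T : Set (Fin J → Bool)) : Set (Fin D → ℝ) :=
  ⋃ t ∈ T, {x | x ∈ unitCube (Fin D) ∧ ∀ j, x ∈ graphSide (k j) (h j) (t j)}

/-- The class of piecewise smooth functions `∑_m f_m 1_{R_m}` with `f_m ∈ H_F^β(I^D)`, where the
pieces come from `J` graphs of functions in `H_F^α(I^{D-1})` and a partition of the set of sign
vectors into `M` labelled (possibly empty) sets. -/
def piecewiseSmooth (D J M : ℕ) (α β F : ℝ) : Set ((Fin D → ℝ) → ℝ) :=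
  {f | ∃ (k : Fin J → Fin D) (h : ∀ j, ({i : Fin D // i ≠ k j} → ℝ) → ℝ)
      (T : Fin M → Set (Fin J → Bool)) (fm : Fin M → (Fin D → ℝ) → ℝ),
    (∀ j, h j ∈ holderBall {i : Fin D // i ≠ k j} α F) ∧
    Pairwise (fun m m' => Disjoint (T m) (T m')) ∧ (⋃ m, T m) = Set.univ ∧
    (∀ m, fm m ∈ holderBall (Fin D) β F) ∧
    ∀ x, f x = ∑ m, (piece k h (T m)).indicator (fm m) x}

/-- The distance of `L²(I^D)`. -/
def l2Dist {D : ℕ} (f g : (Fin D → ℝ) → ℝ) : ℝ≥0∞ :=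
  eLpNorm (fun x => f x - g x) 2 (volume.restrict (unitCube (Fin D)))

end

/-! The network simulates a Boolean threshold circuit. From the cube one removes thin neighbourhoods
of the hyperplanes of two fine grids and of the graphs `x_k = h_j`. On the remaining good set every
comparison made by the circuit is decided with a margin `κ`, so it can be carried out by neurons
that realize the Heaviside function only approximately, and the resulting bits can be refreshed in
each layer so that their errors do not accumulate.

The circuit determines the cell of the input and the binary digits of its local coordinates in the
cell. Digits of the Taylor coefficients on the cells are hard-wired in a table and looked up by the
cell. Products of digits are conjunctions of bits, hence single thresholds, and a fixed linear
combination of them is the Taylor polynomial with rounded coefficients at the rounded point. Doing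
this in `D - 1` variables for the functions `h_j` and comparing with `x_k` tells on which side of
each graph the input lies. Doing it in `D` variables for each of the `2 ^ J` sign vectors, and
masking the terms by the bits of the sides, leaves the polynomial of the correct piece. Since pieces
are indexed by sign vectors, `M` plays no role in the construction.

The final value is digitized once more, and its digits pass through a gadget whose range is almost
`[0, 1]` on the whole line. Hence the network is bounded by `F` everywhere, including the removed
set, which therefore contributes at most `2 F` times the square root of its volume to the distance
in `L²`.

Accuracy `2 ^ (-l)` in a Hölder ball of smoothness `β` in `p` variables requires about `2 ^ (l p /
β)` cells; the number of digit products is polynomial in `l` and is absorbed by this power, which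
leaves a cost `2 ^ (l p / β) l ^ 2`. An error of the graphs is seen through the volume of a slab,
under a square root, so the graphs need accuracy `2 ^ (-2 l)`; this is the source of the exponent `2
(D - 1) / α`. Each digit costs one layer, which gives logarithmic depth.

The constant `C_B` may not depend on `D` or `J`. To keep the weights small, each signal is carried
by `m` identical copies and read as their average, which divides the weights by `m`; the factor `m ^
2` in the number of parameters goes into `C_S`.

The main steps are `ActivationAssumption.exists_hasGadgets` (gadgets), `Hidden.layer` and
`Frame.TC.extend` (one layer of the simulation), `Frame.TC.gridTerms` (table lookup),
`exists_gridApprox` (digital Taylor approximation), `Frame.TC.analogOutput` (bounded output),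
`l2Dist_le` and `exists_approx` (choice of parameters). -/

noncomputable section

/-! ### Building networks layer by layer -/

theorem maxAbs_le {n m : ℕ} {A : Matrix (Fin n) (Fin m) ℝ} {b : Fin n → ℝ} {B : ℝ} (hB : 0 ≤ B)
    (hA : ∀ i j, |A i j| ≤ B) (hb : ∀ i, |b i| ≤ B) : (maxAbs A b : ℝ) ≤ B := by
  have : maxAbs A b ≤ ⟨B, hB⟩ := by
    refine sup_le (Finset.sup_le fun p _ => ?_) (Finset.sup_le fun i _ => ?_)
    · exact NNReal.coe_le_coe.1 (hA p.1 p.2)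
    · exact NNReal.coe_le_coe.1 (hb i)
  exact NNReal.coe_le_coe.2 this

open Classical in
/-- The number of non-zero entries of a matrix with arbitrary finite index types. -/
def supportCard {ι κ : Type} [Fintype ι] [Fintype κ] (A : ι → κ → ℝ) : ℕ :=
  (Finset.univ.filter fun p : ι × κ => A p.1 p.2 ≠ 0).card

theorem numNonzero_le {ι κ : Type} [Fintype ι] [Fintype κ] {n m : ℕ} (e : Fin n ≃ ι)
    (f : Fin m ≃ κ) (A : ι → κ → ℝ) (b : Fin n → ℝ) (c : ℕ) (hc : supportCard A ≤ c) (t : ℕ)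
    (ht : (∀ i, b i = 0) ∨ n ≤ t) :
    numNonzero (Matrix.of fun i j => A (e i) (f j)) b ≤ c + t := by
  classical
  unfold numNonzero
  refine add_le_add (le_trans ?_ hc) ?_
  · refine Finset.card_le_card_of_injOn (fun p => (e p.1, f p.2)) ?_ ?_
    · intro p hp
      exact Finset.mem_coe.2 (Finset.mem_filter.2 ⟨Finset.mem_univ _,
        (Finset.mem_filter.1 (Finset.mem_coe.1 hp)).2⟩)
    · rintro ⟨p, q⟩ _ ⟨p', q'⟩ _ h
      simpa using h
  · rcases ht with h | h
    · simp [h]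
    · exact (Finset.card_filter_le _ _).trans (by simpa using h)

/-- The functions `v i` are the neurons of a hidden layer: there are `l` hidden layers with at
most `s` non-zero parameters, all of absolute value at most `B`, whose last layer computes `v`. -/
def Hidden (η : ℝ → ℝ) (B : ℝ) {D : ℕ} {ι : Type} [Fintype ι] (v : ι → (Fin D → ℝ) → ℝ)
    (l s : ℕ) : Prop :=
  ∀ rest : Net (Fintype.card ι) 1, (rest.maxParam : ℝ) ≤ B → ∃ Φ : Net D 1,
    (∀ x, Φ.eval η x = rest.eval η fun i => v ((Fintype.equivFin ι).symm i) x) ∧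
    Φ.numLayers = l + rest.numLayers ∧ Φ.numParams ≤ s + rest.numParams ∧ (Φ.maxParam : ℝ) ≤ B

theorem Hidden.first {η : ℝ → ℝ} {B : ℝ} (hB : 0 ≤ B) {D : ℕ} {ι : Type} [Fintype ι]
    (A : ι → Fin D → ℝ) (b : ι → ℝ) (hA : ∀ i j, |A i j| ≤ B) (hb : ∀ i, |b i| ≤ B) :
    Hidden η B (fun i x => η (∑ j, A i j * x j + b i)) 1 (supportCard A + Fintype.card ι) := by
  intro rest hrest
  refine ⟨.hidden (Matrix.of fun i j => A ((Fintype.equivFin ι).symm i) ((Equiv.refl _) j))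
    (fun i => b ((Fintype.equivFin ι).symm i)) rest, ?_, rfl, ?_, ?_⟩
  · intro x
    rw [Net.eval]
    rfl
  · rw [Net.numParams]
    refine add_le_add ?_ le_rfl
    exact numNonzero_le _ _ A _ _ le_rfl _ (Or.inr le_rfl)
  · rw [Net.maxParam, NNReal.coe_max]
    exact max_le (maxAbs_le hB (fun i j => hA _ _) (fun i => hb _)) hrest

/-- Only the first layer uses biases. Later constants come from a signal identically equal to `1`,
so that they too can be distributed over copies of neurons and stay below `B`. -/
theorem Hidden.step {η : ℝ → ℝ} {B : ℝ} (hB : 0 ≤ B) {D : ℕ} {ι κ : Type} [Fintype ι] [Fintype κ]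
    {v : ι → (Fin D → ℝ) → ℝ} {l s : ℕ} (h : Hidden η B v l s) (A : κ → ι → ℝ)
    (hA : ∀ i j, |A i j| ≤ B) :
    Hidden η B (fun i x => η (∑ j, A i j * v j x)) (l + 1) (s + supportCard A) := by
  intro rest hrest
  obtain ⟨Φ, h1, h2, h3, h4⟩ := h (.hidden (Matrix.of fun i j =>
    A ((Fintype.equivFin κ).symm i) ((Fintype.equivFin ι).symm j)) (fun _ => 0) rest) (by
      rw [Net.maxParam, NNReal.coe_max]
      exact max_le (maxAbs_le hB (fun i j => hA _ _) (fun i => by simpa using hB)) hrest)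
  refine ⟨Φ, ?_, ?_, ?_, h4⟩
  · intro x
    rw [h1, Net.eval]
    congr 1
    funext i
    simp only [Pi.add_apply, add_zero, Matrix.mulVec, dotProduct, Matrix.of_apply]
    congr 1
    exact Equiv.sum_comp (Fintype.equivFin ι).symm
      (fun j => A ((Fintype.equivFin κ).symm i) j * v j x)
  · rw [h2, Net.numLayers]; ring
  · rw [Net.numParams] at h3
    have := numNonzero_le (Fintype.equivFin κ).symm (Fintype.equivFin ι).symm A (fun _ => 0) _
      le_rfl 0 (Or.inl fun _ => rfl)
    omega

theorem Hidden.output {η : ℝ → ℝ} {B : ℝ} (hB : 0 ≤ B) {D : ℕ} {ι : Type} [Fintype ι]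
    {v : ι → (Fin D → ℝ) → ℝ} {l s : ℕ} (h : Hidden η B v l s) (a : ι → ℝ)
    (ha : ∀ i, |a i| ≤ B) :
    ∃ Φ : Net D 1, (∀ x, Φ.eval η x 0 = ∑ i, a i * v i x) ∧ Φ.numLayers = l + 1 ∧
      Φ.numParams ≤ s + Fintype.card ι ∧ (Φ.maxParam : ℝ) ≤ B := by
  obtain ⟨Φ, h1, h2, h3, h4⟩ := h (.output (Matrix.of fun _ j =>
    a ((Fintype.equivFin ι).symm j)) (fun _ => 0)) (by
      rw [Net.maxParam]
      exact maxAbs_le hB (fun i j => ha _) (fun i => by simpa using hB))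
  refine ⟨Φ, ?_, h2, ?_, h4⟩
  · intro x
    rw [h1, Net.eval]
    simp only [Pi.add_apply, add_zero, Matrix.mulVec, dotProduct, Matrix.of_apply]
    exact Equiv.sum_comp (Fintype.equivFin ι).symm (fun j => a j * v j x)
  · rw [Net.numParams] at h3
    have h5 : supportCard (fun (_ : Fin 1) (j : ι) => a j) ≤ Fintype.card ι := by
      unfold supportCard
      exact (Finset.card_filter_le _ _).trans (by simp)
    have := numNonzero_le (Equiv.refl (Fin 1)) (Fintype.equivFin ι).symm
      (fun (_ : Fin 1) (j : ι) => a j) (fun _ => 0) _ h5 0 (Or.inl fun _ => rfl)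
    exact h3.trans (add_le_add le_rfl this)


/-! ### Gadgets of four neurons -/

/-- A linear combination of four neurons with scalar input. -/
def gadget (η : ℝ → ℝ) (p u v : Fin 4 → ℝ) (z : ℝ) : ℝ := ∑ l, p l * η (u l * z + v l)

/-- Non-zero constants can be realized. -/
def HasOne (η : ℝ → ℝ) (K : ℝ) : Prop := ∃ b, |b| ≤ K ∧ 1 ≤ K * |η b|

/-- The identity can be realized with input weights independent of the accuracy. -/
def HasId (η : ℝ → ℝ) (K : ℝ) : Prop :=
  ∀ Y : ℝ, 1 ≤ Y → ∃ p u v : Fin 4 → ℝ, (∀ l, |p l| ≤ K * Y) ∧ (∀ l, |u l| ≤ K) ∧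
    (∀ l, |v l| ≤ K) ∧ ∀ z, |z| ≤ 2 → |gadget η p u v z - z| ≤ 1 / Y

/-- The Heaviside function can be realized outside a neighbourhood of its jump. -/
def HasStep (η : ℝ → ℝ) (K : ℝ) : Prop :=
  ∀ Y : ℝ, 1 ≤ Y → ∃ p u v : Fin 4 → ℝ, (∀ l, |p l| ≤ K * Y ^ 2) ∧ (∀ l, |u l| ≤ K * Y ^ 2) ∧
    (∀ l, |v l| ≤ K * Y ^ 2) ∧ ∀ z, (1 / Y ≤ z → |gadget η p u v z - 1| ≤ 1 / Y) ∧
      (z ≤ -(1 / Y) → |gadget η p u v z| ≤ 1 / Y)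

/-- The identity of `{0, 1}` can be realized by a function whose range is almost `[0, 1]`. -/
def HasClip (η : ℝ → ℝ) (K : ℝ) : Prop :=
  ∀ Y : ℝ, 1 ≤ Y → ∃ p u v : Fin 4 → ℝ, (∀ l, |p l| ≤ K * Y ^ 2) ∧ (∀ l, |u l| ≤ K * Y ^ 2) ∧
    (∀ l, |v l| ≤ K * Y ^ 2) ∧ ∀ z, -(1 / Y) ≤ gadget η p u v z ∧ gadget η p u v z ≤ 1 + 1 / Y ∧
      (|z - 1| ≤ 1 / (K * Y ^ 2) → |gadget η p u v z - 1| ≤ 1 / Y) ∧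
      (|z| ≤ 1 / (K * Y ^ 2) → |gadget η p u v z| ≤ 1 / Y)

/-- The properties of an activation function used in the construction. -/
def HasGadgets (η : ℝ → ℝ) (K : ℝ) : Prop :=
  1 ≤ K ∧ HasOne η K ∧ HasId η K ∧ HasStep η K ∧ HasClip η K

theorem HasOne.mono {η : ℝ → ℝ} {K K' : ℝ} (h : HasOne η K) (hK : K ≤ K') : HasOne η K' := by
  obtain ⟨b, h1, h2⟩ := h
  exact ⟨b, h1.trans hK, h2.trans (mul_le_mul_of_nonneg_right hK (abs_nonneg _))⟩

theorem HasId.mono {η : ℝ → ℝ} {K K' : ℝ} (h : HasId η K) (hK : K ≤ K') : HasId η K' := by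
  intro Y hY
  obtain ⟨p, u, v, h1, h2, h3, h4⟩ := h Y hY
  exact ⟨p, u, v, fun l => (h1 l).trans (by gcongr), fun l => (h2 l).trans hK,
    fun l => (h3 l).trans hK, h4⟩

theorem HasStep.mono {η : ℝ → ℝ} {K K' : ℝ} (h : HasStep η K) (hK : K ≤ K') : HasStep η K' := by
  intro Y hY
  obtain ⟨p, u, v, h1, h2, h3, h4⟩ := h Y hY
  exact ⟨p, u, v, fun l => (h1 l).trans (by gcongr), fun l => (h2 l).trans (by gcongr),
    fun l => (h3 l).trans (by gcongr), h4⟩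

theorem HasClip.mono {η : ℝ → ℝ} {K K' : ℝ} (h : HasClip η K) (hK : K ≤ K') (h0 : 0 < K) :
    HasClip η K' := by
  intro Y hY
  obtain ⟨p, u, v, h1, h2, h3, h4⟩ := h Y hY
  have hle : 1 / (K' * Y ^ 2) ≤ 1 / (K * Y ^ 2) := by
    apply one_div_le_one_div_of_le
    · positivity
    · gcongr
  exact ⟨p, u, v, fun l => (h1 l).trans (by gcongr), fun l => (h2 l).trans (by gcongr),
    fun l => (h3 l).trans (by gcongr), fun z => ⟨(h4 z).1, (h4 z).2.1,
      fun hz => (h4 z).2.2.1 (hz.trans hle), fun hz => (h4 z).2.2.2 (hz.trans hle)⟩⟩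

theorem exists_hasGadgets_of {η : ℝ → ℝ} (h1 : ∃ K, HasOne η K) (h2 : ∃ K, HasId η K)
    (h3 : ∃ K, HasStep η K) (h4 : ∃ K, 0 < K ∧ HasClip η K) : ∃ K, HasGadgets η K := by
  obtain ⟨K1, h1⟩ := h1
  obtain ⟨K2, h2⟩ := h2
  obtain ⟨K3, h3⟩ := h3
  obtain ⟨K4, h0, h4⟩ := h4
  have e1 := le_abs_self K1
  have e2 := le_abs_self K2
  have e3 := le_abs_self K3
  have e4 := le_abs_self K4
  have f1 := abs_nonneg K1
  have f2 := abs_nonneg K2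
  have f3 := abs_nonneg K3
  have f4 := abs_nonneg K4
  refine ⟨1 + |K1| + |K2| + |K3| + |K4|, by linarith, h1.mono (by linarith), h2.mono (by linarith),
    h3.mono (by linarith), h4.mono (by linarith) h0⟩

/-! ### Gadgets for activations resembling ReLU -/

/-- A combination of two neurons is at bounded distance from `max z 0`. -/
def HasRelu (η : ℝ → ℝ) : Prop :=
  ∃ a₁ a₂ C : ℝ, 1 ≤ C ∧ ∀ z, |a₁ * η z + a₂ * η (-z) - max z 0| ≤ C

/-- `max z 0` is positively homogeneous, so scaling the argument up and the value down by `2 C Y`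
shrinks the bounded error `C` to `1 / (2 Y)`. -/
theorem HasRelu.scaled {η : ℝ → ℝ} {a₁ a₂ C : ℝ} (hC : 1 ≤ C)
    (h : ∀ z, |a₁ * η z + a₂ * η (-z) - max z 0| ≤ C) {Y : ℝ} (hY : 1 ≤ Y) (s t : ℝ) :
    |(a₁ / (2 * C * Y) * η (2 * C * Y * (s * t)) + a₂ / (2 * C * Y) * η (-(2 * C * Y * (s * t)))
      - max (s * t) 0)| ≤ 1 / (2 * Y) := by
  have hR : 0 < 2 * C * Y := by positivity
  have h1 := h (2 * C * Y * (s * t))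
  have h2 : max (2 * C * Y * (s * t)) 0 = 2 * C * Y * max (s * t) 0 := by
    rw [mul_max_of_nonneg _ _ hR.le, mul_zero]
  rw [h2] at h1
  have h3 : a₁ / (2 * C * Y) * η (2 * C * Y * (s * t)) +
      a₂ / (2 * C * Y) * η (-(2 * C * Y * (s * t))) - max (s * t) 0 =
      (a₁ * η (2 * C * Y * (s * t)) + a₂ * η (-(2 * C * Y * (s * t))) -
        2 * C * Y * max (s * t) 0) / (2 * C * Y) := by
    field_simp
  rw [h3, abs_div, abs_of_pos hR, div_le_div_iff₀ hR (by positivity)]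
  nlinarith

/-- The gadget for `max (s z - t) 0 - max (s z - t - 1) 0`. -/
theorem HasRelu.exists_ramp {η : ℝ → ℝ} {a₁ a₂ C : ℝ} (hC : 1 ≤ C)
    (h : ∀ z, |a₁ * η z + a₂ * η (-z) - max z 0| ≤ C) {Y : ℝ} (hY : 1 ≤ Y) (s t : ℝ) (hs : 1 ≤ s)
    (ht : |t| ≤ 1) :
    ∃ p u v : Fin 4 → ℝ, (∀ l, |p l| ≤ |a₁| + |a₂|) ∧ (∀ l, |u l| ≤ 2 * C * Y * s) ∧
      (∀ l, |v l| ≤ 4 * C * Y) ∧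
      ∀ z, |gadget η p u v z - (max (s * z - t) 0 - max (s * z - t - 1) 0)| ≤ 1 / Y := by
  have hR : 1 ≤ 2 * C * Y := by nlinarith
  have hR0 : 0 < 2 * C * Y := by linarith
  have hd : ∀ a : ℝ, |a / (2 * C * Y)| ≤ |a| := by
    intro a
    rw [abs_div, abs_of_pos hR0]
    exact div_le_self (abs_nonneg _) hR
  -- Two neurons for each of the two ramps, at the scale `2 C Y`; each ramp contributes the error `1
  -- / (2 Y)`.
  refine ⟨![a₁ / (2 * C * Y), a₂ / (2 * C * Y), -(a₁ / (2 * C * Y)), -(a₂ / (2 * C * Y))],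
    ![2 * C * Y * s, -(2 * C * Y * s), 2 * C * Y * s, -(2 * C * Y * s)],
    ![-(2 * C * Y * t), 2 * C * Y * t, -(2 * C * Y * (t + 1)), 2 * C * Y * (t + 1)], ?_, ?_, ?_, ?_⟩
  · have h1 := hd a₁
    have h2 := hd a₂
    have h3 := abs_nonneg a₁
    have h4 := abs_nonneg a₂
    intro l
    fin_cases l <;> simp <;> linarith
  · intro l
    have : |2 * C * Y * s| = 2 * C * Y * s := abs_of_pos (by positivity)
    fin_cases l <;> simp only [Fin.zero_eta, Fin.mk_one, Fin.reduceFinMk, Matrix.cons_val,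
      abs_neg] <;> exact this.le
  · intro l
    have h1 : |2 * C * Y * t| ≤ 4 * C * Y := by
      rw [abs_mul, abs_of_pos hR0]; nlinarith
    have h2 : |2 * C * Y * (t + 1)| ≤ 4 * C * Y := by
      rw [abs_mul, abs_of_pos hR0]
      have : |t + 1| ≤ 2 := (abs_add_le _ _).trans (by simpa using (by linarith : |t| + 1 ≤ 2))
      nlinarith
    fin_cases l <;> simp only [Fin.zero_eta, Fin.mk_one, Fin.reduceFinMk, Matrix.cons_val,
      abs_neg] <;> assumption
  · intro z
    have h1 := HasRelu.scaled hC h hY 1 (s * z - t)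
    have h2 := HasRelu.scaled hC h hY 1 (s * z - t - 1)
    simp only [one_mul] at h1 h2
    have e : (1 : ℝ) / Y = 1 / (2 * Y) + 1 / (2 * Y) := by field_simp; norm_num
    rw [e]
    refine le_trans (le_of_eq ?_) ((abs_sub _ _).trans (add_le_add h1 h2))
    congr 1
    unfold gadget
    simp only [Fin.sum_univ_four, Matrix.cons_val]
    rw [show 2 * C * Y * s * z + -(2 * C * Y * t) = 2 * C * Y * (s * z - t) by ring,
      show -(2 * C * Y * s) * z + 2 * C * Y * t = -(2 * C * Y * (s * z - t)) by ring,
      show 2 * C * Y * s * z + -(2 * C * Y * (t + 1)) = 2 * C * Y * (s * z - t - 1) by ring,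
      show -(2 * C * Y * s) * z + 2 * C * Y * (t + 1) = -(2 * C * Y * (s * z - t - 1)) by ring]
    ring

/-- The ramp with slope `Y` that rises from `0` at `z = 0` to `1` at `z = 1 / Y`. -/
theorem HasRelu.hasStep {η : ℝ → ℝ} (h : HasRelu η) : ∃ K, HasStep η K := by
  obtain ⟨a₁, a₂, C, hC, h⟩ := h
  have f1 := abs_nonneg a₁
  have f2 := abs_nonneg a₂
  refine ⟨|a₁| + |a₂| + 4 * C, fun Y hY => ?_⟩
  obtain ⟨p, u, v, h1, h2, h3, h4⟩ := HasRelu.exists_ramp hC h hY Y 0 hY (by simp)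
  have hY2 : Y ≤ Y ^ 2 := by nlinarith
  have hY3 : (|a₁| + |a₂|) * 1 ≤ (|a₁| + |a₂|) * Y ^ 2 := by gcongr; linarith
  refine ⟨p, u, v, fun l => (h1 l).trans (by nlinarith), fun l => (h2 l).trans (by nlinarith),
    fun l => (h3 l).trans (by nlinarith), fun z => ⟨fun hz => ?_, fun hz => ?_⟩⟩
  · have : max (Y * z - 0) 0 - max (Y * z - 0 - 1) 0 = 1 := by
      have h5 : 1 ≤ Y * z := by
        rw [div_le_iff₀ (by linarith)] at hz; linarith
      rw [max_eq_left (by linarith), max_eq_left (by linarith)]; ring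
    have h6 := h4 z
    rwa [this] at h6
  · have : max (Y * z - 0) 0 - max (Y * z - 0 - 1) 0 = 0 := by
      have h5 : Y * z ≤ 0 := by
        have : z ≤ 0 := hz.trans (by simp; linarith)
        nlinarith
      rw [max_eq_right (by linarith), max_eq_right (by linarith)]; ring
    have h6 := h4 z
    rwa [this, sub_zero] at h6

/-- The ramp with slope `2` that rises between `1 / 4` and `3 / 4`: it is constant near `0` and near
`1`, so it tolerates errors of its input. -/
theorem HasRelu.hasClip {η : ℝ → ℝ} (h : HasRelu η) : ∃ K, 0 < K ∧ HasClip η K := by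
  obtain ⟨a₁, a₂, C, hC, h⟩ := h
  have f1 := abs_nonneg a₁
  have f2 := abs_nonneg a₂
  refine ⟨|a₁| + |a₂| + 4 * C, by linarith, fun Y hY => ?_⟩
  obtain ⟨p, u, v, h1, h2, h3, h4⟩ := HasRelu.exists_ramp hC h hY 2 (1 / 2) (by norm_num)
    (by rw [abs_of_pos] <;> norm_num)
  have hY2 : Y ≤ Y ^ 2 := by nlinarith
  have hY3 : (|a₁| + |a₂|) * 1 ≤ (|a₁| + |a₂|) * Y ^ 2 := by gcongr; linarith
  have hK : 1 / ((|a₁| + |a₂| + 4 * C) * Y ^ 2) ≤ 1 / 4 := by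
    apply one_div_le_one_div_of_le (by norm_num)
    nlinarith
  refine ⟨p, u, v, fun l => (h1 l).trans (by nlinarith), fun l => (h2 l).trans (by nlinarith),
    fun l => (h3 l).trans (by nlinarith), fun z => ?_⟩
  have h5 := h4 z
  have h6 : 0 ≤ max (2 * z - 1 / 2) 0 - max (2 * z - 1 / 2 - 1) 0 := by
    have := max_le_max (a := 2 * z - 1 / 2 - 1) (b := 0) (c := 2 * z - 1 / 2) (d := 0)
      (by linarith) le_rfl
    linarith
  have h7 : max (2 * z - 1 / 2) 0 - max (2 * z - 1 / 2 - 1) 0 ≤ 1 := by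
    have : max (2 * z - 1 / 2) 0 ≤ max (2 * z - 1 / 2 - 1) 0 + 1 :=
      max_le (by linarith [le_max_left (2 * z - 1 / 2 - 1) 0])
        (by linarith [le_max_right (2 * z - 1 / 2 - 1) 0])
    linarith
  rw [abs_le] at h5
  refine ⟨by linarith, by linarith, fun hz => ?_, fun hz => ?_⟩
  · have hz' := abs_le.1 (hz.trans hK)
    have : max (2 * z - 1 / 2) 0 - max (2 * z - 1 / 2 - 1) 0 = 1 := by
      rw [max_eq_left (by linarith), max_eq_left (by linarith)]; ring
    rw [this] at h5
    exact abs_le.2 h5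
  · have hz' := abs_le.1 (hz.trans hK)
    have : max (2 * z - 1 / 2) 0 - max (2 * z - 1 / 2 - 1) 0 = 0 := by
      rw [max_eq_right (by linarith), max_eq_right (by linarith)]; ring
    rw [this, sub_zero] at h5
    exact abs_le.2 h5

/-- Both identities are exact: `c₁ η(z) + c₂ η(-z) = (c₁² - c₂²) max z 0` and `η(z) - η(-z) = (c₁ +
c₂) z`. -/
theorem PiecewiseLinearActivation.exists_hasGadgets {η : ℝ → ℝ}
    (h : PiecewiseLinearActivation η) : ∃ K, HasGadgets η K := by
  obtain ⟨c₁, c₂, h0, h1, h⟩ := h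
  have hr : HasRelu η := by
    have hpos : 0 < c₁ ^ 2 - c₂ ^ 2 := by nlinarith
    refine ⟨c₁ / (c₁ ^ 2 - c₂ ^ 2), c₂ / (c₁ ^ 2 - c₂ ^ 2), 1, le_rfl, fun z => ?_⟩
    have : c₁ / (c₁ ^ 2 - c₂ ^ 2) * η z + c₂ / (c₁ ^ 2 - c₂ ^ 2) * η (-z) - max z 0 = 0 := by
      rw [h, h]
      rcases lt_trichotomy z 0 with hz | hz | hz
      · rw [if_neg (by linarith), if_pos (by linarith), max_eq_right hz.le]
        field_simp
        ring
      · simp [hz]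
      · rw [if_pos hz.le, if_neg (by linarith), max_eq_left hz.le]
        field_simp
        ring
    rw [this]; simp
  refine exists_hasGadgets_of ?_ ?_ hr.hasStep hr.hasClip
  · refine ⟨1 + 1 / c₁, 1, ?_, ?_⟩
    · rw [abs_one]
      have : 0 < 1 / c₁ := by apply one_div_pos.2; linarith
      linarith
    · rw [h, if_pos (by norm_num), mul_one, abs_of_pos (by linarith)]
      have : c₁ ≠ 0 := by linarith
      field_simp
      linarith
  · have hpos : 0 < c₁ + c₂ := by linarith
    refine ⟨1 + 1 / (c₁ + c₂), fun Y hY => ⟨![1 / (c₁ + c₂), -(1 / (c₁ + c₂)), 0, 0], ![1, -1, 0, 0],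
      ![0, 0, 0, 0], ?_, ?_, ?_, ?_⟩⟩
    · intro l
      have h2 : 0 < 1 / (c₁ + c₂) := one_div_pos.2 hpos
      have h3 : |1 / (c₁ + c₂)| ≤ (1 + 1 / (c₁ + c₂)) * Y := by
        rw [abs_of_pos h2]; nlinarith
      have h4 : 0 ≤ (1 + 1 / (c₁ + c₂)) * Y := by positivity
      fin_cases l <;> simp only [Fin.zero_eta, Fin.mk_one, Fin.reduceFinMk, Matrix.cons_val,
        abs_neg, abs_zero] <;> assumption
    · intro l
      have h2 : 0 < 1 / (c₁ + c₂) := one_div_pos.2 hpos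
      fin_cases l <;> simp only [Fin.zero_eta, Fin.mk_one, Fin.reduceFinMk, Matrix.cons_val,
        abs_neg, abs_zero, abs_one] <;> linarith
    · intro l
      have h2 : 0 < 1 / (c₁ + c₂) := one_div_pos.2 hpos
      fin_cases l <;> simp only [Fin.zero_eta, Fin.mk_one, Fin.reduceFinMk, Matrix.cons_val,
        abs_zero] <;> linarith
    · intro z _
      have : gadget η ![1 / (c₁ + c₂), -(1 / (c₁ + c₂)), 0, 0] ![1, -1, 0, 0] ![0, 0, 0, 0] z
          - z = 0 := by
        unfold gadget
        simp only [Fin.sum_univ_four, Matrix.cons_val]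
        rw [h, h]
        rcases lt_trichotomy z 0 with hz | hz | hz
        · rw [if_neg (by linarith), if_pos (by linarith)]
          field_simp
          ring
        · simp [hz]
        · rw [if_pos (by linarith), if_neg (by linarith)]
          field_simp
          ring
      rw [this, abs_zero]
      positivity


/-! ### Gadgets for smooth activations -/

theorem abs_taylor_one_le {η : ℝ → ℝ} {K : ℝ} (h0 : Differentiable ℝ η)
    (h1 : Differentiable ℝ (deriv η)) (hK : ∀ x, |deriv (deriv η) x| ≤ K) (a h : ℝ) :
    |η (a + h) - η a - deriv η a * h| ≤ K * h ^ 2 := by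
  have hK0 : 0 ≤ K := (abs_nonneg _).trans (hK a)
  have hl : ∀ x, |deriv η x - deriv η a| ≤ K * |x - a| := fun x =>
    Convex.norm_image_sub_le_of_norm_deriv_le (s := Set.univ) (f := deriv η)
      (fun y _ => h1 y) (fun y _ => hK y) convex_univ (Set.mem_univ a) (Set.mem_univ x)
  have hd : ∀ y, HasDerivAt (fun y => η (a + y) - deriv η a * y) (deriv η (a + y) - deriv η a) y := by
    intro y
    have e1 : HasDerivAt (fun y => η (a + y)) (deriv η (a + y)) y := by
      have := (h0 (a + y)).hasDerivAt.comp_const_add a y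
      exact this
    have e2 : HasDerivAt (fun y => deriv η a * y) (deriv η a) y := by
      simpa using (hasDerivAt_id y).const_mul (deriv η a)
    exact e1.sub e2
  have := Convex.norm_image_sub_le_of_norm_hasDerivWithin_le (s := Set.uIcc 0 h)
    (C := K * |h|) (fun y _ => (hd y).hasDerivWithinAt) (fun y hy => by
      refine (hl (a + y)).trans ?_
      rw [add_sub_cancel_left]
      have : |y| ≤ |h| := by simpa using Set.abs_sub_left_of_mem_uIcc hy
      gcongr) (convex_uIcc 0 h) Set.left_mem_uIcc Set.right_mem_uIcc
  simp only [Real.norm_eq_abs, add_zero, mul_zero, sub_zero] at this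
  refine le_trans (le_of_eq ?_) (this.trans (le_of_eq ?_))
  · congr 1; ring
  · rw [mul_assoc, ← sq, sq_abs]

/-- The difference quotient `(η(a + h z) - η(a)) / (h η'(a))` with `h = 1 / (c Y)` is close to `z`.
For `|z| ≤ 2` its error is at most `4 K h / |η'(a)|`, and `c` is chosen to make this at most `1 /
Y`. Only the output weights grow with `Y`. -/
theorem hasId_of_deriv_ne_zero {η : ℝ → ℝ} {K a : ℝ} (h0 : Differentiable ℝ η)
    (h1 : Differentiable ℝ (deriv η)) (hK : ∀ x, |deriv (deriv η) x| ≤ K)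
    (ha : deriv η a ≠ 0) : ∃ K, HasId η K := by
  have hK0 : 0 ≤ K := (abs_nonneg _).trans (hK a)
  set d := |deriv η a| with hd
  have hd0 : 0 < d := abs_pos.2 ha
  set c := 1 + 4 * K / d with hc
  have hc1 : 1 ≤ c := by
    have : 0 ≤ 4 * K / d := by positivity
    linarith
  have hcd : 4 * K ≤ c * d := by
    rw [hc, add_mul, div_mul_cancel₀ _ hd0.ne']; linarith
  refine ⟨1 + |a| + c / d, fun Y hY => ⟨![c * Y / deriv η a, -(c * Y / deriv η a), 0, 0],
    ![1 / (c * Y), 0, 0, 0], ![a, a, 0, 0], ?_, ?_, ?_, ?_⟩⟩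
  · intro l
    have hcd : 0 ≤ c / d := by positivity
    have e : |c * Y / deriv η a| ≤ (1 + |a| + c / d) * Y := by
      rw [abs_div, abs_of_pos (by positivity : 0 < c * Y), ← hd, mul_div_right_comm]
      have := abs_nonneg a
      nlinarith
    have e' : 0 ≤ (1 + |a| + c / d) * Y := by positivity
    fin_cases l <;> simp only [Fin.zero_eta, Fin.mk_one, Fin.reduceFinMk, Matrix.cons_val,
        abs_neg, abs_zero] <;> assumption
  · intro l
    have hcd : 0 ≤ c / d := by positivity
    have e : |1 / (c * Y)| ≤ 1 := by
      rw [abs_of_pos (by positivity), div_le_one (by positivity)]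
      nlinarith
    have := abs_nonneg a
    fin_cases l <;> simp only [Fin.zero_eta, Fin.mk_one, Fin.reduceFinMk, Matrix.cons_val,
        abs_zero] <;> linarith
  · intro l
    have hcd : 0 ≤ c / d := by positivity
    have := abs_nonneg a
    fin_cases l <;> simp only [Fin.zero_eta, Fin.mk_one, Fin.reduceFinMk, Matrix.cons_val,
        abs_zero] <;> linarith
  · intro z hz
    have e := abs_taylor_one_le h0 h1 hK a (1 / (c * Y) * z)
    have hcY : 0 < c * Y := by positivity
    have e2 : gadget η ![c * Y / deriv η a, -(c * Y / deriv η a), 0, 0]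
        ![1 / (c * Y), 0, 0, 0] ![a, a, 0, 0] z - z =
        c * Y / deriv η a * (η (a + 1 / (c * Y) * z) - η a - deriv η a * (1 / (c * Y) * z)) := by
      unfold gadget
      simp only [Fin.sum_univ_four, Matrix.cons_val]
      rw [add_comm (1 / (c * Y) * z) a, zero_mul, zero_add]
      field_simp
      ring
    rw [e2, abs_mul, abs_div, abs_of_pos hcY, ← hd]
    calc c * Y / d * |η (a + 1 / (c * Y) * z) - η a - deriv η a * (1 / (c * Y) * z)|
        ≤ c * Y / d * (K * (1 / (c * Y) * z) ^ 2) := by gcongr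
      _ = K * |z| ^ 2 / (d * c * Y) := by rw [sq_abs]; field_simp
      _ ≤ K * 2 ^ 2 / (d * c * Y) := by gcongr
      _ ≤ 1 / Y := by
        rw [div_le_div_iff₀ (by positivity) (by linarith)]
        nlinarith

/-- Near-maximizers need not be far away. If the supremum does not exceed both limits at infinity, a
point at distance `C Y` from the origin serves; otherwise the tail bounds confine all points with
values well above the limits to a bounded interval. -/
theorem exists_near_sup {f : ℝ → ℝ} {c₁ c₂ C S : ℝ} (hC : 0 < C)
    (h1 : ∀ x, 0 < x → |f x - c₁| ≤ C / x) (h2 : ∀ x < 0, |f x - c₂| ≤ C / |x|)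
    (hS : IsLUB (Set.range f) S) :
    ∃ K, 0 < K ∧ ∀ Y : ℝ, 1 ≤ Y → ∃ a, |a| ≤ K * Y ∧ S - 1 / Y ≤ f a := by
  by_cases hcase : S ≤ max c₁ c₂
  · refine ⟨C, hC, fun Y hY => ?_⟩
    have hCY : 0 < C * Y := by positivity
    have hdiv : C / (C * Y) = 1 / Y := by field_simp
    rcases le_max_iff.1 hcase with hc | hc
    · refine ⟨C * Y, (abs_of_pos hCY).le, ?_⟩
      have := abs_le.1 (h1 (C * Y) hCY)
      rw [hdiv] at this
      linarith
    · refine ⟨-(C * Y), by rw [abs_neg]; exact (abs_of_pos hCY).le, ?_⟩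
      have := abs_le.1 (h2 (-(C * Y)) (by linarith))
      rw [abs_neg, abs_of_pos hCY, hdiv] at this
      linarith
  · push Not at hcase
    set d := (S - max c₁ c₂) / 2 with hd
    have hd0 : 0 < d := by rw [hd]; linarith
    refine ⟨C / d, by positivity, fun Y hY => ?_⟩
    have hm : 0 < min (1 / Y) d := lt_min (by positivity) hd0
    obtain ⟨_, ⟨a, rfl⟩, ha⟩ := (lt_isLUB_iff hS).1 (show S - min (1 / Y) d < S by linarith)
    refine ⟨a, ?_, by linarith [min_le_left (1 / Y) d]⟩
    have hfa : d ≤ f a - max c₁ c₂ := by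
      have := min_le_right (1 / Y) d
      rw [hd] at this ha ⊢
      linarith
    have hle : |a| ≤ C / d := by
      rcases lt_trichotomy a 0 with h | h | h
      · have h3 := (abs_le.1 (h2 a h)).2
        rw [le_div_iff₀ hd0, mul_comm, ← le_div_iff₀ (abs_pos.2 h.ne)]
        linarith [le_max_right c₁ c₂]
      · rw [h, abs_zero]; positivity
      · have h3 := (abs_le.1 (h1 a h)).2
        rw [le_div_iff₀ hd0, abs_of_pos h, mul_comm, ← le_div_iff₀ h]
        linarith [le_max_left c₁ c₂]
    exact hle.trans (le_mul_of_one_le_right (by positivity) hY)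

section Sigmoid

variable {η : ℝ → ℝ} {cUp cLow C b : ℝ}

/-- `(η(w z) - cLow) / (cUp - cLow)` with `w` of order `Y ^ 2`: for `|z| ≥ 1 / Y` the tail bound
leaves the error `1 / (Y ^ 2 |z|) ≤ 1 / Y`. The constant is produced by a neuron with input weight
`0`. -/
theorem hasStep_of_sigmoid (hC : 0 < C) (hc : cLow < cUp)
    (h1 : ∀ x, 0 < x → |η x - cUp| ≤ C / x) (h2 : ∀ x < 0, |η x - cLow| ≤ C / |x|)
    (hb : η b ≠ 0) : ∃ K, HasStep η K := by
  set Δ := cUp - cLow with hΔ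
  have hΔ0 : 0 < Δ := sub_pos.2 hc
  set e := |cLow / (Δ * η b)| with he
  have he0 : 0 ≤ e := abs_nonneg _
  refine ⟨1 / Δ + e + C / Δ + |b|, fun Y hY => ⟨![1 / Δ, -(cLow / (Δ * η b)), 0, 0],
    ![C * Y ^ 2 / Δ, 0, 0, 0], ![0, b, 0, 0], ?_, ?_, ?_, ?_⟩⟩
  · have a1 : 0 ≤ 1 / Δ := by positivity
    have a2 : 0 ≤ C / Δ := by positivity
    have a3 := abs_nonneg b
    have a4 : 1 ≤ Y ^ 2 := by nlinarith
    have a5 : |1 / Δ| = 1 / Δ := abs_of_nonneg a1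
    intro l
    fin_cases l <;> simp only [Fin.zero_eta, Fin.mk_one, Fin.reduceFinMk, Matrix.cons_val,
        abs_neg, abs_zero, a5, ← he] <;> nlinarith
  · have a1 : 0 ≤ 1 / Δ := by positivity
    have a2 : 0 ≤ C / Δ := by positivity
    have a3 := abs_nonneg b
    have a5 : |C * Y ^ 2 / Δ| = C / Δ * Y ^ 2 := by
      rw [abs_of_nonneg (by positivity)]; ring
    intro l
    fin_cases l <;> simp only [Fin.zero_eta, Fin.mk_one, Fin.reduceFinMk, Matrix.cons_val,
        abs_zero, a5] <;> first | positivity | (gcongr; linarith)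
  · have a1 : 0 ≤ 1 / Δ := by positivity
    have a2 : 0 ≤ C / Δ := by positivity
    have a3 := abs_nonneg b
    have a4 : 1 ≤ Y ^ 2 := by nlinarith
    intro l
    fin_cases l <;> simp only [Fin.zero_eta, Fin.mk_one, Fin.reduceFinMk, Matrix.cons_val,
        abs_zero] <;> nlinarith
  · intro z
    have hg : gadget η ![1 / Δ, -(cLow / (Δ * η b)), 0, 0]
        ![C * Y ^ 2 / Δ, 0, 0, 0] ![0, b, 0, 0] z = (η (C * Y ^ 2 / Δ * z) - cLow) / Δ := by
      unfold gadget
      simp only [Fin.sum_univ_four, Matrix.cons_val]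
      rw [add_zero, zero_mul, zero_add]
      field_simp
      ring
    have key : ∀ w, 1 / Y ≤ w → C / (C * Y ^ 2 / Δ * w) / Δ ≤ 1 / Y := by
      intro w hw
      have hw0 : 0 < w := lt_of_lt_of_le (by positivity) hw
      have : C / (C * Y ^ 2 / Δ * w) / Δ = 1 / (Y * (Y * w)) := by field_simp
      rw [this]
      apply one_div_le_one_div_of_le (by linarith)
      rw [div_le_iff₀ (by linarith)] at hw
      nlinarith
    rw [hg]
    constructor
    · intro hz
      have hz0 : 0 < z := lt_of_lt_of_le (by positivity) hz
      have : (η (C * Y ^ 2 / Δ * z) - cLow) / Δ - 1 = (η (C * Y ^ 2 / Δ * z) - cUp) / Δ := by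
        field_simp; rw [hΔ]; ring
      rw [this, abs_div, abs_of_pos hΔ0]
      refine le_trans ?_ (key z hz)
      gcongr
      exact h1 _ (by positivity)
    · intro hz
      have hz0 : z < 0 := lt_of_le_of_lt hz (by simp; linarith)
      rw [abs_div, abs_of_pos hΔ0]
      refine le_trans ?_ (key (-z) (by linarith))
      have hn : C * Y ^ 2 / Δ * z < 0 := mul_neg_of_pos_of_neg (by positivity) hz0
      have := h2 _ hn
      rw [abs_of_neg hn] at this
      rw [mul_neg]
      gcongr

/-- With `S = sup η` and `T = sup (-η)` the function `(η + T) / (S + T)` has its range in `[0, 1]`.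
An affine substitution sends `0` to a near-minimizer `a₁` and `1` to a near-maximizer `a₂`. Its
slope is of order `Y`, so by the Lipschitz bound inputs may be off by order `1 / Y ^ 2`. -/
theorem hasClip_of_extremes (hb : η b ≠ 0) {K₁ S T KS KT : ℝ} (hK₁ : 0 ≤ K₁)
    (hlip : ∀ x y, |η x - η y| ≤ K₁ * |x - y|) (hSle : ∀ x, η x ≤ S) (hTle : ∀ x, -η x ≤ T)
    (hKS : 0 < KS) (hKT : 0 < KT)
    (hnS : ∀ Y : ℝ, 1 ≤ Y → ∃ a, |a| ≤ KS * Y ∧ S - 1 / Y ≤ η a)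
    (hnT : ∀ Y : ℝ, 1 ≤ Y → ∃ a, |a| ≤ KT * Y ∧ T - 1 / Y ≤ -η a) (hd0 : 0 < S + T) :
    ∃ K, 0 < K ∧ HasClip η K := by
  obtain ⟨d, hd⟩ : ∃ d, d = S + T := ⟨_, rfl⟩
  rw [← hd] at hd0
  -- Near-extrema of accuracy `1 / (c Y) ≤ d / (2 Y)` use half of the error after division by `d`;
  -- the Lipschitz bound uses the other half.
  obtain ⟨c, hcdef⟩ : ∃ c, c = 1 + 2 / d := ⟨_, rfl⟩
  have hc1 : 1 ≤ c := by
    have : 0 < 2 / d := by positivity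
    linarith
  have hcd : 2 ≤ c * d := by
    rw [hcdef, add_mul, div_mul_cancel₀ _ hd0.ne']; linarith
  obtain ⟨Ka, hKa⟩ : ∃ Ka, Ka = (KS + KT) * c := ⟨_, rfl⟩
  have hc0 : 0 < c := by linarith
  have hKa0 : 0 < Ka := by rw [hKa]; positivity
  obtain ⟨e, he⟩ : ∃ e, e = |T / (d * η b)| := ⟨_, rfl⟩
  have he0 : 0 ≤ e := he ▸ abs_nonneg _
  obtain ⟨K, hK⟩ : ∃ K, K = 1 / d + e + Ka + |b| + 1 + 2 * K₁ * Ka / d := ⟨_, rfl⟩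
  have q1 : 0 < 1 / d := by positivity
  have q2 : 0 ≤ 2 * K₁ * Ka / d := by positivity
  have q3 := abs_nonneg b
  have hK0 : 0 < K := by rw [hK]; linarith
  have k1 : 1 / d ≤ K := by rw [hK]; linarith
  have k2 : e ≤ K := by rw [hK]; linarith
  have k3 : Ka ≤ K := by rw [hK]; linarith
  have k4 : |b| ≤ K := by rw [hK]; linarith
  have k5 : 2 * K₁ * Ka / d ≤ K := by rw [hK]; linarith
  refine ⟨K, hK0, fun Y hY => ?_⟩
  have hY2 : Y ≤ Y ^ 2 := by nlinarith
  have hY1 : 1 ≤ Y ^ 2 := by nlinarith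
  have hcY : 1 ≤ c * Y := by nlinarith
  obtain ⟨a₂, ha₂, hfa₂⟩ := hnS (c * Y) hcY
  obtain ⟨a₁, ha₁, hfa₁⟩ := hnT (c * Y) hcY
  have hinv : 1 / (c * Y) ≤ d / (2 * Y) := by
    rw [div_le_div_iff₀ (by positivity) (by positivity)]
    nlinarith
  have hdiff : |a₂ - a₁| ≤ Ka * Y := by
    refine (abs_sub _ _).trans ?_
    rw [hKa]; nlinarith
  have hg : ∀ z, gadget η ![1 / d, T / (d * η b), 0, 0] ![a₂ - a₁, 0, 0, 0] ![a₁, b, 0, 0] z =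
      (η ((a₂ - a₁) * z + a₁) + T) / d := by
    intro z
    unfold gadget
    simp only [Fin.sum_univ_four, Matrix.cons_val]
    rw [zero_mul, zero_add]
    field_simp
    ring
  have hYinv : 0 < 1 / Y := by positivity
  have hclose : ∀ w, |w| ≤ 1 / (K * Y ^ 2) → K₁ * |(a₂ - a₁) * w| ≤ d / (2 * Y) := by
    intro w hw
    rw [abs_mul]
    calc K₁ * (|a₂ - a₁| * |w|) ≤ K₁ * (Ka * Y * (1 / (K * Y ^ 2))) := by gcongr
      _ = K₁ * Ka / (K * Y) := by field_simp
      _ ≤ d / (2 * Y) := by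
        rw [div_le_div_iff₀ (by positivity) (by positivity)]
        have : 2 * K₁ * Ka ≤ K * d := by
          rwa [div_le_iff₀ hd0] at k5
        nlinarith
  refine ⟨![1 / d, T / (d * η b), 0, 0], ![a₂ - a₁, 0, 0, 0], ![a₁, b, 0, 0], ?_, ?_, ?_, ?_⟩
  · have a5 : |1 / d| = 1 / d := abs_of_pos q1
    intro l
    refine le_trans ?_ (le_mul_of_one_le_right hK0.le hY1)
    fin_cases l <;> simp only [Fin.zero_eta, Fin.mk_one, Fin.reduceFinMk, Matrix.cons_val,
        abs_zero, a5, ← he] <;> first | assumption | exact hK0.le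
  · intro l
    have : |a₂ - a₁| ≤ K * Y ^ 2 := hdiff.trans (by gcongr)
    fin_cases l <;> simp only [Fin.zero_eta, Fin.mk_one, Fin.reduceFinMk, Matrix.cons_val,
        abs_zero] <;> first | assumption | positivity
  · intro l
    have e1 : |a₁| ≤ K * Y ^ 2 := ha₁.trans (by
      have e3 : KT * c ≤ Ka := by rw [hKa]; nlinarith
      calc KT * (c * Y) = (KT * c) * Y := by ring
        _ ≤ K * Y ^ 2 := by gcongr; linarith)
    have e2 : |b| ≤ K * Y ^ 2 := by
      exact k4.trans (le_mul_of_one_le_right hK0.le hY1)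
    fin_cases l <;> simp only [Fin.zero_eta, Fin.mk_one, Fin.reduceFinMk, Matrix.cons_val,
        abs_zero] <;> first | assumption | positivity
  · intro z
    rw [hg]
    have hlow : 0 ≤ (η ((a₂ - a₁) * z + a₁) + T) / d :=
      div_nonneg (by linarith [hTle ((a₂ - a₁) * z + a₁)]) hd0.le
    have hup : (η ((a₂ - a₁) * z + a₁) + T) / d ≤ 1 := by
      rw [div_le_one hd0]; linarith [hSle ((a₂ - a₁) * z + a₁)]
    refine ⟨by linarith, by linarith, fun hz => ?_, fun hz => ?_⟩
    · rw [abs_le]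
      refine ⟨?_, by linarith⟩
      have e0 := hlip ((a₂ - a₁) * z + a₁) a₂
      rw [show (a₂ - a₁) * z + a₁ - a₂ = (a₂ - a₁) * (z - 1) by ring] at e0
      have e1 := (abs_le.1 (e0.trans (hclose _ hz))).1
      have e3 : 1 - 1 / Y ≤ (η ((a₂ - a₁) * z + a₁) + T) / d := by
        rw [le_div_iff₀ hd0]
        have : (1 - 1 / Y) * d = d - (d / (2 * Y) + d / (2 * Y)) := by field_simp; ring
        linarith
      linarith
    · rw [abs_of_nonneg hlow, div_le_iff₀ hd0]
      have e0 := hlip ((a₂ - a₁) * z + a₁) a₁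
      rw [add_sub_cancel_right] at e0
      have e1 := (abs_le.1 (e0.trans (hclose _ hz))).2
      have : 1 / Y * d = d / (2 * Y) + d / (2 * Y) := by field_simp; norm_num
      linarith

theorem hasClip_of_sigmoid (hC : 0 < C) (hc : cLow < cUp)
    (h1 : ∀ x, 0 < x → |η x - cUp| ≤ C / x) (h2 : ∀ x < 0, |η x - cLow| ≤ C / |x|)
    (hb : η b ≠ 0) {K₀ K₁ : ℝ} (hbd : ∀ x, |η x| ≤ K₀) (hK₁ : 0 ≤ K₁)
    (hlip : ∀ x y, |η x - η y| ≤ K₁ * |x - y|) : ∃ K, 0 < K ∧ HasClip η K := by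
  obtain ⟨S, hS⟩ : ∃ S, IsLUB (Set.range η) S :=
    ⟨_, isLUB_csSup (Set.range_nonempty η) ⟨K₀, by
      rintro _ ⟨x, rfl⟩; exact (abs_le.1 (hbd x)).2⟩⟩
  obtain ⟨T, hT⟩ : ∃ T, IsLUB (Set.range fun x => -η x) T :=
    ⟨_, isLUB_csSup (Set.range_nonempty _) ⟨K₀, by
      rintro _ ⟨x, rfl⟩; exact neg_le.1 (abs_le.1 (hbd x)).1⟩⟩
  have hSle : ∀ x, η x ≤ S := fun x => hS.1 ⟨x, rfl⟩
  have hTle : ∀ x, -η x ≤ T := fun x => hT.1 ⟨x, rfl⟩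
  obtain ⟨KS, hKS, hnS⟩ := exists_near_sup hC h1 h2 hS
  obtain ⟨KT, hKT, hnT⟩ := exists_near_sup (f := fun x => -η x) (c₁ := -cUp) (c₂ := -cLow) hC
    (fun x hx => by
      have := h1 x hx
      rwa [← abs_neg, show -(η x - cUp) = -η x - -cUp by ring] at this)
    (fun x hx => by
      have := h2 x hx
      rwa [← abs_neg, show -(η x - cLow) = -η x - -cLow by ring] at this) hT
  set d := S + T with hd
  have hd0 : 0 < d := by
    -- At `w` and `-w` the values are within a quarter of the gap from the two limits, so `η` is not
    -- constant.
    set w := 4 * C / (cUp - cLow) with hw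
    have hw0 : 0 < w := div_pos (by positivity) (sub_pos.2 hc)
    have hCw : C / w = (cUp - cLow) / 4 := by
      rw [hw]; have := (sub_pos.2 hc).ne'; field_simp
    have e1 := (abs_le.1 (h1 w hw0)).1
    have e2 := (abs_le.1 (h2 (-w) (by linarith))).2
    rw [abs_neg, abs_of_pos hw0] at e2
    rw [hCw] at e1 e2
    linarith [hSle w, hTle (-w)]
  exact hasClip_of_extremes hb hK₁ hlip hSle hTle hKS hKT hnS hnT hd0

end Sigmoid

/-- Since `q ≥ 1`, the asymptotic bound is at least as strong as `|c| / x` beyond some `Z`; on `(0,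
Z]` the a priori bound takes over. -/
theorem exists_tail_bound {f : ℝ → ℝ} {q : ℝ} (hq : 1 ≤ q) {M : ℝ} (hM : ∀ x, 0 < x → |f x| ≤ M * (1 + x))
    (h : f =O[atTop] fun x => 1 / x ^ q) :
    (∃ C, 0 < C ∧ ∀ x, 0 < x → |f x| ≤ C) ∧
      ((∀ x, 0 < x → |f x| ≤ M) → ∃ C, 0 < C ∧ ∀ x, 0 < x → |f x| ≤ C / x) := by
  obtain ⟨c, hc⟩ := h.bound
  obtain ⟨X, hX⟩ := eventually_atTop.1 hc
  set Z := max X 1 with hZ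
  have hZ1 : 1 ≤ Z := le_max_right _ _
  have hM0 : 0 ≤ M := by
    have := (abs_nonneg _).trans (hM 1 one_pos); linarith
  have hbig : ∀ x, Z ≤ x → |f x| ≤ |c| / x := by
    intro x hx
    have hx1 : 1 ≤ x := hZ1.trans hx
    have h1 := hX x ((le_max_left _ _).trans hx)
    rw [Real.norm_eq_abs, Real.norm_eq_abs] at h1
    refine h1.trans ?_
    have h2 : x ≤ x ^ q := by
      simpa using Real.rpow_le_rpow_of_exponent_le hx1 hq
    have h3 : |1 / x ^ q| ≤ 1 / x := by
      rw [abs_of_pos (by positivity)]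
      exact one_div_le_one_div_of_le (by linarith) h2
    calc c * |1 / x ^ q| ≤ |c| * (1 / x) := by
          gcongr
          exact le_abs_self c
      _ = |c| / x := by ring
  have hc0 := abs_nonneg c
  refine ⟨⟨|c| + M * (1 + Z) + 1, by positivity, fun x hx => ?_⟩, fun hb =>
    ⟨|c| + M * Z + 1, by positivity, fun x hx => ?_⟩⟩
  · rcases le_total Z x with hx' | hx'
    · have : |c| / x ≤ |c| := div_le_self hc0 (hZ1.trans hx')
      have := hbig x hx'
      have : 0 ≤ M * (1 + Z) := by positivity
      linarith
    · have := hM x hx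
      have : M * (1 + x) ≤ M * (1 + Z) := by gcongr
      linarith
  · rcases le_total Z x with hx' | hx'
    · refine (hbig x hx').trans ?_
      gcongr
      have : 0 ≤ M * Z := by positivity
      linarith
    · rw [le_div_iff₀ hx]
      have : |f x| * x ≤ M * Z := by
        gcongr
        exact hb x hx
      linarith

/-- For `k = 0` the activation is a sigmoid with tails `O(1 / x)`. For `k = 1` the function `η /
cUp` is at bounded distance from `max z 0`, so the ramps apply. The identity comes from a point with
non-zero first derivative in both cases. -/
theorem SmoothActivation.exists_hasGadgets {N : ℕ} {η : ℝ → ℝ} (hN : 1 ≤ N)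
    (h : SmoothActivation N η) : ∃ K, HasGadgets η K := by
  obtain ⟨hdiff, hbd, ⟨x', c, hc, hx'⟩, q, hq, k, hk, ⟨cUp, cLow, hc0, hcc, hup, hlow⟩, CK, hCK,
    hηb⟩ := h
  have h0 : Differentiable ℝ η := by simpa using hdiff 0 (by omega)
  have h1 : Differentiable ℝ (deriv η) := by simpa [iteratedDeriv_one] using hdiff 1 hN
  obtain ⟨K₁, hK₁⟩ := hbd 1 le_rfl (by omega)
  obtain ⟨K₂, hK₂⟩ := hbd 2 (by omega) (by omega)
  rw [iteratedDeriv_one] at hK₁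
  rw [iteratedDeriv_succ, iteratedDeriv_one] at hK₂
  have hx0 : deriv η x' ≠ 0 := by
    have := hx' 1 le_rfl hN
    rw [iteratedDeriv_one] at this
    exact abs_pos.1 (hc.trans_le this)
  have hId := hasId_of_deriv_ne_zero h0 h1 hK₂ hx0
  have hlip : ∀ x y, |η x - η y| ≤ K₁ * |x - y| := fun x y =>
    Convex.norm_image_sub_le_of_norm_deriv_le (s := Set.univ) (f := η)
      (fun y _ => h0 y) (fun y _ => hK₁ y) convex_univ (Set.mem_univ y) (Set.mem_univ x)
  have hK₁0 : 0 ≤ K₁ := (abs_nonneg _).trans (hK₁ 0)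
  have hcUp : 0 < cUp := hc0.trans_lt hcc
  have hlow' : (fun x => η (-x) - cLow) =O[atTop] fun x => 1 / x ^ q := by
    have := hlow.comp_tendsto tendsto_neg_atTop_atBot
    refine this.trans (IsBigO.of_bound 1 ?_)
    filter_upwards [eventually_gt_atTop 0] with x hx
    simp [abs_of_pos hx]
  have hηb' : ∀ x, |η x| ≤ 2 * CK * (1 + |x|) := by
    intro x
    refine (hηb x).trans ?_
    have := abs_nonneg x
    rcases hk with rfl | rfl
    · rw [pow_zero]; nlinarith
    · rw [pow_one]; nlinarith
  have hOne : (∃ b, η b ≠ 0) → ∃ K, HasOne η K := by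
    rintro ⟨b, hb⟩
    refine ⟨|b| + 1 / |η b|, b, ?_, ?_⟩
    · have : 0 < 1 / |η b| := by positivity
      linarith
    · have h2 : 0 < |η b| := abs_pos.2 hb
      rw [add_mul, div_mul_cancel₀ _ h2.ne']
      have := abs_nonneg b
      nlinarith
  rcases hk with rfl | rfl
  · simp only [pow_zero, mul_one] at hup hηb
    set M := 2 * CK + cUp with hM
    have b1 : ∀ x, 0 < x → |η x - cUp| ≤ M := fun x _ => by
      refine (abs_sub _ _).trans ?_
      rw [abs_of_pos hcUp]; linarith [hηb x]
    have b2 : ∀ x, 0 < x → |η (-x) - cLow| ≤ M := fun x _ => by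
      refine (abs_sub _ _).trans ?_
      rw [abs_of_nonneg hc0]; linarith [hηb (-x)]
    have hM0 : 0 ≤ M := (abs_nonneg _).trans (b1 1 one_pos)
    obtain ⟨C₁, hC₁, t1⟩ := (exists_tail_bound hq (M := M) (fun x hx => (b1 x hx).trans
      (le_mul_of_one_le_right hM0 (by linarith))) hup).2 b1
    obtain ⟨C₂, hC₂, t2⟩ := (exists_tail_bound hq (M := M) (fun x hx => (b2 x hx).trans
      (le_mul_of_one_le_right hM0 (by linarith))) hlow').2 b2
    have u1 : ∀ x, 0 < x → |η x - cUp| ≤ (C₁ + C₂) / x := fun x hx => (t1 x hx).trans (by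
      gcongr; linarith)
    have u2 : ∀ x < 0, |η x - cLow| ≤ (C₁ + C₂) / |x| := fun x hx => by
      have := t2 (-x) (by linarith)
      rw [neg_neg] at this
      rw [abs_of_neg hx]
      refine this.trans ?_
      have : 0 < -x := by linarith
      gcongr; linarith
    have hb : ∃ b, η b ≠ 0 := by
      refine ⟨2 * C₁ / cUp, fun h => ?_⟩
      have := t1 (2 * C₁ / cUp) (by positivity)
      rw [h, zero_sub, abs_neg, abs_of_pos hcUp,
        show C₁ / (2 * C₁ / cUp) = cUp / 2 by field_simp] at this
      linarith
    obtain ⟨b, hb'⟩ := hb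
    exact exists_hasGadgets_of (hOne ⟨b, hb'⟩) hId
      (hasStep_of_sigmoid (by positivity) hcc u1 u2 hb')
      (hasClip_of_sigmoid (by positivity) hcc u1 u2 hb' hηb hK₁0 hlip)
  · simp only [pow_one] at hup
    obtain ⟨⟨C₁, hC₁, t1⟩, -⟩ := exists_tail_bound hq (M := 2 * CK + cUp) (fun x hx => by
      refine (abs_sub _ _).trans ?_
      have := hηb' x
      rw [abs_of_pos hx] at this
      rw [abs_of_pos (by positivity : 0 < cUp * x)]
      nlinarith) hup
    obtain ⟨⟨C₂, hC₂, t2⟩, -⟩ := exists_tail_bound hq (M := 2 * CK + cLow) (fun x hx => by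
      refine (abs_sub _ _).trans ?_
      have := hηb' (-x)
      rw [abs_neg, abs_of_pos hx] at this
      rw [abs_of_nonneg hc0]
      nlinarith) hlow'
    have hr : HasRelu η := by
      refine ⟨1 / cUp, 0, 1 + (C₁ + C₂ + cLow + |η 0|) / cUp, ?_, fun z => ?_⟩
      · have : 0 ≤ (C₁ + C₂ + cLow + |η 0|) / cUp := by positivity
        linarith
      · have e : 1 / cUp * η z + 0 * η (-z) - max z 0 = (η z - cUp * max z 0) / cUp := by
          field_simp; ring
        rw [e, abs_div, abs_of_pos hcUp]
        have : |η z - cUp * max z 0| ≤ C₁ + C₂ + cLow + |η 0| := by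
          have := abs_nonneg (η 0)
          rcases lt_trichotomy z 0 with hz | hz | hz
          · rw [max_eq_right hz.le, mul_zero, sub_zero]
            have h3 := t2 (-z) (by linarith)
            rw [neg_neg] at h3
            have h4 := abs_add_le (η z - cLow) cLow
            rw [sub_add_cancel, abs_of_nonneg hc0] at h4
            linarith
          · simp [hz]; linarith
          · rw [max_eq_left hz.le]
            linarith [t1 z hz]
        have h5 : |η z - cUp * max z 0| / cUp ≤ (C₁ + C₂ + cLow + |η 0|) / cUp := by gcongr
        linarith
    refine exists_hasGadgets_of (hOne ⟨2 * C₁ / cUp, fun h => ?_⟩) hId hr.hasStep hr.hasClip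
    have := t1 (2 * C₁ / cUp) (by positivity)
    rw [h, zero_sub, abs_neg, show cUp * (2 * C₁ / cUp) = 2 * C₁ by field_simp,
      abs_of_pos (by positivity)] at this
    linarith

theorem ActivationAssumption.exists_hasGadgets {N : ℕ} {η : ℝ → ℝ} (hN : 1 ≤ N)
    (h : ActivationAssumption N η) : ∃ K, HasGadgets η K :=
  h.elim (fun h => h.exists_hasGadgets hN) fun h => h.exists_hasGadgets


/-! ### Simulation of threshold circuits by networks -/

open Classical in
/-- One more hidden layer on top of `m` copies of each of the neurons `v`. The signals are the
combinations `∑ l, p j l * v (j, l)`, one of which is the constant `1`. -/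
theorem Hidden.layer {η : ℝ → ℝ} {B : ℝ} (hB : 0 ≤ B) {D m : ℕ} (hm : 1 ≤ m) {σ τ A : Type}
    [Fintype σ] [Fintype τ] [Fintype A] {v : σ × Fin 4 → (Fin D → ℝ) → ℝ} {l s : ℕ}
    (h : Hidden η B (fun q : Fin m × (σ × Fin 4) => v q.2) l s) {P Φ : ℝ} (hP : 0 ≤ P)
    (hPB : P * (Φ + 1) * P ≤ m * B) (p : σ → Fin 4 → ℝ) (hp : ∀ j r, |p j r| ≤ P) (o : σ)
    (ho : ∀ x, ∑ r, p o r * v (o, r) x = 1) (i : τ → A → σ) (c : τ → A → ℝ)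
    (hc : ∀ t, ∑ a, |c t a| ≤ Φ) (u w : τ → Fin 4 → ℝ) (hu : ∀ t r, |u t r| ≤ P)
    (hw : ∀ t r, |w t r| ≤ P) (cnt : ℕ)
    (hcnt : ∑ t, (insert o (Finset.univ.image (i t))).card ≤ cnt) :
    Hidden η B (fun (q : Fin m × (τ × Fin 4)) x =>
      η (u q.2.1 q.2.2 * (∑ a, c q.2.1 a * ∑ r, p (i q.2.1 a) r * v (i q.2.1 a, r) x) + w q.2.1 q.2.2))
      (l + 1) (s + 16 * m ^ 2 * cnt) := by
  have hm0 : (0 : ℝ) < m := by exact_mod_cast hm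
  -- The total coefficient of the signal `j` in the input of `t`; the index map `i t` need not be
  -- injective.
  let W : τ → σ → ℝ := fun t j => ∑ a, if i t a = j then c t a else 0
  -- Every signal is read as the average of its `m` copies. The bias `w` is carried by the constant
  -- signal `o`, so it is divided by `m` as well.
  let M : Fin m × (τ × Fin 4) → Fin m × (σ × Fin 4) → ℝ := fun q q' =>
    (u q.2.1 q.2.2 * W q.2.1 q'.2.1 + if q'.2.1 = o then w q.2.1 q.2.2 else 0) *
      p q'.2.1 q'.2.2 / m
  have hWle : ∀ t j, |W t j| ≤ Φ := by
    intro t j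
    refine (Finset.abs_sum_le_sum_abs _ _).trans (le_trans ?_ (hc t))
    refine Finset.sum_le_sum fun a _ => ?_
    split_ifs <;> simp
  have hM : ∀ q q', |M q q'| ≤ B := by
    intro q q'
    have h1 : |u q.2.1 q.2.2 * W q.2.1 q'.2.1 + if q'.2.1 = o then w q.2.1 q.2.2 else 0| ≤
        P * (Φ + 1) := by
      refine (abs_add_le _ _).trans ?_
      rw [abs_mul, mul_add, mul_one]
      refine add_le_add (mul_le_mul (hu _ _) (hWle _ _) (abs_nonneg _) hP) ?_
      split_ifs
      · exact hw _ _
      · simpa using hP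
    simp only [M]
    rw [abs_div, abs_of_pos hm0, div_le_iff₀ hm0, abs_mul, mul_comm B]
    exact (mul_le_mul h1 (hp _ _) (abs_nonneg _) ((abs_nonneg _).trans h1)).trans hPB
  have hsupp : supportCard M ≤ 16 * m ^ 2 * cnt := by
    have hW0 : ∀ t j, j ∉ insert o (Finset.univ.image (i t)) → W t j = 0 := by
      intro t j hj
      refine Finset.sum_eq_zero fun a _ => if_neg fun haj => hj ?_
      exact Finset.mem_insert_of_mem (Finset.mem_image.2 ⟨a, Finset.mem_univ _, haj⟩)
    -- A non-zero entry is determined by the copies and gadget slots at its two ends, `16 m ^ 2`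
    -- choices, and by a pair `(t, j)` where `j` is `o` or an input of `t`.
    have h1 : supportCard M ≤ ((Finset.univ : Finset ((Fin m × Fin 4) × (Fin m × Fin 4))) ×ˢ
        (Finset.univ.sigma fun t => insert o (Finset.univ.image (i t)))).card := by
      unfold supportCard
      refine Finset.card_le_card_of_injOn (fun z => (((z.1.1, z.1.2.2), (z.2.1, z.2.2.2)),
        ⟨z.1.2.1, z.2.2.1⟩)) ?_ ?_
      · rintro ⟨⟨a, t, r⟩, a', j, r'⟩ hz
        have hz' := (Finset.mem_filter.1 (Finset.mem_coe.1 hz)).2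
        refine Finset.mem_coe.2 (Finset.mem_product.2 ⟨Finset.mem_univ _,
          Finset.mem_sigma.2 ⟨Finset.mem_univ _, ?_⟩⟩)
        by_contra hj
        apply hz'
        simp only at hj
        have hjo : j ≠ o := fun h => hj (h ▸ Finset.mem_insert_self _ _)
        simp [M, hW0 t j hj, hjo]
      · rintro ⟨⟨a, t, r⟩, a', j, r'⟩ _ ⟨⟨b, t', k⟩, b', j', k'⟩ _ hz
        simp only [Prod.mk.injEq, Sigma.mk.injEq] at hz
        obtain ⟨⟨⟨rfl, rfl⟩, rfl, rfl⟩, rfl, hz⟩ := hz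
        cases hz
        rfl
    refine h1.trans ?_
    rw [Finset.card_product, Finset.card_sigma]
    refine Nat.mul_le_mul (le_of_eq ?_) hcnt
    simp only [Finset.card_univ, Fintype.card_prod, Fintype.card_fin]
    ring
  have h2 := h.step hB M hM
  have h3 : Hidden η B (fun (q : Fin m × (τ × Fin 4)) x =>
      η (∑ q', M q q' * v q'.2 x)) (l + 1) (s + 16 * m ^ 2 * cnt) := by
    intro rest hrest
    obtain ⟨N, e1, e2, e3, e4⟩ := h2 rest hrest
    exact ⟨N, e1, e2, e3.trans (by omega), e4⟩
  convert h3 using 3 with q x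
  congr 1
  rw [Fintype.sum_prod_type]
  change _ = ∑ _c : Fin m, ∑ y, M q (q.1, y) * v y x
  rw [Finset.sum_const, Finset.card_univ, Fintype.card_fin, nsmul_eq_mul, Fintype.sum_prod_type]
  have h4 : ∀ j, (m : ℝ) * ∑ r, M q (q.1, (j, r)) * v (j, r) x =
      (u q.2.1 q.2.2 * W q.2.1 j + if j = o then w q.2.1 q.2.2 else 0) *
        ∑ r, p j r * v (j, r) x := by
    intro j
    rw [Finset.mul_sum, Finset.mul_sum]
    refine Finset.sum_congr rfl fun r _ => ?_
    simp only [M]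
    field_simp
  refine Eq.symm ((Finset.mul_sum _ _ _).trans ((Finset.sum_congr rfl fun j _ => h4 j).trans ?_))
  simp only [add_mul, Finset.sum_add_distrib, ite_mul, zero_mul, Finset.sum_ite_eq',
    Finset.mem_univ, if_true, ho, mul_one]
  congr 1
  simp only [mul_assoc, ← Finset.mul_sum]
  congr 1
  simp only [W, Finset.sum_mul, ite_mul, zero_mul]
  rw [Finset.sum_comm]
  refine Finset.sum_congr rfl fun a _ => ?_
  simp

/-- The data and the tolerances of a network that simulates threshold circuits on the good set
`G`: every signal is carried by `m` copies of a gadget with weights at most `P`. -/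
structure Frame (D : ℕ) (η : ℝ → ℝ) where
  G : Set (Fin D → ℝ)
  m : ℕ
  B : ℝ
  κ : ℝ
  Φ : ℝ
  δ : ℝ
  P : ℝ
  depth : ℕ
  one_le_m : 1 ≤ m
  B_nonneg : 0 ≤ B
  κ_pos : 0 < κ
  κ_le : κ ≤ 1 / 2
  δ_nonneg : 0 ≤ δ
  le_Φ : 3 / 2 ≤ Φ
  P_nonneg : 0 ≤ P
  weights : P * (Φ + 1) * P ≤ m * B
  small : Φ * (depth * δ) ≤ κ / 2
  cube : ∀ x ∈ G, ∀ d, |x d| ≤ 1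
  one : ∃ p v : Fin 4 → ℝ, (∀ r, |p r| ≤ P) ∧ (∀ r, |v r| ≤ P) ∧ (∀ r, |v r| ≤ B) ∧
    ∀ z, gadget η p 0 v z = 1
  ident : ∃ p u v : Fin 4 → ℝ, (∀ r, |p r| ≤ P) ∧ (∀ r, |u r| ≤ P) ∧ (∀ r, |v r| ≤ P) ∧
    (∀ r, |u r| ≤ B) ∧ (∀ r, |v r| ≤ B) ∧ ∀ z, |z| ≤ 2 → |gadget η p u v z - z| ≤ δ
  step : ∃ p u v : Fin 4 → ℝ, (∀ r, |p r| ≤ P) ∧ (∀ r, |u r| ≤ P) ∧ (∀ r, |v r| ≤ P) ∧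
    ∀ z, (κ / 2 ≤ z → |gadget η p u v z - 1| ≤ δ) ∧ (z ≤ -(κ / 2) → |gadget η p u v z| ≤ δ)

/-- The signals of a circuit: the constant `1`, the coordinates, and the bits. -/
def idxVal {D : ℕ} {ι : Type} (β : ι → (Fin D → ℝ) → ℝ) : Option (Fin D ⊕ ι) → (Fin D → ℝ) → ℝ
  | none, _ => 1
  | some (.inl d), x => x d
  | some (.inr i), x => β i x

namespace Frame

variable {D : ℕ} {η : ℝ → ℝ} (F : Frame D η)

/-- The bits `β` are available after `l` hidden layers with at most `s` parameters. -/
def TC {ι : Type} (β : ι → (Fin D → ℝ) → ℝ) (l s : ℕ) : Prop :=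
  (∀ x ∈ F.G, ∀ i, β i x = 0 ∨ β i x = 1) ∧
  ∃ (τ : Type) (_ : Fintype τ) (β₀ : τ → (Fin D → ℝ) → ℝ) (g : ι → τ)
    (p : Option (Fin D ⊕ τ) → Fin 4 → ℝ)
    (v : Option (Fin D ⊕ τ) × Fin 4 → (Fin D → ℝ) → ℝ),
    Hidden η F.B (fun q : Fin F.m × (Option (Fin D ⊕ τ) × Fin 4) => v q.2) l s ∧
    (∀ j r, |p j r| ≤ F.P) ∧ (∀ x, ∑ r, p none r * v (none, r) x = 1) ∧
    (∀ x ∈ F.G, ∀ j, |∑ r, p j r * v (j, r) x - idxVal β₀ j x| ≤ l * F.δ) ∧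
    ∀ x ∈ F.G, ∀ i, β i x = β₀ (g i) x

/-- The cost of a unit of circuit size. -/
def Q : ℕ := 48 * F.m ^ 2

variable {F}

/-- Bits are read from the computed signals through a map of indices, so permuting, repeating or
forgetting bits, or changing them off the good set, costs nothing. -/
theorem TC.reindex {ι κ : Type} {β : ι → (Fin D → ℝ) → ℝ} {l s : ℕ} (h : F.TC β l s) (f : κ → ι)
    {β' : κ → (Fin D → ℝ) → ℝ} (hβ : ∀ x ∈ F.G, ∀ i, β' i x = β (f i) x) : F.TC β' l s := by
  obtain ⟨h0, τ, hτ, β₀, g, p, v, h1, h2, h3, h4, h5⟩ := h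
  refine ⟨fun x hx i => ?_, τ, hτ, β₀, g ∘ f, p, v, h1, h2, h3, h4, fun x hx i => ?_⟩
  · rw [hβ x hx i]; exact h0 x hx _
  · rw [hβ x hx i]; exact h5 x hx _

theorem TC.mono {ι : Type} {β : ι → (Fin D → ℝ) → ℝ} {l s s' : ℕ} (h : F.TC β l s) (hs : s ≤ s') :
    F.TC β l s' := by
  obtain ⟨h0, τ, hτ, β₀, g, p, v, h1, h2, h3, h4, h5⟩ := h
  refine ⟨h0, τ, hτ, β₀, g, p, v, fun rest hrest => ?_, h2, h3, h4, h5⟩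
  obtain ⟨N, e1, e2, e3, e4⟩ := h1 rest hrest
  exact ⟨N, e1, e2, e3.trans (by omega), e4⟩

variable (F) in
-- The first layer provides the constant and the coordinates. Its weights act on the raw inputs and
-- are not averaged over copies, so they must be at most `B` themselves.
theorem TC.init : F.TC (fun (i : Empty) _ => i.elim) 1 (F.Q * (D + 1)) := by
  classical
  obtain ⟨pO, vO, o1, o2, o3, o4⟩ := F.one
  obtain ⟨pI, uI, vI, i1, i2, i3, i4, i5, i6⟩ := F.ident
  let p : Option (Fin D ⊕ Empty) → Fin 4 → ℝ := fun j => if j = none then pO else pI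
  let b : Option (Fin D ⊕ Empty) → Fin 4 → ℝ := fun j => if j = none then vO else vI
  let A : Fin F.m × (Option (Fin D ⊕ Empty) × Fin 4) → Fin D → ℝ := fun q d =>
    if q.2.1 = some (.inl d) then uI q.2.2 else 0
  refine ⟨fun x _ i => i.elim, Empty, inferInstance, fun i _ => i.elim, id, p,
    fun q x => η (∑ d, (if q.1 = some (.inl d) then uI q.2 else 0) * x d + b q.1 q.2),
    ?_, ?_, ?_, ?_, fun x _ i => i.elim⟩
  · have h := Hidden.first (η := η) F.B_nonneg A (fun q => b q.2.1 q.2.2) (fun q d => by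
      simp only [A]
      split_ifs
      · exact i4 _
      · simpa using F.B_nonneg) (fun q => by
      simp only [b]
      split_ifs
      · exact o3 _
      · exact i5 _)
    have hs : supportCard A ≤ F.m * 4 * D := by
      have h1 : supportCard A ≤
          (Finset.univ : Finset ((Fin F.m × Fin 4) × Fin D)).card := by
        unfold supportCard
        refine Finset.card_le_card_of_injOn (fun z => ((z.1.1, z.1.2.2), z.2))
          (fun _ _ => Finset.mem_coe.2 (Finset.mem_univ _)) ?_
        rintro ⟨⟨a, j, r⟩, d⟩ hz ⟨⟨a', j', r'⟩, d'⟩ hz' he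
        have e1 := (Finset.mem_filter.1 (Finset.mem_coe.1 hz)).2
        have e2 := (Finset.mem_filter.1 (Finset.mem_coe.1 hz')).2
        simp only [Prod.mk.injEq] at he
        obtain ⟨⟨rfl, rfl⟩, rfl⟩ := he
        simp only [A] at e1 e2
        have f1 : j = some (.inl d) := by by_contra h; simp [h] at e1
        have f2 : j' = some (.inl d) := by by_contra h; simp [h] at e2
        rw [f1, f2]
      simpa using h1
    intro rest hrest
    obtain ⟨N, e1, e2, e3, e4⟩ := h rest hrest
    refine ⟨N, e1, e2, e3.trans (add_le_add ?_ le_rfl), e4⟩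
    have hm := F.one_le_m
    simp only [Fintype.card_prod, Fintype.card_fin, Fintype.card_option, Fintype.card_sum,
      Fintype.card_empty, add_zero, Q]
    nlinarith [Nat.mul_le_mul hm (le_refl (F.m * (D + 1)))]
  · intro j r
    simp only [p]
    split_ifs
    · exact o1 _
    · exact i1 _
  · intro x
    have := o4 0
    simpa [gadget, p, b] using this
  · intro x hx j
    rcases j with _ | d | i
    · have := o4 0
      have h2 : ∑ r, p none r * η (∑ d, (if (none : Option (Fin D ⊕ Empty)) = some (.inl d) then
          uI r else 0) * x d + b none r) = 1 := by
        simpa [gadget, p, b] using this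
      simp only [h2, idxVal, sub_self, abs_zero]
      have := F.δ_nonneg
      positivity
    · have h1 := i6 (x d) ((F.cube x hx d).trans (by norm_num))
      have h2 : ∑ r, p (some (.inl d)) r * η (∑ d', (if (some (.inl d) : Option (Fin D ⊕ Empty)) =
          some (.inl d') then uI r else 0) * x d' + b (some (.inl d)) r) =
          gadget η pI uI vI (x d) := by
        simp [gadget, p, b]
      simp only [h2, idxVal, Nat.cast_one, one_mul]
      exact h1
    · exact i.elim

/-- One layer of the circuit. New bits are thresholds of linear combinations that have the margin
`κ` on the good set. Old bits are refreshed by thresholding `β - 1 / 2`, so their error falls back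
to `δ`; coordinates pass through the identity gadget and lose `δ` in each layer. -/
theorem TC.extend {ι γ A : Type} [Fintype ι] [Fintype γ] [Fintype A] {β : ι → (Fin D → ℝ) → ℝ}
    {l s : ℕ} (h : F.TC β l s) (hl : l < F.depth) (i : γ → A → Option (Fin D ⊕ ι))
    (c : γ → A → ℝ) (hc : ∀ q, ∑ a, |c q a| ≤ F.Φ) (β' : γ → (Fin D → ℝ) → ℝ)
    (hz : ∀ x ∈ F.G, ∀ q, (F.κ ≤ ∑ a, c q a * idxVal β (i q a) x ∧ β' q x = 1) ∨
      (∑ a, c q a * idxVal β (i q a) x ≤ -F.κ ∧ β' q x = 0)) :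
    F.TC (Sum.elim β β') (l + 1) (s + F.Q * (D + 1 + Fintype.card ι +
      Fintype.card γ * (Fintype.card A + 1))) := by
  classical
  obtain ⟨h0, τ, hτ, β₀, g, p, v, h1, h2, h3, h4, h5⟩ := h
  obtain ⟨pO, vO, o1, o2, o3, o4⟩ := F.one
  obtain ⟨pI, uI, vI, i1, i2, i3, i4, i5, i6⟩ := F.ident
  obtain ⟨pS, uS, vS, s1, s2, s3, s4⟩ := F.step
  let lift : Option (Fin D ⊕ ι) → Option (Fin D ⊕ τ) := Option.map (Sum.map id g)
  have hlift : ∀ x ∈ F.G, ∀ j, idxVal β₀ (lift j) x = idxVal β j x := by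
    rintro x hx (_ | d | k)
    · rfl
    · rfl
    · exact (h5 x hx k).symm
  let T := Option (Fin D ⊕ (ι ⊕ γ))
  let sel {X : Type} (a b c : X) : T → X
    | none => a
    | some (.inl _) => b
    | some (.inr _) => c
  -- The slots `.inl a` hold the inputs of the new bits. For old signals, `.inr true` holds the
  -- signal itself and `.inr false` the constant that is used for the shift by `-1 / 2`.
  let ii : T → A ⊕ Bool → Option (Fin D ⊕ τ)
    | some (.inr (.inr q)), .inl a => lift (i q a)
    | some (.inr (.inl k)), .inr true => some (.inr (g k))
    | some (.inl d), .inr true => some (.inl d)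
    | _, _ => none
  let cc : T → A ⊕ Bool → ℝ
    | some (.inr (.inr q)), .inl a => c q a
    | some (.inr (.inl _)), .inr true => 1
    | some (.inr (.inl _)), .inr false => -(1 / 2)
    | some (.inl _), .inr true => 1
    | _, _ => 0
  have hcc : ∀ t, ∑ a, |cc t a| ≤ F.Φ := by
    have hΦ := F.le_Φ
    rintro (_ | d | k | q) <;> simp only [Fintype.sum_sum_type, Fintype.sum_bool, cc, abs_zero,
      Finset.sum_const_zero, abs_one, abs_neg, add_zero, zero_add]
    · linarith
    · linarith
    · rw [abs_of_pos (by norm_num : (0 : ℝ) < 1 / 2)]; linarith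
    · exact hc q
  have hlen : ∀ t, (insert none (Finset.univ.image (ii t))).card ≤
      match t with
      | some (.inr (.inr _)) => Fintype.card A + 1
      | _ => 2 := by
    have aux : ∀ (t : T) (y : Option (Fin D ⊕ τ)), (∀ a, ii t a = none ∨ ii t a = y) →
        (insert none (Finset.univ.image (ii t))).card ≤ 2 := by
      intro t y ht
      refine (Finset.card_le_card (t := {none, y}) ?_).trans Finset.card_le_two
      intro z hz
      rcases Finset.mem_insert.1 hz with rfl | hz
      · simp
      · obtain ⟨a, -, rfl⟩ := Finset.mem_image.1 hz
        rcases ht a with h | h <;> simp [h]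
    rintro (_ | d | k | q)
    · exact aux none none (by rintro (a | _ | _) <;> simp [ii])
    · exact aux (some (.inl d)) (some (.inl d)) (by rintro (a | _ | _) <;> simp [ii])
    · exact aux (some (.inr (.inl k))) (some (.inr (g k))) (by rintro (a | _ | _) <;> simp [ii])
    · have : insert none (Finset.univ.image (ii (some (.inr (.inr q))))) ⊆
          insert none (Finset.univ.image fun a => lift (i q a)) := by
        intro z hz
        rcases Finset.mem_insert.1 hz with rfl | hz
        · simp
        · obtain ⟨a | _ | _, -, rfl⟩ := Finset.mem_image.1 hz <;> simp [ii]
      refine (Finset.card_le_card this).trans ((Finset.card_insert_le _ _).trans ?_)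
      exact Nat.add_le_add_right (Finset.card_image_le.trans (by simp)) 1
  have hcnt : ∑ t, (insert none (Finset.univ.image (ii t))).card ≤
      2 * (D + 1 + Fintype.card ι) + Fintype.card γ * (Fintype.card A + 1) := by
    refine (Finset.sum_le_sum fun t _ => hlen t).trans (le_of_eq ?_)
    simp only [T, Fintype.sum_option, Fintype.sum_sum_type, Finset.sum_const, Finset.card_univ,
      smul_eq_mul, Fintype.card_fin]
    ring
  have hl1 := h1.layer F.B_nonneg F.one_le_m F.P_nonneg F.weights p h2 none h3 ii cc hcc
    (sel 0 uI uS) (sel vO vI vS)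
    (by
      rintro (_ | d | k) r
      · simpa [sel] using F.P_nonneg
      · exact i2 r
      · exact s2 r)
    (by
      rintro (_ | d | k) r
      · exact o2 r
      · exact i3 r
      · exact s3 r) _ (by convert hcnt)
  have hδ := F.δ_nonneg
  have hld : (l : ℝ) * F.δ ≤ F.depth * F.δ := by
    have : (l : ℝ) ≤ F.depth := by exact_mod_cast hl.le
    gcongr
  have hld0 : 0 ≤ (l : ℝ) * F.δ := by positivity
  have hκ := F.κ_le
  have hΦ := F.le_Φ
  have hsmall := F.small
  -- Errors `l * δ` of the signals change a combination with coefficients of total size `Φ` by at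
  -- most half of the margin.
  have hld1 : F.Φ * (l * F.δ) ≤ F.κ / 2 := le_trans (by gcongr) hsmall
  have hnew : ∀ x ∈ F.G, ∀ q, Sum.elim β β' q x = 0 ∨ Sum.elim β β' q x = 1 := by
    rintro x hx (k | q)
    · exact h0 x hx k
    · rcases hz x hx q with h | h
      · exact Or.inr h.2
      · exact Or.inl h.2
  have happ : ∀ x ∈ F.G, ∀ t, |∑ a, cc t a * ∑ r, p (ii t a) r * v (ii t a, r) x -
      ∑ a, cc t a * idxVal β₀ (ii t a) x| ≤ F.κ / 2 := by
    intro x hx t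
    rw [← Finset.sum_sub_distrib]
    refine (Finset.abs_sum_le_sum_abs _ _).trans (le_trans ?_ hld1)
    calc ∑ a, |cc t a * ∑ r, p (ii t a) r * v (ii t a, r) x - cc t a * idxVal β₀ (ii t a) x|
        ≤ ∑ a, |cc t a| * (l * F.δ) := Finset.sum_le_sum fun a _ => by
          rw [← mul_sub, abs_mul]
          exact mul_le_mul_of_nonneg_left (h4 x hx _) (abs_nonneg _)
      _ ≤ F.Φ * (l * F.δ) := by
          rw [← Finset.sum_mul]
          exact mul_le_mul_of_nonneg_right (hcc t) hld0
  refine ⟨hnew, ι ⊕ γ, inferInstance, Sum.elim β β', id, sel pO pI pS, fun q x =>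
    η (sel 0 uI uS q.1 q.2 * (∑ a, cc q.1 a * ∑ r, p (ii q.1 a) r * v (ii q.1 a, r) x) +
      sel vO vI vS q.1 q.2), ?_, ?_, ?_, ?_, fun x _ i => rfl⟩
  · intro rest hrest
    obtain ⟨N, e1, e2, e3, e4⟩ := hl1 rest hrest
    refine ⟨N, e1, e2, e3.trans (add_le_add (add_le_add le_rfl ?_) le_rfl), e4⟩
    rw [Q]
    calc 16 * F.m ^ 2 * (2 * (D + 1 + Fintype.card ι) + Fintype.card γ * (Fintype.card A + 1))
        ≤ 16 * F.m ^ 2 * (3 * (D + 1 + Fintype.card ι + Fintype.card γ * (Fintype.card A + 1))) :=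
          Nat.mul_le_mul_left _ (by omega)
      _ = _ := by ring
  · rintro (_ | d | k) r
    · exact o1 r
    · exact i1 r
    · exact s1 r
  · intro x
    exact o4 (∑ a, cc none a * ∑ r, p (ii none a) r * v (ii none a, r) x)
  · intro x hx t
    push_cast
    rw [add_mul, one_mul]
    have key := happ x hx t
    rcases t with _ | d | k
    · have := o4 (∑ a, cc none a * ∑ r, p (ii none a) r * v (ii none a, r) x)
      have h6 : |gadget η pO 0 vO (∑ a, cc none a * ∑ r, p (ii none a) r * v (ii none a, r) x) - 1|
          ≤ l * F.δ + F.δ := by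
        rw [this, sub_self, abs_zero]; positivity
      exact h6
    · have e1 : ∑ a, cc (some (.inl d)) a * ∑ r, p (ii (some (.inl d)) a) r *
          v (ii (some (.inl d)) a, r) x = ∑ r, p (some (.inl d)) r * v (some (.inl d), r) x := by
        rw [Fintype.sum_sum_type, Fintype.sum_bool]
        simp [cc, ii]
      have h6 := h4 x hx (some (.inl d))
      set z := ∑ r, p (some (.inl d)) r * v (some (.inl d), r) x with hzdef
      have h7 : |z| ≤ 2 := by
        have := abs_add_le (z - x d) (x d)
        rw [sub_add_cancel] at this
        have h8 : (l : ℝ) * F.δ ≤ 1 := by nlinarith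
        have h9 := F.cube x hx d
        have h10 : |z - x d| ≤ l * F.δ := h6
        linarith
      have h8 := abs_add_le (gadget η pI uI vI z - z) (z - x d)
      rw [sub_add_sub_cancel] at h8
      have h9 : |gadget η pI uI vI z - x d| ≤ l * F.δ + F.δ := by
        refine h8.trans ?_
        have := i6 z h7
        have h10 : |z - x d| ≤ l * F.δ := h6
        linarith
      rw [← e1] at h9
      exact h9
    · have hgoal : |gadget η pS uS vS (∑ a, cc (some (.inr k)) a * ∑ r, p (ii (some (.inr k)) a) r *
          v (ii (some (.inr k)) a, r) x) - Sum.elim β β' k x| ≤ F.δ := by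
        have hcase : (F.κ ≤ ∑ a, cc (some (.inr k)) a * idxVal β₀ (ii (some (.inr k)) a) x ∧
            Sum.elim β β' k x = 1) ∨
            (∑ a, cc (some (.inr k)) a * idxVal β₀ (ii (some (.inr k)) a) x ≤ -F.κ ∧
            Sum.elim β β' k x = 0) := by
          rcases k with k | q
          · have e1 : ∑ a, cc (some (.inr (.inl k))) a * idxVal β₀ (ii (some (.inr (.inl k))) a) x =
                β k x - 1 / 2 := by
              rw [Fintype.sum_sum_type, Fintype.sum_bool]
              simp [cc, ii, idxVal, h5 x hx k]
              ring
            rw [e1]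
            rcases h0 x hx k with h | h
            · right; exact ⟨by rw [h]; linarith, h⟩
            · left; exact ⟨by rw [h]; linarith, h⟩
          · have e1 : ∑ a, cc (some (.inr (.inr q))) a * idxVal β₀ (ii (some (.inr (.inr q))) a) x =
                ∑ a, c q a * idxVal β (i q a) x := by
              rw [Fintype.sum_sum_type, Fintype.sum_bool]
              simp [cc, ii, hlift x hx]
            rw [e1]
            exact hz x hx q
        have hk := abs_le.1 key
        rcases hcase with ⟨h6, h7⟩ | ⟨h6, h7⟩
        · rw [h7]; exact (s4 _).1 (by linarith)
        · rw [h7, sub_zero]; exact (s4 _).2 (by linarith)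
      have : |gadget η pS uS vS (∑ a, cc (some (.inr k)) a * ∑ r, p (ii (some (.inr k)) a) r *
          v (ii (some (.inr k)) a, r) x) - Sum.elim β β' k x| ≤ l * F.δ + F.δ := by linarith
      exact this

/-- A last gadget is applied to each bit before the affine output. Its range is bounded on the whole
line, so the bounds on `f` hold at all points, while closeness to the bits is claimed on the good
set only. -/
theorem TC.output {ι : Type} [Fintype ι] {β : ι → (Fin D → ℝ) → ℝ} {l s : ℕ} (h : F.TC β l s)
    {p u w : Fin 4 → ℝ} (hp : ∀ r, |p r| ≤ F.P) (hu : ∀ r, |u r| ≤ F.P) (hw : ∀ r, |w r| ≤ F.P)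
    {e : ℝ} (hrange : ∀ z, -e ≤ gadget η p u w z ∧ gadget η p u w z ≤ 1 + e)
    (h1 : ∀ z, |z - 1| ≤ l * F.δ → |gadget η p u w z - 1| ≤ e)
    (h0 : ∀ z, |z| ≤ l * F.δ → |gadget η p u w z| ≤ e)
    (a : ι → ℝ) (a₀ : ℝ) (ha : ∀ i, |a i| * F.P ≤ F.m * F.B) (ha₀ : |a₀| * F.P ≤ F.m * F.B) :
    ∃ (f : ι → (Fin D → ℝ) → ℝ) (N : Net D 1),
      (∀ x i, -e ≤ f i x ∧ f i x ≤ 1 + e) ∧ (∀ x ∈ F.G, ∀ i, |f i x - β i x| ≤ e) ∧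
      (∀ x, N.eval η x 0 = a₀ + ∑ i, a i * f i x) ∧ N.numLayers = l + 2 ∧
      N.numParams ≤ s + F.Q * (1 + Fintype.card ι) ∧ (N.maxParam : ℝ) ≤ F.B := by
  classical
  obtain ⟨hb, τ, hτ, β₀, g, p₀, v, g1, g2, g3, g4, g5⟩ := h
  obtain ⟨pO, vO, o1, o2, o3, o4⟩ := F.one
  have hm0 : (0 : ℝ) < F.m := by exact_mod_cast F.one_le_m
  let sel {X : Type} (a b : X) : Option ι → X := fun t => t.elim a fun _ => b
  let ii : Option ι → Unit → Option (Fin D ⊕ τ) := fun t _ => t.map fun k => .inr (g k)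
  have hcnt : ∑ t, (insert none (Finset.univ.image (ii t))).card ≤ 2 * (1 + Fintype.card ι) := by
    refine (Finset.sum_le_sum (g := fun _ => 2) fun t _ => ?_).trans (le_of_eq ?_)
    · refine (Finset.card_insert_le _ _).trans ?_
      exact Nat.add_le_add_right (Finset.card_image_le.trans (by simp)) 1
    · simp [Fintype.card_option]; ring
  have hl := g1.layer F.B_nonneg F.one_le_m F.P_nonneg F.weights p₀ g2 none g3 ii
    (fun _ _ => 1) (fun t => by simpa using (by linarith [F.le_Φ] : (1 : ℝ) ≤ F.Φ))
    (sel 0 u) (sel vO w)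
    (by
      rintro (_ | k) r
      · simpa [sel] using F.P_nonneg
      · exact hu r)
    (by
      rintro (_ | k) r
      · exact o2 r
      · exact hw r) _ (by convert hcnt)
  obtain ⟨N, n1, n2, n3, n4⟩ := hl.output F.B_nonneg
    (fun q : Fin F.m × (Option ι × Fin 4) => q.2.1.elim a₀ a * sel pO p q.2.1 q.2.2 / F.m)
    (by
      rintro ⟨c, t, r⟩
      rw [abs_div, abs_of_pos hm0, div_le_iff₀ hm0, abs_mul, mul_comm F.B]
      rcases t with _ | k
      · exact le_trans (mul_le_mul_of_nonneg_left (o1 r) (abs_nonneg _)) ha₀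
      · exact le_trans (mul_le_mul_of_nonneg_left (hp r) (abs_nonneg _)) (ha k))
  refine ⟨fun i x => gadget η p u w (∑ r, p₀ (some (.inr (g i))) r * v (some (.inr (g i)), r) x),
    N, fun x i => hrange _, fun x hx i => ?_, fun x => ?_, n2, n3.trans ?_, n4⟩
  · have h6 := g4 x hx (some (.inr (g i)))
    simp only [idxVal, ← g5 x hx i] at h6
    rcases hb x hx i with h7 | h7
    · rw [h7, sub_zero] at h6 ⊢
      exact h0 _ h6
    · rw [h7] at h6 ⊢
      exact h1 _ h6
  · rw [n1, Fintype.sum_prod_type]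
    simp only [Finset.sum_const, Finset.card_univ, Fintype.card_fin, nsmul_eq_mul]
    rw [Fintype.sum_prod_type, Fintype.sum_option, mul_add, Finset.mul_sum]
    congr 1
    · have := o4 0
      simp only [gadget, Pi.zero_apply, zero_mul, zero_add] at this
      simp only [Option.elim_none, sel, Pi.zero_apply, zero_mul, zero_add]
      refine Eq.trans ?_ ((congrArg (a₀ * ·) this).trans (mul_one a₀))
      simp only [Finset.mul_sum]
      refine Finset.sum_congr rfl fun r _ => ?_
      field_simp
    · rw [Finset.mul_sum]
      refine Finset.sum_congr rfl fun i _ => ?_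
      simp only [gadget, Option.elim_some, sel, Finset.mul_sum, ii, Option.map_some,
        Finset.univ_unique, Finset.sum_singleton, one_mul]
      refine Finset.sum_congr rfl fun r _ => ?_
      field_simp
  · rw [add_assoc]
    refine Nat.add_le_add_left ?_ _
    have hm := F.one_le_m
    simp only [Fintype.card_prod, Fintype.card_fin, Fintype.card_option, Q]
    nlinarith [Nat.mul_le_mul hm (le_refl (F.m * (Fintype.card ι + 1)))]

end Frame


/-! ### Binary digits and cells -/

/-- The partial sums of the binary expansion of `u`, clipped to the unit interval. -/
def greedySum (u : ℝ) : ℕ → ℝ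
  | 0 => 0
  | n + 1 => greedySum u n + if greedySum u n + (1 / 2) ^ (n + 1) < u then (1 / 2) ^ (n + 1) else 0

/-- The digits of the binary expansion of `u`, clipped to the unit interval. -/
def greedyBit (u : ℝ) (n : ℕ) : ℝ := if greedySum u n + (1 / 2) ^ (n + 1) < u then 1 else 0

theorem greedyBit_eq (u : ℝ) (n : ℕ) : greedyBit u n = 0 ∨ greedyBit u n = 1 := by
  unfold greedyBit; split_ifs <;> simp

theorem greedySum_eq_sum (u : ℝ) (n : ℕ) :
    greedySum u n = ∑ i : Fin n, (1 / 2) ^ (i.val + 1) * greedyBit u i := by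
  induction n with
  | zero => simp [greedySum]
  | succ n ih =>
    rw [Fin.sum_univ_castSucc, greedySum]
    simp only [Fin.val_castSucc, Fin.val_last]
    rw [← ih, greedyBit]
    split_ifs <;> simp

theorem greedySum_nonneg (u : ℝ) (n : ℕ) : 0 ≤ greedySum u n := by
  induction n with
  | zero => exact le_rfl
  | succ n ih => rw [greedySum]; split_ifs <;> positivity

theorem greedySum_le {u : ℝ} (hu : 0 ≤ u) (n : ℕ) : greedySum u n ≤ u := by
  induction n with
  | zero => exact hu
  | succ n ih => rw [greedySum]; split_ifs <;> linarith

theorem le_greedySum_add {u : ℝ} (hu : u ≤ 1) (n : ℕ) : u ≤ greedySum u n + (1 / 2) ^ n := by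
  induction n with
  | zero => simpa [greedySum] using hu
  | succ n ih =>
    rw [greedySum]
    have h2 : (1 / 2 : ℝ) ^ n = (1 / 2) ^ (n + 1) + (1 / 2) ^ (n + 1) := by rw [pow_succ]; ring
    split_ifs <;> linarith

theorem greedySum_of_one_le {u : ℝ} (hu : 1 ≤ u) (n : ℕ) : greedySum u n + (1 / 2) ^ n = 1 := by
  induction n with
  | zero => simp [greedySum]
  | succ n ih =>
    have h1 : (0 : ℝ) < (1 / 2) ^ (n + 1) := by positivity
    have h2 : (1 / 2 : ℝ) ^ n = (1 / 2) ^ (n + 1) + (1 / 2) ^ (n + 1) := by rw [pow_succ]; ring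
    rw [greedySum, if_pos (by linarith)]
    linarith

theorem greedySum_of_nonpos {u : ℝ} (hu : u ≤ 0) (n : ℕ) : greedySum u n = 0 := by
  induction n with
  | zero => rfl
  | succ n ih =>
    have h1 : (0 : ℝ) < (1 / 2) ^ (n + 1) := by positivity
    rw [greedySum, if_neg (by linarith), ih, add_zero]

/-- Clipping to `[0, 1]` does not increase the distance to a point `c` of this interval, so `u`
itself may lie slightly outside. -/
theorem abs_greedySum_sub_le {u c : ℝ} (hc0 : 0 ≤ c) (hc1 : c ≤ 1) (n : ℕ) :
    |greedySum u n - c| ≤ |u - c| + (1 / 2) ^ n := by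
  have h1 : (0 : ℝ) < (1 / 2) ^ n := by positivity
  rcases le_total u 0 with h | h
  · rw [greedySum_of_nonpos h, abs_le]
    have := neg_abs_le (u - c)
    constructor <;> linarith [abs_nonneg (u - c)]
  rcases le_total 1 u with h' | h'
  · have := greedySum_of_one_le h' n
    rw [abs_le]
    have := le_abs_self (u - c)
    constructor <;> linarith [abs_nonneg (u - c)]
  · have e1 := greedySum_le h n
    have e2 := le_greedySum_add h' n
    rw [abs_le]
    have := le_abs_self (u - c)
    have := neg_abs_le (u - c)
    constructor <;> linarith

theorem half_pow_eq {m n : ℕ} (h : m ≤ n) : ∃ j : ℤ, (1 / 2 : ℝ) ^ m = j * (1 / 2) ^ n := by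
  refine ⟨2 ^ (n - m), ?_⟩
  obtain ⟨k, rfl⟩ := Nat.exists_eq_add_of_le h
  push_cast
  rw [Nat.add_sub_cancel_left, pow_add]
  have : (2 : ℝ) ^ k * (1 / 2) ^ k = 1 := by rw [← mul_pow]; norm_num
  linear_combination -(1 / 2 : ℝ) ^ m * this

/-- The first `n` digits result from comparisons of `u` with multiples of `2 ^ (-n)`; distance `κ`
from this lattice is a margin for all of them. -/
theorem greedySum_lattice (u : ℝ) {s n : ℕ} (h : s ≤ n) :
    ∃ j : ℤ, greedySum u s = j * (1 / 2) ^ n := by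
  induction s with
  | zero => exact ⟨0, by simp [greedySum]⟩
  | succ s ih =>
    obtain ⟨j, hj⟩ := ih (by omega)
    obtain ⟨k, hk⟩ := half_pow_eq h
    rw [greedySum]
    split_ifs
    · exact ⟨j + k, by rw [hj, hk]; push_cast; ring⟩
    · exact ⟨j, by rw [hj, add_zero]⟩

/-- The cell of the point `t` of the unit interval among `N` cells of equal length. -/
def cellFin (N : ℕ) [NeZero N] (t : ℝ) : Fin N := Fin.ofNat N ⌊N * t⌋₊

theorem cellFin_val {N : ℕ} [NeZero N] {t : ℝ} (h0 : 0 ≤ t) (h1 : t < 1) :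
    ((cellFin N t : ℕ) : ℝ) ≤ N * t ∧ N * t < (cellFin N t : ℕ) + 1 := by
  have hN : (0 : ℝ) < N := by exact_mod_cast Nat.pos_of_ne_zero (NeZero.ne N)
  have h2 : ⌊N * t⌋₊ < N := by
    rw [Nat.floor_lt (by positivity)]
    nlinarith
  have h3 : (cellFin N t : ℕ) = ⌊N * t⌋₊ := by
    simp [cellFin, Nat.mod_eq_of_lt h2]
  rw [h3]
  exact ⟨Nat.floor_le (by positivity), Nat.lt_floor_add_one _⟩

/-- The local coordinate of `t` in its cell. -/
def localCoord (N : ℕ) [NeZero N] (t : ℝ) : ℝ := N * t - (cellFin N t : ℕ)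

/-- The indicator of the cell `k`. -/
def cellBit (N : ℕ) [NeZero N] (k : Fin N) (t : ℝ) : ℝ := if cellFin N t = k then 1 else 0

theorem cellBit_eq {N : ℕ} [NeZero N] {t : ℝ} (h0 : 0 ≤ t) (h1 : t < 1) (k : Fin N) :
    ((k : ℕ) ≤ N * t ∧ N * t < (k : ℕ) + 1 ∧ cellBit N k t = 1) ∨
      ((N * t < (k : ℕ) ∨ (k : ℕ) + 1 ≤ N * t) ∧ cellBit N k t = 0) := by
  have h := cellFin_val (N := N) h0 h1
  by_cases hk : cellFin N t = k
  · left
    rw [hk] at h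
    exact ⟨h.1, h.2, by simp [cellBit, hk]⟩
  · right
    refine ⟨?_, by simp [cellBit, hk]⟩
    rcases lt_or_gt_of_ne (fun h => hk (Fin.ext h)) with h3 | h3
    · left
      have : ((cellFin N t : ℕ) : ℝ) + 1 ≤ (k : ℕ) := by exact_mod_cast h3
      linarith
    · right
      have : ((k : ℕ) : ℝ) + 1 ≤ (cellFin N t : ℕ) := by exact_mod_cast h3
      linarith

/-- Signals of a subfamily of bits. -/
def liftIdx {D : ℕ} {ι κ : Type} (g : ι → κ) : Option (Fin D ⊕ ι) → Option (Fin D ⊕ κ) :=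
  Option.map (Sum.map id g)

theorem idxVal_liftIdx {D : ℕ} {ι κ : Type} {g : ι → κ} {β : ι → (Fin D → ℝ) → ℝ}
    {β' : κ → (Fin D → ℝ) → ℝ} {x : Fin D → ℝ} (h : ∀ i, β' (g i) x = β i x)
    (j : Option (Fin D ⊕ ι)) : idxVal β' (liftIdx g j) x = idxVal β j x := by
  rcases j with _ | d | i
  · rfl
  · rfl
  · exact h i

/-- A conjunction is a threshold: the sum of the bits equals their number or is smaller by at least
`1`, so `card - 1 / 2` separates the two cases. -/
theorem prod_bits {A : Type} [Fintype A] (b : A → ℝ) (hb : ∀ a, b a = 0 ∨ b a = 1) :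
    (∑ a, b a = Fintype.card A ∧ ∏ a, b a = 1) ∨
      (∑ a, b a ≤ Fintype.card A - 1 ∧ ∏ a, b a = 0) := by
  classical
  by_cases h : ∃ a, b a = 0
  · obtain ⟨a, ha⟩ := h
    right
    refine ⟨?_, Finset.prod_eq_zero (Finset.mem_univ a) ha⟩
    rw [← Finset.add_sum_erase _ _ (Finset.mem_univ a), ha, zero_add]
    refine (Finset.sum_le_card_nsmul _ _ 1 fun c _ => ?_).trans (le_of_eq ?_)
    · rcases hb c with h | h <;> rw [h] <;> norm_num
    · rw [Finset.card_erase_of_mem (Finset.mem_univ a), Finset.card_univ, nsmul_one, Nat.cast_sub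
        (Fintype.card_pos_iff.2 ⟨a⟩), Nat.cast_one]
  · left
    push Not at h
    have : ∀ a, b a = 1 := fun a => (hb a).resolve_left (h a)
    simp [this]

/-! ### Circuits for conjunctions, digits and table lookup -/

namespace Frame

variable {D : ℕ} {η : ℝ → ℝ} {F : Frame D η}

theorem TC.and {ι γ A : Type} [Fintype ι] [Fintype γ] [Fintype A] {β : ι → (Fin D → ℝ) → ℝ}
    {l s : ℕ} (h : F.TC β l s) (hl : l < F.depth) (hΦ : 2 * (Fintype.card A : ℝ) + 1 ≤ F.Φ)
    (i : γ → A → Option (Fin D ⊕ ι))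
    (hi : ∀ x ∈ F.G, ∀ q a, idxVal β (i q a) x = 0 ∨ idxVal β (i q a) x = 1) :
    F.TC (Sum.elim β fun q x => ∏ a, idxVal β (i q a) x) (l + 1) (s + F.Q * (D + 1 +
      Fintype.card ι + Fintype.card γ * (Fintype.card A + 2))) := by
  have h1 := h.extend hl (γ := γ) (A := Option A) (fun q a => a.elim none (i q))
    (fun _ a => a.elim (-((Fintype.card A : ℝ) - 1 / 2)) fun _ => 1) (fun q => by
      rw [Fintype.sum_option]
      simp only [Option.elim_none, Option.elim_some, abs_one, Finset.sum_const, Finset.card_univ,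
        nsmul_eq_mul, mul_one, abs_neg]
      have := abs_sub (Fintype.card A : ℝ) (1 / 2)
      rw [Nat.abs_cast, abs_of_pos (by norm_num : (0 : ℝ) < 1 / 2)] at this
      linarith) (fun q x => ∏ a, idxVal β (i q a) x) (fun x hx q => by
      rw [Fintype.sum_option]
      simp only [Option.elim_none, Option.elim_some, one_mul]
      have hκ := F.κ_le
      have e : idxVal β none x = 1 := rfl
      rw [e]
      rcases prod_bits (fun a => idxVal β (i q a) x) (hi x hx q) with h | h
      · left; exact ⟨by linarith [h.1], h.2⟩
      · right; exact ⟨by linarith [h.1], h.2⟩)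
  exact h1.mono (le_of_eq (by rw [Fintype.card_option]))

/-- Binary digits of linear combinations of signals. -/
theorem TC.digits {ι γ A : Type} [Fintype ι] [Fintype γ] [Fintype A] {β : ι → (Fin D → ℝ) → ℝ}
    {l s : ℕ} (h : F.TC β l s) (n : ℕ) (hl : l + n ≤ F.depth) (i : γ → A → Option (Fin D ⊕ ι))
    (c : γ → A → ℝ) (hc : ∀ q, ∑ a, |c q a| + 2 ≤ F.Φ) (u : γ → (Fin D → ℝ) → ℝ)
    (hu : ∀ x ∈ F.G, ∀ q, u q x = ∑ a, c q a * idxVal β (i q a) x)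
    (hκ : ∀ x ∈ F.G, ∀ q, ∀ j : ℤ, F.κ ≤ |u q x - j * (1 / 2) ^ n|) :
    F.TC (Sum.elim β fun (q : γ × Fin n) x => greedyBit (u q.1 x) q.2) (l + n)
      (s + n * (F.Q * (D + 1 + Fintype.card ι + Fintype.card γ * (Fintype.card A + 2 * n + 2)))) := by
  -- One layer per digit: each digit needs all the previous ones.
  suffices H : ∀ k ≤ n, F.TC (Sum.elim β fun (q : γ × Fin k) x => greedyBit (u q.1 x) q.2) (l + k)
      (s + k * (F.Q * (D + 1 + Fintype.card ι + Fintype.card γ * (Fintype.card A + 2 * n + 2)))) from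
    H n le_rfl
  intro k
  induction k with
  | zero =>
    intro _
    exact (h.reindex (Sum.elim id fun q => q.2.elim0) (by
      rintro x _ (k | q)
      · rfl
      · exact q.2.elim0)).mono (by omega)
  | succ k ih =>
    intro hk
    have h0 := ih (by omega)
    have hgeom : ∀ k : ℕ, ∑ j : Fin k, (1 / 2 : ℝ) ^ (j.val + 1) = 1 - (1 / 2) ^ k := by
      intro k
      induction k with
      | zero => simp
      | succ k ih => rw [Fin.sum_univ_castSucc]; simp only [Fin.val_castSucc, Fin.val_last]; rw [ih, pow_succ]; ring
    have h1 := h0.extend (by omega) (γ := γ) (A := A ⊕ (Fin k ⊕ Unit))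
      (fun q a => Sum.elim (fun a => liftIdx Sum.inl (i q a))
        (Sum.elim (fun j => some (.inr (.inr (q, j)))) fun _ => none) a)
      (fun q a => Sum.elim (c q) (Sum.elim (fun j => -(1 / 2) ^ (j.val + 1))
        fun _ => -(1 / 2) ^ (k + 1)) a) (fun q => by
        simp only [Fintype.sum_sum_type, Sum.elim_inl, Sum.elim_inr, abs_neg, Finset.univ_unique,
          Finset.sum_singleton]
        have e1 : ∀ j : ℕ, |(1 / 2 : ℝ) ^ j| = (1 / 2) ^ j := fun j => abs_of_pos (by positivity)
        simp only [e1]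
        rw [hgeom]
        have e2 : (1 / 2 : ℝ) ^ (k + 1) ≤ 1 := pow_le_one₀ (by norm_num) (by norm_num)
        have e3 : (0 : ℝ) < (1 / 2) ^ k := by positivity
        linarith [hc q]) (fun q x => greedyBit (u q x) k) (fun x hx q => by
        have ez : ∑ a, (Sum.elim (c q) (Sum.elim (fun j : Fin k => -(1 / 2 : ℝ) ^ (j.val + 1))
            fun _ : Unit => -(1 / 2) ^ (k + 1)) a) * idxVal (Sum.elim β fun (q : γ × Fin k) x =>
              greedyBit (u q.1 x) q.2) (Sum.elim (fun a => liftIdx Sum.inl (i q a))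
              (Sum.elim (fun j => some (.inr (.inr (q, j)))) fun _ => none) a) x =
            u q x - (greedySum (u q x) k + (1 / 2) ^ (k + 1)) := by
          simp only [Fintype.sum_sum_type, Sum.elim_inl, Sum.elim_inr, Finset.univ_unique,
            Finset.sum_singleton]
          have e1 : ∑ a, c q a * idxVal (Sum.elim β fun (q : γ × Fin k) x =>
              greedyBit (u q.1 x) q.2) (liftIdx Sum.inl (i q a)) x = u q x := by
            rw [hu x hx]
            exact Finset.sum_congr rfl fun a _ => by
              rw [idxVal_liftIdx (β := β)]
              exact fun i => rfl
          rw [e1, greedySum_eq_sum]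
          simp only [idxVal, Sum.elim_inr, neg_mul, Finset.sum_neg_distrib, mul_one]
          ring
        rw [ez]
        -- The threshold of this comparison is a multiple of `2 ^ (-n)`, so the distance of `u` from
        -- the lattice is the margin.
        obtain ⟨j, hj⟩ := greedySum_lattice (u q x) (show k ≤ n by omega)
        obtain ⟨j', hj'⟩ := half_pow_eq (show k + 1 ≤ n by omega)
        have hm := hκ x hx q (j + j')
        have hκ0 := F.κ_pos
        rw [show u q x - ((j + j' : ℤ) : ℝ) * (1 / 2) ^ n =
          u q x - (greedySum (u q x) k + (1 / 2) ^ (k + 1)) by rw [hj, hj']; push_cast; ring] at hm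
        rcases le_abs.1 hm with h | h
        · left; exact ⟨h, by rw [greedyBit, if_pos (by linarith)]⟩
        · right; exact ⟨by linarith, by rw [greedyBit, if_neg (by linarith)]⟩)
    refine (h1.reindex (Sum.elim (fun i => .inl (.inl i)) fun q =>
      if hq : q.2.val < k then .inl (.inr (q.1, ⟨q.2.val, hq⟩)) else .inr q.1) ?_).mono ?_
    · rintro x _ (i | ⟨q, r⟩)
      · rfl
      · simp only [Sum.elim_inr]
        split_ifs with hr
        · rfl
        · have : r.val = k := by have := r.2; omega
          simp [this]
    · simp only [Fintype.card_sum, Fintype.card_prod, Fintype.card_fin, Fintype.card_unit]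
      rw [add_assoc, add_mul, one_mul]
      refine Nat.add_le_add_left (Nat.add_le_add_left (Nat.mul_le_mul_left _ ?_) _) _
      have : Fintype.card γ * k + Fintype.card γ * (Fintype.card A + (k + 1) + 1) ≤
          Fintype.card γ * (Fintype.card A + 2 * n + 2) := by
        rw [← mul_add]
        exact Nat.mul_le_mul_left _ (by omega)
      omega

/-- The indicators of the cells of every coordinate and the digits of the local coordinates. -/
theorem TC.gridBits {ι : Type} [Fintype ι] {β : ι → (Fin D → ℝ) → ℝ} {l s : ℕ} (h : F.TC β l s)
    (N n : ℕ) [NeZero N] (hl : l + 2 + n ≤ F.depth) (hΦ : (N : ℝ) ^ 2 + N + 2 ≤ F.Φ)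
    (hG : ∀ x ∈ F.G, ∀ d, 0 < x d ∧ x d < 1)
    (hoff : ∀ x ∈ F.G, ∀ d, ∀ j : ℤ, F.κ ≤ |x d - j / (N * 2 ^ n)|) :
    F.TC (Sum.elim β (Sum.elim (fun (q : Fin D × Fin N) x => cellBit N q.2 (x q.1))
      fun (q : Fin D × Fin n) x => greedyBit (localCoord N (x q.1)) q.2)) (l + 2 + n)
      (s + F.Q * ((8 + 3 * n) * (D + 1 + Fintype.card ι + D * (N + n + 3)))) := by
  have hN1 : 1 ≤ N := Nat.pos_of_ne_zero (NeZero.ne N)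
  have hN1' : (1 : ℝ) ≤ N := by exact_mod_cast hN1
  have hN : (0 : ℝ) < N := by linarith
  have hκ := F.κ_le
  have hκ0 := F.κ_pos
  have hoff' : ∀ x ∈ F.G, ∀ d, ∀ k : ℕ, F.κ ≤ |x d - k / N| := by
    intro x hx d k
    have := hoff x hx d (k * 2 ^ n)
    push_cast at this
    rwa [mul_div_mul_right _ _ (by positivity)] at this
  -- Unary code of the position: the bits `k / N < x d` for `0 ≤ k ≤ N`.
  have h1 := h.extend (by omega) (γ := Fin D × Fin (N + 1)) (A := Bool)
    (fun q a => if a then some (.inl q.1) else none)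
    (fun q a => if a then 1 else -((q.2.val : ℝ) / N)) (fun q => by
      rw [Fintype.sum_bool]
      simp only [if_true, Bool.false_eq_true, if_false, abs_neg, abs_one]
      have : (q.2.val : ℝ) ≤ N := by exact_mod_cast Nat.le_of_lt_succ q.2.2
      rw [abs_of_nonneg (by positivity)]
      have : (q.2.val : ℝ) / N ≤ 1 := by rwa [div_le_one hN]
      nlinarith)
    (fun q x => if (q.2.val : ℝ) / N < x q.1 then 1 else 0) (fun x hx q => by
      rw [Fintype.sum_bool]
      simp only [if_true, Bool.false_eq_true, if_false, idxVal, one_mul, mul_one]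
      rcases le_abs.1 (hoff' x hx q.1 q.2.val) with h | h
      · left; exact ⟨by linarith, if_pos (by linarith)⟩
      · right; exact ⟨by linarith, if_neg (by linarith)⟩)
  -- A cell is recognized by consecutive unary bits that differ: their difference is `1` in the cell
  -- and `0` elsewhere, and is compared with `1 / 2`.
  have h2 := h1.extend (by omega) (γ := Fin D × Fin N) (A := Fin 3)
    (fun q => ![some (.inr (.inr (q.1, q.2.castSucc))), some (.inr (.inr (q.1, q.2.succ))), none])
    (fun q => ![1, -1, -(1 / 2)]) (fun q => by
      simp only [Fin.sum_univ_three, Matrix.cons_val, abs_neg, abs_one]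
      rw [abs_of_pos (by norm_num : (0 : ℝ) < 1 / 2)]
      nlinarith) (fun q x => cellBit N q.2 (x q.1)) (fun x hx q => by
      simp only [Fin.sum_univ_three, Matrix.cons_val, idxVal, Sum.elim_inr, Fin.val_castSucc,
        Fin.val_succ, Nat.cast_add, Nat.cast_one]
      have hx01 := hG x hx q.1
      have o1 := hoff' x hx q.1 q.2.val
      have c1 : ((q.2.val : ℝ) / N < x q.1) ↔ (q.2.val : ℝ) < N * x q.1 := by
        rw [div_lt_iff₀ hN, mul_comm]
      have c2 : (((q.2.val : ℝ) + 1) / N < x q.1) ↔ (q.2.val : ℝ) + 1 < N * x q.1 := by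
        rw [div_lt_iff₀ hN, mul_comm]
      have n1 : (q.2.val : ℝ) ≠ N * x q.1 := by
        intro he
        have := hoff' x hx q.1 q.2.val
        rw [he, mul_div_cancel_left₀ _ hN.ne', sub_self, abs_zero] at this
        linarith
      have n2 : (q.2.val : ℝ) + 1 ≠ N * x q.1 := by
        intro he
        have := hoff' x hx q.1 (q.2.val + 1)
        push_cast at this
        rw [he, mul_div_cancel_left₀ _ hN.ne', sub_self, abs_zero] at this
        linarith
      simp only [c1, c2]
      rcases cellBit_eq (N := N) hx01.1.le hx01.2 q.2 with ⟨e1, e2, e3⟩ | ⟨e1 | e1, e3⟩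
      · left
        rw [if_pos (lt_of_le_of_ne e1 n1), if_neg (by linarith)]
        exact ⟨by linarith, e3⟩
      · right
        rw [if_neg (by linarith), if_neg (by linarith)]
        exact ⟨by linarith, e3⟩
      · right
        rw [if_pos (by linarith), if_pos (lt_of_le_of_ne e1 n2)]
        exact ⟨by linarith, e3⟩)
  have h3 := h2.reindex (κ := ι ⊕ Fin D × Fin N) (Sum.map Sum.inl id) (β' := Sum.elim β
    fun (q : Fin D × Fin N) x => cellBit N q.2 (x q.1)) (by rintro x _ (i | q) <;> rfl)
  -- The local coordinate is the linear combination of `x d` with coefficient `N` and of the cell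
  -- bits with coefficients `-k`.
  have h4 := h3.digits n (by omega) (γ := Fin D) (A := Unit ⊕ Fin N)
    (fun d a => Sum.elim (fun _ => some (.inl d)) (fun k => some (.inr (.inr (d, k)))) a)
    (fun _ a => Sum.elim (fun _ => (N : ℝ)) (fun k : Fin N => -(k.val : ℝ)) a) (fun q => by
      simp only [Fintype.sum_sum_type, Sum.elim_inl, Sum.elim_inr, abs_neg, Finset.univ_unique,
        Finset.sum_singleton, Nat.abs_cast]
      have : ∑ k : Fin N, (k.val : ℝ) ≤ N ^ 2 := by
        refine (Finset.sum_le_card_nsmul _ _ (N : ℝ) fun k _ => by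
          exact_mod_cast k.2.le).trans (le_of_eq ?_)
        simp [sq]
      linarith) (fun d x => localCoord N (x d)) (fun x hx d => by
      simp only [Fintype.sum_sum_type, Sum.elim_inl, Sum.elim_inr, Finset.univ_unique,
        Finset.sum_singleton, idxVal, cellBit, localCoord]
      simp [sub_eq_add_neg]) (fun x hx d j => by
      have := hoff x hx d ((cellFin N (x d) : ℕ) * 2 ^ n + j)
      -- The dyadic lattice in local coordinates is the grid of mesh `1 / (N 2 ^ n)` in the original
      -- ones, enlarged by the factor `N ≥ 1`.
      have e : localCoord N (x d) - j * (1 / 2) ^ n = N * (x d -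
          (((cellFin N (x d) : ℕ) * 2 ^ n + j : ℤ) : ℝ) / (N * 2 ^ n)) := by
        rw [localCoord]
        push_cast
        rw [one_div, inv_pow]
        field_simp
        ring
      rw [e, abs_mul, abs_of_pos hN]
      nlinarith [abs_nonneg (x d - (((cellFin N (x d) : ℕ) * 2 ^ n + j : ℤ) : ℝ) / (N * 2 ^ n))])
  refine (h4.reindex (Sum.elim (fun i => .inl (.inl i)) (Sum.elim (fun q => .inl (.inr q))
    fun q => .inr q)) (by rintro x _ (i | q | q) <;> rfl)).mono ?_
  simp only [Fintype.card_sum, Fintype.card_prod, Fintype.card_fin, Fintype.card_unit,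
    Fintype.card_bool]
  have e1 : ∀ a b c : ℕ, s + F.Q * a + F.Q * b + n * (F.Q * c) = s + F.Q * (a + b + n * c) := by
    intro a b c; ring
  rw [e1]
  refine Nat.add_le_add_left (Nat.mul_le_mul_left _ ?_) _
  have e2 : D + 1 + (Fintype.card ι + D * N) + D * (1 + N + 2 * n + 2) ≤
      3 * (D + 1 + Fintype.card ι + D * (N + n + 3)) := by nlinarith
  have e3 := Nat.mul_le_mul_left n e2
  nlinarith

/-- Selection from a family of bits by the cell of one coordinate. -/
theorem TC.select_one {ι κ : Type} [Fintype ι] [Fintype κ] {N : ℕ} [NeZero N]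
    {β : ι → (Fin D → ℝ) → ℝ} {V : κ × Fin N → (Fin D → ℝ) → ℝ} {l s : ℕ}
    (h : F.TC (Sum.elim β V) l s) (hl : l + 2 ≤ F.depth) (hΦ : (N : ℝ) + 4 ≤ F.Φ)
    (ic : Fin D → Fin N → ι) (hic : ∀ x ∈ F.G, ∀ d k, β (ic d k) x = cellBit N k (x d))
    (dd : κ → Fin D) :
    F.TC (Sum.elim β fun q x => V (q, cellFin N (x (dd q))) x) (l + 2)
      (s + F.Q * (2 * (D + 1 + Fintype.card ι) + 10 * (Fintype.card κ * N))) := by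
  have hN1 : 1 ≤ N := Nat.pos_of_ne_zero (NeZero.ne N)
  have hb := h.1
  have hκ := F.κ_le
  -- Each entry is masked by the bit of its cell. Exactly one cell bit equals `1`, so the sum of the
  -- masked entries is the selected one.
  have h1 := h.and (by omega) (γ := κ × Fin N) (A := Bool) (by
      have : (0 : ℝ) < N := by exact_mod_cast hN1
      rw [Fintype.card_bool]; push_cast
      have : (1 : ℝ) ≤ N := by exact_mod_cast hN1
      linarith)
    (fun q a => if a then some (.inr (.inr q)) else some (.inr (.inl (ic (dd q.1) q.2))))
    (fun x hx q a => by
      cases a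
      · exact hb x hx (.inl _)
      · exact hb x hx (.inr _))
  have h2 := h1.reindex (κ := ι ⊕ κ × Fin N) (Sum.map Sum.inl id) (β' := Sum.elim β
    fun (q : κ × Fin N) x => V q x * cellBit N q.2 (x (dd q.1))) (by
      rintro x hx (i | q)
      · rfl
      · simp only [Sum.map_inr, id, Sum.elim_inr, Fintype.prod_bool, if_true, Bool.false_eq_true,
          if_false, idxVal, Sum.elim_inl, hic x hx])
  have hval : ∀ x q, ∑ k, V (q, k) x * cellBit N k (x (dd q)) = V (q, cellFin N (x (dd q))) x := by
    intro x q
    simp [cellBit]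
  have h3 := h2.extend (by omega) (γ := κ) (A := Option (Fin N))
    (fun q a => a.elim none fun k => some (.inr (.inr (q, k))))
    (fun _ a => a.elim (-(1 / 2)) fun _ => 1) (fun q => by
      rw [Fintype.sum_option]
      simp only [Option.elim_none, Option.elim_some, abs_one, Finset.sum_const, Finset.card_univ,
        nsmul_eq_mul, mul_one, abs_neg, Fintype.card_fin]
      rw [abs_of_pos (by norm_num : (0 : ℝ) < 1 / 2)]
      linarith) (fun q x => V (q, cellFin N (x (dd q))) x) (fun x hx q => by
      rw [Fintype.sum_option]
      simp only [Option.elim_none, Option.elim_some, one_mul, idxVal, Sum.elim_inr, hval, mul_one]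
      rcases hb x hx (.inr (q, cellFin N (x (dd q)))) with h | h <;>
        simp only [Sum.elim_inr] at h <;> rw [h]
      · right; exact ⟨by linarith, rfl⟩
      · left; exact ⟨by linarith, rfl⟩)
  refine (h3.reindex (Sum.map Sum.inl id) (by rintro x _ (i | q) <;> rfl)).mono ?_
  simp only [Fintype.card_sum, Fintype.card_prod, Fintype.card_fin, Fintype.card_option,
    Fintype.card_bool]
  rw [add_assoc, ← mul_add]
  refine Nat.add_le_add_left (Nat.mul_le_mul_left _ ?_) _
  have := Nat.mul_le_mul_left (Fintype.card κ) hN1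
  nlinarith

/-- Selection from a table of bits by the cells of several coordinates. -/
theorem TC.select {N : ℕ} [NeZero N] {ι : Type} [Fintype ι] {β : ι → (Fin D → ℝ) → ℝ}
    (hΦ : (N : ℝ) + 4 ≤ F.Φ) (ic : Fin D → Fin N → ι)
    (hic : ∀ x ∈ F.G, ∀ d k, β (ic d k) x = cellBit N k (x d)) (p : ℕ) :
    ∀ {κ : Type} [Fintype κ] {V : κ × (Fin p → Fin N) → (Fin D → ℝ) → ℝ} {l s : ℕ}
      (_ : F.TC (Sum.elim β V) l s) (_ : l + 2 * p ≤ F.depth) (dd : κ → Fin p → Fin D),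
      F.TC (Sum.elim β fun q x => V (q, fun i => cellFin N (x (dd q i))) x) (l + 2 * p)
        (s + F.Q * (p * (2 * (D + 1 + Fintype.card ι) + 10 * (Fintype.card κ * N ^ p)))) := by
  have hN1 : 1 ≤ N := Nat.pos_of_ne_zero (NeZero.ne N)
  induction p with
  | zero =>
    intro κ _ V l s h _ dd
    refine (h.reindex (Sum.map id fun q => (q, Fin.elim0)) ?_).mono (by omega)
    rintro x _ (i | q)
    · rfl
    · simp only [Sum.elim_inr, Sum.map_inr]
      congr 2
      exact Subsingleton.elim _ _
  | succ p ih =>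
    intro κ _ V l s h hl dd
    have h1 := h.reindex (κ := ι ⊕ (κ × (Fin p → Fin N)) × Fin N)
      (Sum.map id fun q => (q.1.1, Fin.cons q.2 q.1.2)) (β' := Sum.elim β
        fun (q : (κ × (Fin p → Fin N)) × Fin N) x => V (q.1.1, Fin.cons q.2 q.1.2) x)
      (by rintro x _ (i | q) <;> rfl)
    -- Selection by the first coordinate shrinks the table by the factor `N`; the remaining
    -- coordinates are treated by induction.
    have h2 := h1.select_one (by omega) hΦ ic hic fun q => dd q.1 0
    have h3 := ih (κ := κ) (V := fun q x => V (q.1, Fin.cons (cellFin N (x (dd q.1 0))) q.2) x) h2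
      (by omega) fun q i => dd q i.succ
    have h4 := h3.reindex (κ := ι ⊕ κ) id
      (β' := Sum.elim β fun q x => V (q, fun i => cellFin N (x (dd q i))) x) (by
        rintro x _ (i | q)
        · rfl
        · simp only [id, Sum.elim_inr]
          congr 2
          funext i
          refine Fin.cases ?_ (fun i => ?_) i <;> simp)
    rw [show l + 2 * (p + 1) = l + 2 + 2 * p by ring]
    refine h4.mono ?_
    rw [add_assoc, ← mul_add]
    refine Nat.add_le_add_left (Nat.mul_le_mul_left _ ?_) _
    have e : Fintype.card (κ × (Fin p → Fin N)) * N = Fintype.card κ * N ^ (p + 1) := by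
      simp [Fintype.card_prod, pow_succ, mul_assoc]
    rw [e]
    have e2 : N ^ p ≤ N ^ (p + 1) := Nat.pow_le_pow_right hN1 (by omega)
    have e3 : p * (2 * (D + 1 + Fintype.card ι) + 10 * (Fintype.card κ * N ^ p)) ≤
        p * (2 * (D + 1 + Fintype.card ι) + 10 * (Fintype.card κ * N ^ (p + 1))) := by gcongr
    linarith

/-- The factor of a term: a digit of a local coordinate, or `1`. -/
def digit (N n : ℕ) [NeZero N] (g : Option (Fin D)) (r : Option (Fin n)) (x : Fin D → ℝ) : ℝ :=
  g.elim 1 fun d => r.elim 1 fun i => greedyBit (localCoord N (x d)) i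

open Classical in
/-- Products of table entries, looked up by the cell of the input, and digits of its local
coordinates. -/
theorem TC.gridTerms {ι κ : Type} [Fintype ι] [Fintype κ] {β : ι → (Fin D → ℝ) → ℝ} {l s : ℕ}
    (h : F.TC β l s) (N n k p : ℕ) [NeZero N] (hl : l + (n + 2 * p + 4) ≤ F.depth)
    (hΦ : (N : ℝ) ^ 2 + N + 4 ≤ F.Φ) (hΦk : 2 * (k : ℝ) + 3 ≤ F.Φ)
    (hG : ∀ x ∈ F.G, ∀ d, 0 < x d ∧ x d < 1)
    (hoff : ∀ x ∈ F.G, ∀ d, ∀ j : ℤ, F.κ ≤ |x d - j / (N * 2 ^ n)|)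
    (T : κ → (Fin p → Fin N) → Prop) (dd : κ → Fin p → Fin D) (g : κ → Fin k → Option (Fin D)) :
    F.TC (Sum.elim β fun (q : κ × (Fin k → Option (Fin n))) x =>
      (if T q.1 (fun i => cellFin N (x (dd q.1 i))) then 1 else 0) *
        ∏ j, digit N n (g q.1 j) (q.2 j) x) (l + (n + 2 * p + 4))
      (s + F.Q * ((2 * p + 3 * n + 10) * (D + 1 + Fintype.card ι + D * (N + n + 3)) +
        (10 * p + 3) * (Fintype.card κ * N ^ p) + Fintype.card κ * (n + 1) ^ k * (k + 3))) := by
  have hN1 : 1 ≤ N := Nat.pos_of_ne_zero (NeZero.ne N)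
  have hκ := F.κ_le
  have hN0 : (0 : ℝ) ≤ (N : ℝ) ^ 2 := by positivity
  have h1 := h.gridBits N n (by omega) (by linarith) hG hoff
  -- The table is hard-wired: each entry is the threshold of `1` or `-1` times the constant signal.
  have h2 := h1.extend (by omega) (γ := κ × (Fin p → Fin N)) (A := Unit) (fun _ _ => none)
    (fun q _ => if T q.1 q.2 then 1 else -1) (fun q => by
      have := F.le_Φ
      rw [Finset.univ_unique, Finset.sum_singleton]
      split_ifs <;> simp <;> linarith) (fun q _ => if T q.1 q.2 then 1 else 0) (fun x hx q => by
      rw [Finset.univ_unique, Finset.sum_singleton]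
      simp only [idxVal]
      split_ifs
      · left; exact ⟨by linarith, rfl⟩
      · right; exact ⟨by linarith, rfl⟩)
  have h3 := TC.select (N := N) (by linarith) (fun d k => .inr (.inl (d, k)))
    (fun x _ d k => rfl) p h2 (by omega) dd
  have h4 := h3.and (by omega) (γ := κ × (Fin k → Option (Fin n))) (A := Option (Fin k)) (by
      rw [Fintype.card_option, Fintype.card_fin]; push_cast; linarith)
    (fun q a => a.elim (some (.inr (.inr q.1))) fun j => (g q.1 j).elim none fun d =>
      (q.2 j).elim none fun i => some (.inr (.inl (.inr (.inr (d, i))))))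
    (fun x hx q a => by
      rcases a with _ | j
      · simp only [Option.elim_none, idxVal, Sum.elim_inr]
        split_ifs <;> simp
      · simp only [Option.elim_some]
        rcases g q.1 j with _ | d
        · right; rfl
        · rcases q.2 j with _ | i
          · right; rfl
          · exact greedyBit_eq _ _)
  have h5 := h4.reindex (κ := ι ⊕ κ × (Fin k → Option (Fin n)))
    (Sum.map (fun i => .inl (.inl i)) id) (β' := Sum.elim β
      fun (q : κ × (Fin k → Option (Fin n))) x =>
      (if T q.1 (fun i => cellFin N (x (dd q.1 i))) then 1 else 0) *
        ∏ j, digit N n (g q.1 j) (q.2 j) x) (by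
      rintro x _ (i | q)
      · rfl
      · simp only [Sum.map_inr, id, Sum.elim_inr, Fintype.prod_option, Option.elim_none,
          Option.elim_some]
        congr 1
        refine Finset.prod_congr rfl fun j _ => ?_
        rcases hgj : g q.1 j with _ | d
        · simp [digit, idxVal]
        · rcases hqj : q.2 j with _ | i
          · simp [digit, idxVal]
          · simp [digit, idxVal])
  rw [show l + (n + 2 * p + 4) = l + 2 + n + 1 + 2 * p + 1 by ring]
  refine h5.mono ?_
  simp only [Fintype.card_sum, Fintype.card_prod, Fintype.card_fin, Fintype.card_option,
    Fintype.card_unit, Fintype.card_fun]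
  set W := D + 1 + Fintype.card ι + D * (N + n + 3) with hW
  have e0 : ∀ a b c d : ℕ, s + F.Q * a + F.Q * b + F.Q * c + F.Q * d =
      s + F.Q * (a + b + c + d) := by intro a b c d; ring
  rw [e0]
  refine Nat.add_le_add_left (Nat.mul_le_mul_left _ ?_) _
  have e1 : D + 1 + (Fintype.card ι + (D * N + D * n)) ≤ W := by rw [hW]; nlinarith
  have e2 : 1 ≤ N ^ p := Nat.one_le_pow _ _ hN1
  have e3 : Fintype.card κ ≤ Fintype.card κ * N ^ p := Nat.le_mul_of_pos_right _ e2
  have e4 := Nat.mul_le_mul_left (2 * p) e1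
  nlinarith

end Frame


/-! ### Local Taylor approximation in Hölder balls -/

section Taylor

variable {ι : Type} [Fintype ι] [DecidableEq ι]

/-- The multi-indices of order at most `r`. -/
def multiIdx (ι : Type) [Fintype ι] [DecidableEq ι] (r : ℕ) : Finset (ι → ℕ) :=
  (Fintype.piFinset fun _ => Finset.range (r + 1)).filter fun b => ∑ i, b i ≤ r

theorem mem_multiIdx {r : ℕ} {b : ι → ℕ} : b ∈ multiIdx ι r ↔ ∑ i, b i ≤ r := by
  simp only [multiIdx, Finset.mem_filter, Fintype.mem_piFinset, Finset.mem_range, and_iff_right_iff_imp]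
  intro h i
  exact Nat.lt_succ_of_le ((Finset.single_le_sum (fun _ _ => Nat.zero_le _)
    (Finset.mem_univ i)).trans h)

/-- The monomial `y ^ b / b!`. -/
def taylorMon (b : ι → ℕ) (y : ι → ℝ) : ℝ := ∏ i, y i ^ b i / (b i).factorial

theorem taylorMon_zero (y : ι → ℝ) : taylorMon 0 y = 1 := by simp [taylorMon]

theorem taylorMon_at_zero {b : ι → ℕ} (hb : b ≠ 0) : taylorMon b 0 = 0 := by
  obtain ⟨i, hi⟩ := Function.ne_iff.1 hb
  refine Finset.prod_eq_zero (Finset.mem_univ i) ?_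
  rw [Pi.zero_apply, zero_pow hi, zero_div]

theorem hasDerivAt_taylorMon (b : ι → ℕ) (x x₀ : ι → ℝ) (i : ι) :
    HasDerivAt (fun u => taylorMon b (Function.update x i u - x₀))
      (if b i = 0 then 0 else taylorMon (b - Pi.single i 1) (x - x₀)) (x i) := by
  have h1 : ∀ u, taylorMon b (Function.update x i u - x₀) =
      (u - x₀ i) ^ b i / (b i).factorial *
        ∏ j ∈ Finset.univ.erase i, (x j - x₀ j) ^ b j / (b j).factorial := by
    intro u
    rw [taylorMon, ← Finset.mul_prod_erase _ _ (Finset.mem_univ i)]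
    congr 1
    · simp
    · refine Finset.prod_congr rfl fun j hj => ?_
      rw [Pi.sub_apply, Function.update_of_ne (Finset.ne_of_mem_erase hj)]
  simp only [h1]
  have h2 : HasDerivAt (fun u => (u - x₀ i) ^ b i / (b i).factorial)
      ((b i : ℝ) * (x i - x₀ i) ^ (b i - 1) / (b i).factorial) (x i) := by
    have := (((hasDerivAt_id (x i)).sub_const (x₀ i)).pow (b i)).div_const ((b i).factorial : ℝ)
    simpa using this
  refine (h2.mul_const _).congr_deriv (Eq.symm ?_)
  split_ifs with hb
  · simp [hb]
  · rw [taylorMon, ← Finset.mul_prod_erase _ _ (Finset.mem_univ i)]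
    obtain ⟨c, hc⟩ := Nat.exists_eq_succ_of_ne_zero hb
    congr 1
    · simp only [Pi.sub_apply, Pi.single_eq_same, hc, Nat.succ_eq_add_one, Nat.add_sub_cancel,
        Nat.factorial_succ]
      push_cast
      field_simp
    · refine Finset.prod_congr rfl fun j hj => ?_
      rw [Pi.sub_apply, Pi.sub_apply, Pi.single_eq_of_ne (Finset.ne_of_mem_erase hj), Nat.sub_zero]

/-- The Taylor polynomial of order `r` at `x₀` of the function with derivatives `d`. -/
def taylorPoly (d : (ι → ℕ) → (ι → ℝ) → ℝ) (x₀ : ι → ℝ) (r : ℕ) (a : ι → ℕ) (x : ι → ℝ) : ℝ :=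
  ∑ b ∈ multiIdx ι r, d (a + b) x₀ * taylorMon b (x - x₀)

theorem taylorPoly_self (d : (ι → ℕ) → (ι → ℝ) → ℝ) (x₀ : ι → ℝ) (r : ℕ) (a : ι → ℕ) :
    taylorPoly d x₀ r a x₀ = d a x₀ := by
  rw [taylorPoly, Finset.sum_eq_single 0]
  · rw [add_zero, taylorMon_zero, mul_one]
  · intro b _ hb
    rw [sub_self, taylorMon_at_zero hb, mul_zero]
  · intro h
    exact absurd (mem_multiIdx.2 (by simp)) h

/-- For the monomials `y ^ b / b!` a partial derivative merely shifts the index, so it turns the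
Taylor polynomial of `d a` into that of `d (a + e_i)` with order lowered by one. This drives the
induction for the remainder. -/
theorem hasDerivAt_taylorPoly (d : (ι → ℕ) → (ι → ℝ) → ℝ) (x₀ : ι → ℝ) (r : ℕ) (a : ι → ℕ)
    (x : ι → ℝ) (i : ι) :
    HasDerivAt (fun u => taylorPoly d x₀ (r + 1) a (Function.update x i u))
      (taylorPoly d x₀ r (a + Pi.single i 1) x) (x i) := by
  have h1 : HasDerivAt (fun u => taylorPoly d x₀ (r + 1) a (Function.update x i u))
      (∑ b ∈ multiIdx ι (r + 1), d (a + b) x₀ *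
        (if b i = 0 then 0 else taylorMon (b - Pi.single i 1) (x - x₀))) (x i) := by
    unfold taylorPoly
    exact HasDerivAt.fun_sum fun b _ => (hasDerivAt_taylorMon b x x₀ i).const_mul _
  refine h1.congr_deriv (Eq.symm ?_)
  simp only [mul_ite, mul_zero]
  rw [Finset.sum_ite, Finset.sum_const_zero, zero_add, taylorPoly]
  refine Finset.sum_nbij' (fun c => c + Pi.single i 1) (fun b => b - Pi.single i 1) ?_ ?_ ?_ ?_ ?_
  · intro c hc
    rw [mem_multiIdx] at hc
    refine Finset.mem_filter.2 ⟨mem_multiIdx.2 ?_, by simp⟩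
    simp only [Pi.add_apply, Finset.sum_add_distrib, Finset.sum_pi_single', Finset.mem_univ,
      if_true]
    omega
  · intro b hb
    obtain ⟨hb1, hb2⟩ := Finset.mem_filter.1 hb
    rw [mem_multiIdx] at hb1 ⊢
    have e : b = (b - Pi.single i 1) + Pi.single i 1 := by
      funext j
      by_cases hj : j = i
      · subst hj
        simp only [Pi.add_apply, Pi.sub_apply, Pi.single_eq_same]; omega
      · simp [Pi.single_eq_of_ne hj]
    rw [e] at hb1
    simp only [Pi.add_apply, Finset.sum_add_distrib, Finset.sum_pi_single', Finset.mem_univ,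
      if_true] at hb1
    simpa using hb1
  · intro c _
    funext j; simp
  · intro b hb
    have hb2 := (Finset.mem_filter.1 hb).2
    funext j
    by_cases hj : j = i
    · subst hj
      simp only [Pi.add_apply, Pi.sub_apply, Pi.single_eq_same]; omega
    · simp [Pi.single_eq_of_ne hj]
  · intro c _
    have : c + Pi.single i 1 - Pi.single i 1 = c := by funext j; simp
    rw [this, add_assoc, add_comm (Pi.single i 1) c]

/-- A function with bounded partial derivatives on a box is Lipschitz continuous. -/
theorem abs_sub_le_of_partial_deriv {lo hi : ι → ℝ} (hbox : Set.Icc lo hi ⊆ unitCube ι)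
    {ψ : (ι → ℝ) → ℝ} {ψ' : ι → (ι → ℝ) → ℝ} {E : ℝ}
    (hd : ∀ i, ∀ x ∈ Set.Icc lo hi, HasDerivWithinAt (fun u : ℝ => ψ (Function.update x i u))
      (ψ' i x) (Set.Icc 0 1) (x i))
    (hE : ∀ i, ∀ x ∈ Set.Icc lo hi, |ψ' i x| ≤ E) {x y : ι → ℝ} (hx : x ∈ Set.Icc lo hi)
    (hy : y ∈ Set.Icc lo hi) : |ψ x - ψ y| ≤ E * ∑ i, |x i - y i| := by
  -- The coordinates are changed one at a time; the intermediate points stay in the box, so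
  -- one-dimensional mean value estimates suffice.
  have key : ∀ s : Finset ι, |ψ (fun i => if i ∈ s then x i else y i) - ψ y| ≤
      E * ∑ i ∈ s, |x i - y i| := by
    intro s
    induction s using Finset.induction_on with
    | empty => simp
    | insert i s his ih =>
      set z : ι → ℝ := fun i => if i ∈ s then x i else y i with hz
      have hzmem : ∀ u ∈ Set.uIcc (y i) (x i), Function.update z i u ∈ Set.Icc lo hi := by
        intro u hu
        have hu' : u ∈ Set.Icc (lo i) (hi i) := by
          have := Set.uIcc_subset_Icc (Set.mem_Icc.2 ⟨hy.1 i, hy.2 i⟩)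
            (Set.mem_Icc.2 ⟨hx.1 i, hx.2 i⟩) hu
          exact this
        constructor
        · intro j
          by_cases hj : j = i
          · subst hj; simpa using hu'.1
          · rw [Function.update_of_ne hj, hz]
            dsimp only
            split_ifs
            · exact hx.1 j
            · exact hy.1 j
        · intro j
          by_cases hj : j = i
          · subst hj; simpa using hu'.2
          · rw [Function.update_of_ne hj, hz]
            dsimp only
            split_ifs
            · exact hx.2 j
            · exact hy.2 j
      have hsub : Set.uIcc (y i) (x i) ⊆ Set.Icc 0 1 := by
        intro u hu
        have := hbox (hzmem u hu)
        have h1 := this.1 i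
        have h2 := this.2 i
        simp only [Function.update_self, Pi.zero_apply, Pi.one_apply] at h1 h2
        exact ⟨h1, h2⟩
      have hmv := Convex.norm_image_sub_le_of_norm_hasDerivWithin_le (s := Set.uIcc (y i) (x i))
        (f := fun u => ψ (Function.update z i u)) (f' := fun u => ψ' i (Function.update z i u))
        (C := E) (fun u hu => by
          have := hd i _ (hzmem u hu)
          simp only [Function.update_idem, Function.update_self] at this
          exact this.mono hsub) (fun u hu => hE i _ (hzmem u hu)) (convex_uIcc _ _)
        Set.left_mem_uIcc Set.right_mem_uIcc
      have e1 : Function.update z i (x i) = fun j => if j ∈ insert i s then x j else y j := by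
        funext j
        by_cases hj : j = i
        · subst hj; simp
        · simp [hz, hj]
      have e2 : Function.update z i (y i) = z := by
        rw [Function.update_eq_self_iff, hz]; simp [his]
      simp only [e1, e2, Real.norm_eq_abs] at hmv
      rw [Finset.sum_insert his, mul_add]
      exact (abs_sub_le _ (ψ z) _).trans (add_le_add hmv ih)
  simpa using key Finset.univ

/-- Taylor's theorem on a small box, for functions whose partial derivatives are given as in the
definition of the Hölder ball. -/
theorem abs_sub_taylorPoly_le {d : (ι → ℕ) → (ι → ℝ) → ℝ} {K : ℕ} {x₀ : ι → ℝ} {h : ℝ}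
    (hh : 0 ≤ h) (hbox : Set.Icc x₀ (fun i => x₀ i + h) ⊆ unitCube ι)
    (hd : ∀ a : ι → ℕ, ∑ i, a i < K → ∀ i, ∀ x ∈ unitCube ι,
      HasDerivWithinAt (fun u : ℝ => d a (Function.update x i u))
        (d (a + Pi.single i 1) x) (Set.Icc 0 1) (x i)) {E : ℝ} (hE0 : 0 ≤ E)
    (hE : ∀ a : ι → ℕ, ∑ i, a i = K → ∀ x ∈ Set.Icc x₀ (fun i => x₀ i + h),
      |d a x - d a x₀| ≤ E) :
    ∀ r ≤ K, ∀ a : ι → ℕ, ∑ i, a i + r = K → ∀ x ∈ Set.Icc x₀ (fun i => x₀ i + h),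
      |d a x - taylorPoly d x₀ r a x| ≤ (Fintype.card ι * h) ^ r * E := by
  have hx₀ : x₀ ∈ Set.Icc x₀ (fun i => x₀ i + h) := ⟨le_rfl, fun i => by simpa using hh⟩
  intro r
  induction r with
  | zero =>
    intro _ a ha x hx
    have : taylorPoly d x₀ 0 a x = d a x₀ := by
      rw [taylorPoly, Finset.sum_eq_single 0]
      · rw [add_zero, taylorMon_zero, mul_one]
      · intro b hb hb0
        rw [mem_multiIdx] at hb
        refine absurd (funext fun i => ?_) hb0
        have := (Finset.single_le_sum (f := b) (fun _ _ => Nat.zero_le _) (Finset.mem_univ i)).trans hb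
        simpa using this
      · intro h
        exact absurd (mem_multiIdx.2 (by simp)) h
    rw [this, pow_zero, one_mul]
    exact hE a (by omega) x hx
  | succ r ih =>
    intro hr a ha x hx
    -- The remainder vanishes at `x₀`, and its partial derivatives are remainders of order `r`,
    -- bounded by the induction hypothesis.
    have h1 := abs_sub_le_of_partial_deriv hbox
      (ψ := fun x => d a x - taylorPoly d x₀ (r + 1) a x)
      (ψ' := fun i x => d (a + Pi.single i 1) x - taylorPoly d x₀ r (a + Pi.single i 1) x)
      (E := (Fintype.card ι * h) ^ r * E) (fun i x hx =>
        (hd a (by omega) i x (hbox hx)).sub (hasDerivAt_taylorPoly d x₀ r a x i).hasDerivWithinAt)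
      (fun i x hx => ih (by omega) _ (by
        simp only [Pi.add_apply, Finset.sum_add_distrib, Finset.sum_pi_single', Finset.mem_univ,
          if_true]
        omega) x hx) hx hx₀
    simp only [taylorPoly_self, sub_self, sub_zero] at h1
    refine h1.trans ?_
    have h2 : ∑ i, |x i - x₀ i| ≤ Fintype.card ι * h := by
      refine (Finset.sum_le_card_nsmul _ _ h fun i _ => ?_).trans (le_of_eq ?_)
      · have e1 := hx.1 i
        have e2 := hx.2 i
        rw [abs_le]
        constructor <;> linarith
      · simp
    calc _ ≤ (Fintype.card ι * h) ^ r * E * (Fintype.card ι * h) := by gcongr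
      _ = _ := by rw [pow_succ]; ring

theorem holder_dist_le [Nonempty ι] {x y : ι → ℝ} {h γ : ℝ} (hh : 0 ≤ h) (hγ0 : 0 ≤ γ)
    (hγ1 : γ ≤ 1) (hxy : ∀ i, |x i - y i| ≤ h) :
    √(∑ i, (x i - y i) ^ 2) ^ γ ≤ Fintype.card ι * h ^ γ := by
  have hc : (1 : ℝ) ≤ Fintype.card ι := by exact_mod_cast Fintype.card_pos
  have h1 : √(∑ i, (x i - y i) ^ 2) ≤ Fintype.card ι * h := by
    rw [Real.sqrt_le_left (by positivity)]
    refine (Finset.sum_le_card_nsmul _ _ (h ^ 2) fun i _ => sq_le_sq' ?_ ?_).trans ?_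
    · exact (abs_le.1 (hxy i)).1
    · exact (abs_le.1 (hxy i)).2
    · rw [Finset.card_univ, nsmul_eq_mul, mul_pow]
      have : (Fintype.card ι : ℝ) ≤ Fintype.card ι ^ 2 := by nlinarith
      gcongr
  calc √(∑ i, (x i - y i) ^ 2) ^ γ ≤ (Fintype.card ι * h) ^ γ := by gcongr
    _ = (Fintype.card ι : ℝ) ^ γ * h ^ γ := Real.mul_rpow (by positivity) hh
    _ ≤ (Fintype.card ι : ℝ) ^ (1 : ℝ) * h ^ γ := by gcongr
    _ = _ := by rw [Real.rpow_one]

/-- If `⌊β⌋ = 0` the Hölder quotient of the function itself is bounded; otherwise the bounded first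
partial derivatives give a Lipschitz estimate. -/
theorem continuousOn_of_mem_holderBall [Nonempty ι] {β F : ℝ} (hβ : 0 < β) {f : (ι → ℝ) → ℝ}
    (hf : f ∈ holderBall ι β F) : ContinuousOn f (unitCube ι) := by
  obtain ⟨d, s, t, hs, ht, hst, h0, h1, h2, h3⟩ := hf
  intro x hx
  have hbd : ∃ b : (ι → ℝ) → ℝ, Continuous b ∧ b x = 0 ∧ ∀ y ∈ unitCube ι, |f y - f x| ≤ b y := by
    rcases Nat.eq_zero_or_pos ⌊β⌋₊ with hk | hk
    · refine ⟨fun y => t * √(∑ i, (y i - x i) ^ 2) ^ β, ?_, ?_, fun y hy => ?_⟩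
      · refine continuous_const.mul (Continuous.rpow_const (by fun_prop) fun y => Or.inr hβ.le)
      · simp [hβ.ne']
      · rcases eq_or_ne y x with rfl | hne
        · simp [hβ.ne']
        · have := h3 0 (by simp [hk]) y hy x hx hne
          rw [h0 y hy, h0 x hx, hk] at this
          simpa using this
    · refine ⟨fun y => s * ∑ i, |y i - x i|, by fun_prop, by simp, fun y hy => ?_⟩
      have := abs_sub_le_of_partial_deriv (lo := 0) (hi := 1) (E := s) (ψ := d 0) subset_rfl
        (fun i x hx => h1 0 (by simpa using hk) i x hx) (fun i x hx => h2 _ (by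
          simp only [zero_add, Finset.sum_pi_single', Finset.mem_univ, if_true]
          omega) x hx) hy hx
      rwa [h0 y hy, h0 x hx] at this
  obtain ⟨b, hb, hbx, hle⟩ := hbd
  rw [ContinuousWithinAt, tendsto_iff_norm_sub_tendsto_zero]
  refine squeeze_zero' (Eventually.of_forall fun _ => norm_nonneg _)
    (eventually_mem_nhdsWithin.mono fun y hy => hle y hy) ?_
  have := (hb.tendsto x).mono_left (nhdsWithin_le_nhds (s := unitCube ι))
  rwa [hbx] at this

theorem abs_le_of_mem_holderBall {β F : ℝ} {f : (ι → ℝ) → ℝ}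
    (hf : f ∈ holderBall ι β F) {x : ι → ℝ} (hx : x ∈ unitCube ι) : |f x| ≤ F := by
  obtain ⟨d, s, t, hs, ht, hst, h0, h1, h2, h3⟩ := hf
  rw [← h0 x hx]
  exact (h2 0 (by simp) x hx).trans (by linarith)

theorem holderBall_comp_equiv {κ : Type} [Fintype κ] [DecidableEq κ] (e : κ ≃ ι) {β F : ℝ}
    {f : (ι → ℝ) → ℝ} (hf : f ∈ holderBall ι β F) :
    (fun y : κ → ℝ => f fun i => y (e.symm i)) ∈ holderBall κ β F := by
  obtain ⟨d, s, t, hs, ht, hst, h0, h1, h2, h3⟩ := hf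
  have hcube : ∀ y ∈ unitCube κ, (fun i => y (e.symm i)) ∈ unitCube ι := fun y hy =>
    ⟨fun i => hy.1 (e.symm i), fun i => hy.2 (e.symm i)⟩
  have hsum : ∀ a : κ → ℕ, ∑ i, a (e.symm i) = ∑ j, a j := fun a => Equiv.sum_comp e.symm a
  refine ⟨fun a y => d (fun i => a (e.symm i)) fun i => y (e.symm i), s, t, hs, ht, hst,
    fun y hy => h0 _ (hcube y hy), fun a ha j y hy => ?_, fun a ha y hy => ?_,
    fun a ha y hy y' hy' hne => ?_⟩
  · have := h1 (fun i => a (e.symm i)) (by rwa [hsum]) (e j) _ (hcube y hy)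
    rw [e.symm_apply_apply] at this
    have e1 : ∀ u, (fun i => Function.update y j u (e.symm i)) =
        Function.update (fun i => y (e.symm i)) (e j) u := by
      intro u
      funext i
      by_cases hi : i = e j
      · subst hi; simp
      · rw [Function.update_of_ne hi, Function.update_of_ne fun h => hi (by rw [← h]; simp)]
    have e2 : (fun i => (a + Pi.single j 1 : κ → ℕ) (e.symm i)) =
        (fun i => a (e.symm i)) + Pi.single (e j) 1 := by
      funext i
      by_cases hi : i = e j
      · subst hi; simp
      · rw [Pi.add_apply, Pi.add_apply, Pi.single_eq_of_ne hi,
          Pi.single_eq_of_ne fun h => hi (by rw [← h]; simp)]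
    simp only [e1, e2]
    exact this
  · exact h2 _ (by rwa [hsum]) _ (hcube y hy)
  · have := h3 (fun i => a (e.symm i)) (by rwa [hsum]) _ (hcube y hy) _ (hcube y' hy')
      fun h => hne (funext fun j => by simpa using congrFun h (e j))
    have e3 : ∑ i, (y (e.symm i) - y' (e.symm i)) ^ 2 = ∑ j, (y j - y' j) ^ 2 :=
      Equiv.sum_comp e.symm fun j => (y j - y' j) ^ 2
    rwa [e3] at this

/-- The local polynomial approximation of a function in a Hölder ball, in local coordinates of a
cell of side length `1 / N`. -/
theorem exists_local_coeffs [Nonempty ι] {β F : ℝ} (hβ : 0 < β) {f : (ι → ℝ) → ℝ}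
    (hf : f ∈ holderBall ι β F) {N : ℕ} (hN : 1 ≤ N) (k : ι → Fin N) :
    ∃ C : (ι → ℕ) → ℝ, (∀ b ∈ multiIdx ι ⌊β⌋₊, |C b| ≤ F) ∧
      (∀ b ∈ multiIdx ι ⌊β⌋₊, b ≠ 0 → |C b| ≤ F * (1 / N)) ∧
      ∀ y ∈ unitCube ι, |f (fun i => ((k i : ℕ) + y i) / N) -
        ∑ b ∈ multiIdx ι ⌊β⌋₊, C b * ∏ i, y i ^ b i| ≤
          F * Fintype.card ι ^ (⌊β⌋₊ + 1) * (1 / N : ℝ) ^ β := by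
  obtain ⟨d, s, t, hs, ht, hst, h0, h1, h2, h3⟩ := hf
  have hN0 : (0 : ℝ) < N := by exact_mod_cast hN
  set h : ℝ := 1 / N with hh
  have hh0 : 0 < h := by positivity
  have hh1 : h ≤ 1 := by
    rw [hh, div_le_one hN0]; exact_mod_cast hN
  set x₀ : ι → ℝ := fun i => (k i : ℕ) / N with hx₀
  have hbox : Set.Icc x₀ (fun i => x₀ i + h) ⊆ unitCube ι := by
    intro x hx
    constructor
    · intro i
      exact le_trans (by positivity) (hx.1 i)
    · intro i
      refine (hx.2 i).trans ?_
      have : ((k i : ℕ) : ℝ) + 1 ≤ N := by exact_mod_cast (k i).2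
      simp only [hx₀, hh, Pi.one_apply]
      rw [← add_div, div_le_one hN0]
      exact this
  have hx₀m : x₀ ∈ unitCube ι := hbox ⟨le_rfl, fun i => by simpa using hh0.le⟩
  have hγ0 : 0 ≤ β - ⌊β⌋₊ := sub_nonneg.2 (Nat.floor_le hβ.le)
  have hγ1 : β - ⌊β⌋₊ ≤ 1 := by have := Nat.lt_floor_add_one β; linarith
  have hF : 0 ≤ F := by linarith
  have hfac : ∀ b : ι → ℕ, (1 : ℝ) ≤ ∏ i, ((b i).factorial : ℝ) := fun b => by
    exact_mod_cast Finset.prod_pos fun i _ => (b i).factorial_pos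
  have hCle : ∀ b ∈ multiIdx ι ⌊β⌋₊,
      |d b x₀ * h ^ (∑ i, b i) / ∏ i, ((b i).factorial : ℝ)| ≤ F * h ^ (∑ i, b i) := by
    intro b hb
    have e1 := h2 b (mem_multiIdx.1 hb) x₀ hx₀m
    have hp : 0 ≤ h ^ (∑ i, b i) := by positivity
    rw [abs_div, abs_mul, abs_of_nonneg hp, abs_of_pos (zero_lt_one.trans_le (hfac b))]
    refine (div_le_self (by positivity) (hfac b)).trans ?_
    gcongr
    linarith
  refine ⟨fun b => d b x₀ * h ^ (∑ i, b i) / ∏ i, ((b i).factorial : ℝ), fun b hb => ?_,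
    fun b hb hb0 => ?_, fun y hy => ?_⟩
  · refine (hCle b hb).trans (mul_le_of_le_one_right hF (pow_le_one₀ hh0.le hh1))
  · refine (hCle b hb).trans (mul_le_mul_of_nonneg_left ?_ hF)
    have : ∑ i, b i ≠ 0 := by
      intro hsum
      apply hb0
      funext i
      exact (Finset.sum_eq_zero_iff.1 hsum) i (Finset.mem_univ i)
    exact pow_le_of_le_one hh0.le hh1 this
  · set x : ι → ℝ := fun i => ((k i : ℕ) + y i) / N with hx
    have hxx : ∀ i, x i - x₀ i = h * y i := fun i => by
      simp only [hx, hx₀, hh]; field_simp; ring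
    have hxm : x ∈ Set.Icc x₀ (fun i => x₀ i + h) := by
      constructor
      · intro i
        have := hxx i
        have h5 : 0 ≤ h * y i := mul_nonneg hh0.le (hy.1 i)
        linarith
      · intro i
        have := hxx i
        have h5 : h * y i ≤ h * 1 := mul_le_mul_of_nonneg_left (hy.2 i) hh0.le
        show x i ≤ x₀ i + h
        linarith
    have hT := abs_sub_taylorPoly_le hh0.le hbox h1 (E := F * (Fintype.card ι * h ^ (β - ⌊β⌋₊)))
      (by positivity)
      (fun a ha z hz => by
        rcases eq_or_ne z x₀ with rfl | hne
        · rw [sub_self, abs_zero]; positivity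
        · refine (h3 a ha z (hbox hz) x₀ hx₀m hne).trans ?_
          have := holder_dist_le (x := z) (y := x₀) hh0.le hγ0 hγ1 (fun i => by
            have e1 := hz.1 i
            have e2 := hz.2 i
            rw [abs_le]; constructor <;> linarith)
          have htF : t ≤ F := by linarith
          gcongr) ⌊β⌋₊ le_rfl 0 (by simp) x hxm
    rw [h0 x (hbox hxm)] at hT
    have e1 : taylorPoly d x₀ ⌊β⌋₊ 0 x = ∑ b ∈ multiIdx ι ⌊β⌋₊,
        d b x₀ * h ^ (∑ i, b i) / (∏ i, ((b i).factorial : ℝ)) * ∏ i, y i ^ b i := by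
      refine Finset.sum_congr rfl fun b _ => ?_
      rw [zero_add, taylorMon]
      simp only [Pi.sub_apply, hxx, Finset.prod_div_distrib, mul_pow, Finset.prod_mul_distrib,
        Finset.prod_pow_eq_pow_sum]
      ring
    rw [← e1]
    refine hT.trans (le_of_eq ?_)
    have e2 : h ^ β = h ^ ⌊β⌋₊ * h ^ (β - ⌊β⌋₊) := by
      rw [← Real.rpow_natCast h, ← Real.rpow_add hh0]; congr 1; ring
    rw [e2, mul_pow, pow_succ]
    ring

end Taylor


/-! ### Digital piecewise polynomial approximation -/

open Frame (digit)

/-- Padding by factors `1` (the value `none`) gives all monomials of degree at most `K` the same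
shape, a product of exactly `K` factors. -/
theorem exists_prod_factors {ι : Type} [Fintype ι] [DecidableEq ι] (K : ℕ) :
    ∀ b : ι → ℕ, ∑ i, b i ≤ K → ∃ g : Fin K → Option ι,
      ∀ y : ι → ℝ, ∏ j, (g j).elim 1 y = ∏ i, y i ^ b i := by
  induction K with
  | zero =>
    intro b hb
    have : ∀ i, b i = 0 := fun i =>
      Finset.sum_eq_zero_iff.1 (Nat.le_zero.1 hb) i (Finset.mem_univ i)
    exact ⟨Fin.elim0, fun y => by simp [this]⟩
  | succ K ih =>
    intro b hb
    by_cases h0 : ∀ i, b i = 0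
    · exact ⟨fun _ => none, fun y => by simp [h0]⟩
    · push Not at h0
      obtain ⟨i, hi⟩ := h0
      have h1 : b = (b - Pi.single i 1) + Pi.single i 1 := by
        funext j
        rcases eq_or_ne j i with rfl | hj
        · simp; omega
        · simp [hj]
      have h2 : ∑ j, (b - Pi.single i 1 : ι → ℕ) j ≤ K := by
        have : ∑ j, b j = ∑ j, (b - Pi.single i 1 : ι → ℕ) j + 1 := by
          conv_lhs => rw [h1]
          simp [Finset.sum_add_distrib]
        omega
      obtain ⟨g, hg⟩ := ih _ h2
      refine ⟨Fin.cons (some i) g, fun y => ?_⟩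
      rw [Fin.prod_univ_succ]
      simp only [Fin.cons_zero, Fin.cons_succ, Option.elim_some, hg]
      conv_rhs => rw [h1]
      simp only [Pi.add_apply, pow_add, Finset.prod_mul_distrib]
      rw [mul_comm]
      congr 1
      rw [Finset.prod_eq_single i]
      · simp
      · intro j _ hj; simp [hj]
      · simp

/-- The monomial of a multi-index as a product of coordinates. -/
def monFactors {ι : Type} [Fintype ι] [DecidableEq ι] (K : ℕ) (b : multiIdx ι K) :
    Fin K → Option ι :=
  (exists_prod_factors K b.1 (mem_multiIdx.1 b.2)).choose

theorem prod_monFactors {ι : Type} [Fintype ι] [DecidableEq ι] {K : ℕ} (b : multiIdx ι K)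
    (y : ι → ℝ) : ∏ j, (monFactors K b j).elim 1 y = ∏ i, y i ^ b.1 i :=
  (exists_prod_factors K b.1 (mem_multiIdx.1 b.2)).choose_spec y

/-- The weights of the digits of a coefficient in `[-1, 1]`. -/
def coeffWeight (m : ℕ) : Option (Fin m) → ℝ
  | none => -1
  | some i => 2 * (1 / 2) ^ (i.val + 1)

/-- The weights of the digits of a factor of a monomial. -/
def factorWeight {ι : Type} {n : ℕ} : Option ι → Option (Fin n) → ℝ
  | none, none => 1
  | none, some _ => 0
  | some _, none => 0
  | some _, some s => (1 / 2) ^ (s.val + 1)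

/-- The weights of the digital piecewise polynomial approximation. -/
def gridWeight {ι : Type} [Fintype ι] [DecidableEq ι] (K n m : ℕ)
    (q : (multiIdx ι K × Option (Fin m)) × (Fin K → Option (Fin n))) : ℝ :=
  coeffWeight m q.1.2 * ∏ j, factorWeight (monFactors K q.1.1 j) (q.2 j)

theorem sum_half_pow (k : ℕ) : ∑ j : Fin k, (1 / 2 : ℝ) ^ (j.val + 1) = 1 - (1 / 2) ^ k := by
  induction k with
  | zero => simp
  | succ k ih =>
    rw [Fin.sum_univ_castSucc]
    simp only [Fin.val_castSucc, Fin.val_last, ih]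
    ring

theorem sum_abs_factorWeight_le {ι : Type} {n : ℕ} (o : Option ι) :
    ∑ r : Option (Fin n), |factorWeight o r| ≤ 1 := by
  rw [Fintype.sum_option]
  rcases o with _ | i
  · simp [factorWeight]
  · simp only [factorWeight, abs_zero, zero_add]
    rw [Finset.sum_congr rfl fun j _ => abs_of_nonneg (by positivity : (0 : ℝ) ≤ (1 / 2) ^ (j.val + 1)),
      sum_half_pow]
    have : (0 : ℝ) ≤ (1 / 2) ^ n := by positivity
    linarith

theorem sum_abs_coeffWeight_le (m : ℕ) : ∑ i, |coeffWeight m i| ≤ 3 := by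
  rw [Fintype.sum_option]
  simp only [coeffWeight, abs_neg, abs_one]
  rw [Finset.sum_congr rfl fun j _ => abs_of_nonneg
    (by positivity : (0 : ℝ) ≤ 2 * (1 / 2) ^ (j.val + 1)), ← Finset.mul_sum, sum_half_pow]
  have : (0 : ℝ) ≤ (1 / 2) ^ m := by positivity
  linarith

/-- The sum over the digit tuples factorizes, and the digit weights of each factor sum to at most
`1`. Thus the bound does not depend on the numbers of digits. -/
theorem sum_abs_gridWeight_le {ι : Type} [Fintype ι] [DecidableEq ι] (K n m : ℕ) :
    ∑ q, |gridWeight (ι := ι) K n m q| ≤ 3 * (multiIdx ι K).card := by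
  rw [Fintype.sum_prod_type, Fintype.sum_prod_type]
  have h1 : ∀ b : multiIdx ι K, ∑ i : Option (Fin m), ∑ q : Fin K → Option (Fin n),
      |gridWeight K n m ((b, i), q)| ≤ 3 := by
    intro b
    have h2 : ∀ i : Option (Fin m), ∑ q : Fin K → Option (Fin n),
        |gridWeight K n m ((b, i), q)| ≤ |coeffWeight m i| := by
      intro i
      simp only [gridWeight, abs_mul, Finset.abs_prod, ← Finset.mul_sum]
      refine mul_le_of_le_one_right (abs_nonneg _) ?_
      have h3 := Finset.prod_univ_sum (fun _ : Fin K => (Finset.univ : Finset (Option (Fin n))))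
        (fun j r => |factorWeight (monFactors K b j) r|)
      rw [Fintype.piFinset_univ] at h3
      rw [← h3]
      exact Finset.prod_le_one (fun j _ => Finset.sum_nonneg fun _ _ => abs_nonneg _)
        fun j _ => sum_abs_factorWeight_le _
    exact (Finset.sum_le_sum fun i _ => h2 i).trans (sum_abs_coeffWeight_le m)
  refine (Finset.sum_le_sum fun b _ => h1 b).trans (le_of_eq ?_)
  simp [mul_comm]

/-- All weights lie on one dyadic lattice, hence so do all combinations of bits with these weights.
This provides the margin when the result is digitized. -/
theorem gridWeight_lattice {ι : Type} [Fintype ι] [DecidableEq ι] (K n m : ℕ)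
    (q : (multiIdx ι K × Option (Fin m)) × (Fin K → Option (Fin n))) :
    ∃ j : ℤ, gridWeight K n m q = j * (1 / 2) ^ (m + n * K) := by
  have h1 : ∃ j : ℤ, coeffWeight m q.1.2 = j * (1 / 2) ^ m := by
    rcases q.1.2 with _ | i
    · exact ⟨-2 ^ m, by push_cast; simp [coeffWeight]⟩
    · obtain ⟨j, hj⟩ := half_pow_eq (m := i.val + 1) (n := m) i.2
      exact ⟨2 * j, by push_cast; simp only [coeffWeight, hj]; ring⟩
  have h2 : ∀ l, ∃ j : ℤ, factorWeight (monFactors K q.1.1 l) (q.2 l) = j * (1 / 2) ^ n := by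
    intro l
    rcases monFactors K q.1.1 l with _ | d <;> rcases q.2 l with _ | s
    · exact ⟨2 ^ n, by push_cast; simp [factorWeight]⟩
    · exact ⟨0, by simp [factorWeight]⟩
    · exact ⟨0, by simp [factorWeight]⟩
    · exact half_pow_eq s.2
  obtain ⟨j, hj⟩ := h1
  choose i hi using h2
  refine ⟨j * ∏ l, i l, ?_⟩
  rw [gridWeight, hj, Finset.prod_congr rfl fun l _ => hi l, Finset.prod_mul_distrib]
  simp only [Finset.prod_const, Finset.card_univ, Fintype.card_fin, pow_add, pow_mul]
  push_cast
  ring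

theorem abs_prod_sub_prod_le {A : Type} (s : Finset A) (a b : A → ℝ)
    (ha : ∀ i ∈ s, 0 ≤ a i ∧ a i ≤ 1) (hb : ∀ i ∈ s, 0 ≤ b i ∧ b i ≤ 1) {e : ℝ}
    (he : ∀ i ∈ s, |a i - b i| ≤ e) : |∏ i ∈ s, a i - ∏ i ∈ s, b i| ≤ s.card * e := by
  classical
  induction s using Finset.induction_on with
  | empty => simp
  | insert i s hi ih =>
    rw [Finset.prod_insert hi, Finset.prod_insert hi, Finset.card_insert_of_notMem hi]
    have h1 := ih (fun j hj => ha j (Finset.mem_insert_of_mem hj))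
      (fun j hj => hb j (Finset.mem_insert_of_mem hj)) fun j hj => he j (Finset.mem_insert_of_mem hj)
    have h2 := ha i (Finset.mem_insert_self _ _)
    have h3 := he i (Finset.mem_insert_self _ _)
    have h4 : 0 ≤ ∏ j ∈ s, b j := Finset.prod_nonneg fun j hj => (hb j (Finset.mem_insert_of_mem hj)).1
    have h5 : ∏ j ∈ s, b j ≤ 1 := Finset.prod_le_one
      (fun j hj => (hb j (Finset.mem_insert_of_mem hj)).1)
      fun j hj => (hb j (Finset.mem_insert_of_mem hj)).2
    have h6 : a i * ∏ j ∈ s, a j - b i * ∏ j ∈ s, b j =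
        a i * (∏ j ∈ s, a j - ∏ j ∈ s, b j) + (a i - b i) * ∏ j ∈ s, b j := by ring
    rw [h6]
    refine (abs_add_le _ _).trans ?_
    rw [abs_mul, abs_mul, abs_of_nonneg h2.1, abs_of_nonneg h4]
    push_cast
    nlinarith [mul_le_mul_of_nonneg_right h2.2 (abs_nonneg (∏ j ∈ s, a j - ∏ j ∈ s, b j)),
      mul_le_mul_of_nonneg_left h5 (abs_nonneg (a i - b i))]

theorem digit_map {D p N n : ℕ} [NeZero N] (e : Fin p → Fin D) (g : Option (Fin p))
    (r : Option (Fin n)) (x : Fin D → ℝ) :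
    digit N n (g.map e) r x = digit N n g r fun i => x (e i) := by
  cases g <;> rfl

theorem sum_factorWeight_mul_digit {p N n : ℕ} [NeZero N] (g : Option (Fin p)) (x : Fin p → ℝ) :
    ∑ r : Option (Fin n), factorWeight g r * digit N n g r x =
      g.elim 1 fun d => greedySum (localCoord N (x d)) n := by
  rw [Fintype.sum_option]
  rcases g with _ | d
  · simp [factorWeight, digit]
  · simp [factorWeight, digit, greedySum_eq_sum]

theorem sum_coeffWeight_mul (m : ℕ) (u : ℝ) (t : Option (Fin m) → ℝ) (h0 : t none = 1)
    (h1 : ∀ i : Fin m, t (some i) = greedyBit u i) :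
    ∑ i, coeffWeight m i * t i = -1 + 2 * greedySum u m := by
  rw [Fintype.sum_option, greedySum_eq_sum, Finset.mul_sum]
  simp only [coeffWeight, h0, h1, mul_one, mul_assoc]

open Classical in
/-- Digital approximation of Hölder functions on the open cube: the entries of the table `T` are
digits of the Taylor coefficients on the cells of a grid. -/
theorem exists_gridApprox {p : ℕ} [NeZero p] {β F : ℝ} (hβ : 0 < β) (hF : 0 < F)
    {f : (Fin p → ℝ) → ℝ} (hf : f ∈ holderBall (Fin p) β F) (N n m : ℕ) [NeZero N] :
    ∃ T : multiIdx (Fin p) ⌊β⌋₊ × Option (Fin m) → (Fin p → Fin N) → Prop,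
      ∀ x : Fin p → ℝ, (∀ d, 0 < x d ∧ x d < 1) →
        |f x - ∑ q : (multiIdx (Fin p) ⌊β⌋₊ × Option (Fin m)) × (Fin ⌊β⌋₊ → Option (Fin n)),
          F * gridWeight ⌊β⌋₊ n m q * ((if T q.1 (fun i => cellFin N (x i)) then 1 else 0) *
            ∏ j, digit N n (monFactors ⌊β⌋₊ q.1.1 j) (q.2 j) x)| ≤
        F * (p ^ (⌊β⌋₊ + 1) * (1 / N : ℝ) ^ β + (multiIdx (Fin p) ⌊β⌋₊).card *
          (⌊β⌋₊ * ((1 / 2) ^ n * (1 / N)) + 2 * (1 / 2) ^ m)) := by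
  set K := ⌊β⌋₊ with hK
  have hN1 : 1 ≤ N := Nat.pos_of_ne_zero (NeZero.ne N)
  have hN0 : (0 : ℝ) < N := by exact_mod_cast hN1
  choose C hC1 hC2 hC3 using fun k => exists_local_coeffs hβ hf hN1 k
  -- The coefficient `C` in `[-F, F]` is stored through the digits of `(C / F + 1) / 2`; the entry
  -- `none` is constantly `1` and carries the weight `-1`.
  refine ⟨fun q k => q.2.elim True fun i => greedyBit ((C k q.1.1 / F + 1) / 2) i = 1,
    fun x hx => ?_⟩
  set k : Fin p → Fin N := fun i => cellFin N (x i) with hk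
  set y : Fin p → ℝ := fun i => localCoord N (x i) with hy
  set z : Fin p → ℝ := fun i => greedySum (y i) n with hz
  set c : multiIdx (Fin p) K → ℝ := fun b => -1 + 2 * greedySum ((C k b.1 / F + 1) / 2) m with hc
  have hy0 : ∀ i, 0 ≤ y i ∧ y i ≤ 1 := fun i => by
    have := cellFin_val (N := N) (hx i).1.le (hx i).2
    constructor <;> simp only [hy, localCoord] <;> linarith
  have hz0 : ∀ i, 0 ≤ z i ∧ z i ≤ 1 := fun i =>
    ⟨greedySum_nonneg _ _, (greedySum_le (hy0 i).1 n).trans (hy0 i).2⟩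
  have hyz : ∀ i, |y i - z i| ≤ (1 / 2) ^ n := fun i => by
    have := abs_greedySum_sub_le (u := y i) (hy0 i).1 (hy0 i).2 n
    rwa [sub_self, abs_zero, zero_add, abs_sub_comm] at this
  have hxk : (fun i => ((k i : ℕ) + y i) / N) = x := by
    funext i
    simp only [hk, hy, localCoord]
    field_simp
    ring
  have h3 := hC3 k y ⟨fun i => (hy0 i).1, fun i => (hy0 i).2⟩
  rw [hxk, Fintype.card_fin] at h3
  have hCu : ∀ b : multiIdx (Fin p) K, |C k b.1 - F * c b| ≤ 2 * F * (1 / 2) ^ m := by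
    intro b
    have h4 := abs_le.1 (hC1 k b.1 b.2)
    have e1 : 0 ≤ (C k b.1 / F + 1) / 2 := by
      have : -1 ≤ C k b.1 / F := by rw [le_div_iff₀ hF]; linarith
      linarith
    have e2 : (C k b.1 / F + 1) / 2 ≤ 1 := by
      have : C k b.1 / F ≤ 1 := by rw [div_le_iff₀ hF]; linarith
      linarith
    have h5 := abs_greedySum_sub_le (u := (C k b.1 / F + 1) / 2) e1 e2 m
    rw [sub_self, abs_zero, zero_add, abs_sub_comm] at h5
    have h6 : C k b.1 - F * c b = 2 * F * ((C k b.1 / F + 1) / 2 -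
        greedySum ((C k b.1 / F + 1) / 2) m) := by
      simp only [hc]; field_simp; ring
    rw [h6, abs_mul, abs_of_pos (by positivity)]
    exact mul_le_mul_of_nonneg_left h5 (by positivity)
  -- Expanding the product of the digit sums backwards, the combination is the polynomial with
  -- rounded coefficients `F * c` at the rounded point `z`.
  have hsum : ∑ q : (multiIdx (Fin p) K × Option (Fin m)) × (Fin K → Option (Fin n)),
      F * gridWeight K n m q * ((if (q.1.2.elim True fun i =>
        greedyBit ((C k q.1.1 / F + 1) / 2) i = 1) then 1 else 0) *
        ∏ j, digit N n (monFactors K q.1.1 j) (q.2 j) x) =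
      ∑ b : multiIdx (Fin p) K, F * c b * ∏ i, z i ^ b.1 i := by
    rw [Fintype.sum_prod_type, Fintype.sum_prod_type]
    refine Finset.sum_congr rfl fun b _ => ?_
    rw [← prod_monFactors b z]
    have h6 : ∀ i : Option (Fin m), ∑ r : Fin K → Option (Fin n), F * gridWeight K n m ((b, i), r) *
        ((if (i.elim True fun i => greedyBit ((C k b.1 / F + 1) / 2) i = 1) then 1 else 0) *
        ∏ j, digit N n (monFactors K b j) (r j) x) =
        F * (coeffWeight m i *
        (if (i.elim True fun i => greedyBit ((C k b.1 / F + 1) / 2) i = 1) then 1 else 0)) *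
          ∏ j, (monFactors K b j).elim 1 z := by
      intro i
      have h7 := Finset.prod_univ_sum (fun _ : Fin K => (Finset.univ : Finset (Option (Fin n))))
        (fun j r => factorWeight (monFactors K b j) r * digit N n (monFactors K b j) r x)
      rw [Fintype.piFinset_univ] at h7
      rw [Finset.prod_congr rfl fun j _ => (sum_factorWeight_mul_digit (n := n)
        (monFactors K b j) x)] at h7
      change ∏ j, (monFactors K b j).elim 1 z = _ at h7
      rw [h7, Finset.mul_sum]
      refine Finset.sum_congr rfl fun r _ => ?_
      rw [Finset.prod_mul_distrib]
      simp only [gridWeight]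
      ring
    rw [Finset.sum_congr rfl fun i _ => h6 i, ← Finset.sum_mul, ← Finset.mul_sum]
    rw [sum_coeffWeight_mul m ((C k b.1 / F + 1) / 2) _ (by simp) (fun i => by
      rcases greedyBit_eq ((C k b.1 / F + 1) / 2) i with h | h <;> simp [h])]
  have hterm : ∀ b : multiIdx (Fin p) K,
      |C k b.1 * ∏ i, y i ^ b.1 i - F * c b * ∏ i, z i ^ b.1 i| ≤
        F * (K * ((1 / 2) ^ n * (1 / N)) + 2 * (1 / 2) ^ m) := by
    intro b
    have hzb0 : 0 ≤ ∏ i, z i ^ b.1 i := Finset.prod_nonneg fun i _ => pow_nonneg (hz0 i).1 _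
    have hzb1 : ∏ i, z i ^ b.1 i ≤ 1 := Finset.prod_le_one (fun i _ => pow_nonneg (hz0 i).1 _)
      fun i _ => pow_le_one₀ (hz0 i).1 (hz0 i).2
    have h8 : |C k b.1| * |∏ i, y i ^ b.1 i - ∏ i, z i ^ b.1 i| ≤
        F * (K * ((1 / 2) ^ n * (1 / N))) := by
      -- Rounding the point does not affect the constant term, and the other coefficients carry a
      -- factor `1 / N`.
      by_cases hb : b.1 = 0
      · simp only [hb, Pi.zero_apply, pow_zero, Finset.prod_const_one, sub_self, abs_zero, mul_zero]
        positivity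
      · have h9 := hC2 k b.1 b.2 hb
        have h10 : |∏ i, y i ^ b.1 i - ∏ i, z i ^ b.1 i| ≤ K * (1 / 2) ^ n := by
          rw [← prod_monFactors b y, ← prod_monFactors b z]
          have := abs_prod_sub_prod_le Finset.univ (fun j => (monFactors K b j).elim 1 y)
            (fun j => (monFactors K b j).elim 1 z)
            (fun j _ => by cases monFactors K b j <;> simp [hy0])
            (fun j _ => by cases monFactors K b j <;> simp [hz0]) (e := (1 / 2) ^ n)
            (fun j _ => by
              rcases monFactors K b j with _ | d
              · simp
              · exact hyz d)
          simpa using this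
        refine (mul_le_mul h9 h10 (abs_nonneg _) (by positivity)).trans (le_of_eq (by ring))
    have h11 : C k b.1 * ∏ i, y i ^ b.1 i - F * c b * ∏ i, z i ^ b.1 i =
        C k b.1 * (∏ i, y i ^ b.1 i - ∏ i, z i ^ b.1 i) +
          (C k b.1 - F * c b) * ∏ i, z i ^ b.1 i := by ring
    rw [h11]
    refine (abs_add_le _ _).trans ?_
    rw [abs_mul, abs_mul, abs_of_nonneg hzb0]
    have := mul_le_mul (hCu b) hzb1 hzb0 (by positivity)
    linarith
  refine le_trans (le_of_eq (congrArg (fun t => |f x - t|) hsum)) ?_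
  rw [← Finset.sum_coe_sort (multiIdx (Fin p) K) (fun b => C k b * ∏ i, y i ^ b i)] at h3
  refine (abs_sub_le _ _ _).trans ((add_le_add h3 ?_).trans (le_of_eq (?_ : _ + (multiIdx (Fin p) K).card *
    (F * (K * ((1 / 2) ^ n * (1 / N)) + 2 * (1 / 2) ^ m)) = _)))
  · rw [← Finset.sum_sub_distrib]
    refine (Finset.abs_sum_le_sum_abs _ _).trans ((Finset.sum_le_sum fun b _ => hterm b).trans ?_)
    simp
  · ring


/-! ### Volumes of exceptional sets and the distance in L² -/

theorem volume_unitCube (ι : Type) [Fintype ι] : volume (unitCube ι) = 1 := by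
  rw [unitCube, Real.volume_Icc_pi]
  simp

theorem measurableSet_unitCube (ι : Type) [Fintype ι] : MeasurableSet (unitCube ι) :=
  measurableSet_Icc

/-- By Fubini's theorem in the `k`-th coordinate, since each fibre lies in an interval of length `2
r`. Extending `h` by zero makes it measurable on the whole space. -/
theorem volume_slab_le {p : ℕ} (k : Fin (p + 1)) {h : (Fin p → ℝ) → ℝ}
    (hh : ContinuousOn h (unitCube (Fin p))) (r : ℝ) :
    volume {x | x ∈ unitCube (Fin (p + 1)) ∧ |x k - h (fun i => x (k.succAbove i))| < r} ≤
      ENNReal.ofReal (2 * r) := by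
  classical
  set H : (Fin p → ℝ) → ℝ := (unitCube (Fin p)).piecewise h 0
  have hH : Measurable H :=
    hh.measurable_piecewise continuous_zero.continuousOn (measurableSet_unitCube _)
  let S : Set (ℝ × (Fin p → ℝ)) := {q | q.2 ∈ unitCube (Fin p) ∧ |q.1 - H q.2| < r}
  have hS : MeasurableSet S := by
    refine (measurable_snd (measurableSet_unitCube _)).inter ?_
    exact measurableSet_lt ((measurable_fst.sub (hH.comp measurable_snd)).abs) measurable_const
  have hmp := volume_preserving_piFinSuccAbove (fun _ : Fin (p + 1) => ℝ) k
  have h1 : {x | x ∈ unitCube (Fin (p + 1)) ∧ |x k - h (fun i => x (k.succAbove i))| < r} ⊆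
      MeasurableEquiv.piFinSuccAbove (fun _ : Fin (p + 1) => ℝ) k ⁻¹' S := by
    rintro x ⟨hx, hr⟩
    have hy : (fun i => x (k.succAbove i)) ∈ unitCube (Fin p) :=
      ⟨fun i => hx.1 _, fun i => hx.2 _⟩
    refine ⟨hy, ?_⟩
    change |x k - H (fun i => x (k.succAbove i))| < r
    have h2 : H (fun i => x (k.succAbove i)) = h (fun i => x (k.succAbove i)) :=
      Set.piecewise_eq_of_mem _ _ _ hy
    rwa [h2]
  refine (measure_mono h1).trans ?_
  rw [hmp.measure_preimage hS.nullMeasurableSet]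
  change (volume.prod volume) S ≤ _
  rw [Measure.prod_apply_symm hS]
  have h2 : ∀ y : Fin p → ℝ, volume ((fun a : ℝ => (a, y)) ⁻¹' S) ≤
      (unitCube (Fin p)).indicator (fun _ => ENNReal.ofReal (2 * r)) y := by
    intro y
    by_cases hy : y ∈ unitCube (Fin p)
    · rw [Set.indicator_of_mem hy, ← Real.volume_ball (H y) r]
      refine measure_mono fun a ha => ?_
      rw [Metric.mem_ball, Real.dist_eq]
      exact ha.2
    · rw [Set.indicator_of_notMem hy]
      refine le_of_eq (measure_mono_null (t := ∅) (fun a ha => (hy ha.1).elim) measure_empty)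
  refine (lintegral_mono h2).trans ?_
  rw [lintegral_indicator_const (measurableSet_unitCube _), volume_unitCube, mul_one]

theorem volume_graph_eq_zero {p : ℕ} (k : Fin (p + 1)) {h : (Fin p → ℝ) → ℝ}
    (hh : ContinuousOn h (unitCube (Fin p))) :
    volume {x | x ∈ unitCube (Fin (p + 1)) ∧ x k = h (fun i => x (k.succAbove i))} = 0 := by
  refine le_antisymm (ge_of_tendsto (x := nhdsWithin (0 : ℝ) (Set.Ioi 0))
    (f := fun r => ENNReal.ofReal (2 * r)) ?_ ?_) bot_le
  · have h1 : Tendsto (fun r : ℝ => ENNReal.ofReal (2 * r)) (nhds 0) (nhds (ENNReal.ofReal (2 * 0))) :=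
      (ENNReal.continuous_ofReal.comp (continuous_const.mul continuous_id)).tendsto 0
    rw [mul_zero, ENNReal.ofReal_zero] at h1
    exact h1.mono_left nhdsWithin_le_nhds
  · filter_upwards [self_mem_nhdsWithin] with r hr
    refine (measure_mono ?_).trans (volume_slab_le k hh r)
    rintro x ⟨hx, hxh⟩
    exact ⟨hx, by rw [hxh, sub_self, abs_zero]; exact hr⟩

/-- Grid hyperplanes are graphs of constant functions. As `κ N ≤ 1`, only those with `0 ≤ j ≤ N`
come close to the cube. -/
theorem volume_nearGrid_le {p N : ℕ} (hN : 1 ≤ N) {κ : ℝ} (hκ : κ * N ≤ 1) :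
    volume {x | x ∈ unitCube (Fin (p + 1)) ∧ ∃ d, ∃ j : ℤ, |x d - j / N| < κ} ≤
      ENNReal.ofReal ((p + 1) * ((N + 1) * (2 * κ))) := by
  have hN0 : (0 : ℝ) < N := by exact_mod_cast hN
  have h1 : {x | x ∈ unitCube (Fin (p + 1)) ∧ ∃ d, ∃ j : ℤ, |x d - j / N| < κ} ⊆
      ⋃ d : Fin (p + 1), ⋃ j : Fin (N + 1), {x | x ∈ unitCube (Fin (p + 1)) ∧
        |x d - (fun _ => ((j : ℕ) : ℝ) / N) (fun i => x (d.succAbove i))| < κ} := by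
    rintro x ⟨hx, d, j, hj⟩
    have hx0 : 0 ≤ x d := hx.1 d
    have hx1 : x d ≤ 1 := hx.2 d
    have h2 : |N * x d - j| < 1 := by
      have : N * x d - j = N * (x d - j / N) := by field_simp
      rw [this, abs_mul, abs_of_pos hN0]
      nlinarith
    rw [abs_lt] at h2
    have h3 : (-1 : ℝ) < j := by nlinarith [mul_nonneg hN0.le hx0]
    have h4 : (j : ℝ) < N + 1 := by nlinarith
    have h5 : 0 ≤ j := by
      have : (-1 : ℤ) < j := by exact_mod_cast h3
      omega
    have h6 : j < N + 1 := by exact_mod_cast h4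
    lift j to ℕ using h5
    refine Set.mem_iUnion.2 ⟨d, Set.mem_iUnion.2 ⟨⟨j, by omega⟩, hx, ?_⟩⟩
    simpa using hj
  refine (measure_mono h1).trans ((measure_iUnion_fintype_le _ _).trans
    ((Finset.sum_le_sum fun d _ => (measure_iUnion_fintype_le _ _).trans
      (Finset.sum_le_sum fun j _ => volume_slab_le d continuousOn_const κ)).trans (le_of_eq ?_)))
  simp only [Finset.sum_const, Finset.card_univ, Fintype.card_fin, nsmul_eq_mul]
  rw [← ENNReal.ofReal_natCast, ← ENNReal.ofReal_natCast, ← ENNReal.ofReal_mul (by positivity),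
    ← ENNReal.ofReal_mul (by positivity)]
  push_cast
  rfl

/-- The difference is dominated by `tol` plus `b` times the indicator of a measurable hull of the
bad set; Minkowski's inequality is applied to the dominating functions, so `f`, `g` and `G` need not
be measurable. -/
theorem l2Dist_le {D : ℕ} {f g : (Fin D → ℝ) → ℝ} {G : Set (Fin D → ℝ)} {tol b w : ℝ}
    (htol : 0 ≤ tol) (hb : 0 ≤ b) (hG : ∀ x ∈ unitCube (Fin D), x ∈ G → |f x - g x| ≤ tol)
    (hae : ∀ᵐ x ∂volume.restrict (unitCube (Fin D)), |f x - g x| ≤ b)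
    (hw : volume (unitCube (Fin D) \ G) ≤ ENNReal.ofReal w) :
    l2Dist f g ≤ ENNReal.ofReal (tol + b * √w) := by
  let μ : Measure (Fin D → ℝ) := volume.restrict (unitCube (Fin D))
  let S : Set (Fin D → ℝ) := toMeasurable volume (unitCube (Fin D) \ G)
  let u : (Fin D → ℝ) → ℝ := fun _ => tol
  let v : (Fin D → ℝ) → ℝ := S.indicator fun _ => b
  have hSm : MeasurableSet S := measurableSet_toMeasurable _ _
  have hSv : μ S ≤ ENNReal.ofReal w :=
    (Measure.restrict_apply_le _ _).trans ((measure_toMeasurable _).le.trans hw)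
  have h1 : ∀ᵐ x ∂μ, ‖f x - g x‖ ≤ (u + v) x := by
    filter_upwards [hae, ae_restrict_mem (measurableSet_unitCube (Fin D))] with x hx hxc
    rw [Real.norm_eq_abs, Pi.add_apply]
    by_cases hxG : x ∈ G
    · have : 0 ≤ v x := Set.indicator_nonneg (fun _ _ => hb) x
      have h2 : u x = tol := rfl
      linarith [hG x hxc hxG]
    · have h4 : x ∈ unitCube (Fin D) \ G := ⟨hxc, hxG⟩
      have h2 : v x = b := Set.indicator_of_mem (subset_toMeasurable _ _ h4) _
      have h3 : u x = tol := rfl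
      linarith
  have h2 : μ Set.univ = 1 := by
    simp only [μ]
    rw [Measure.restrict_apply_univ, volume_unitCube]
  have h3 : eLpNorm u 2 μ = ENNReal.ofReal tol := by
    rw [eLpNorm_const' _ (by norm_num) (by norm_num), h2, ENNReal.one_rpow, mul_one,
      Real.enorm_of_nonneg htol]
  have h4 : eLpNorm v 2 μ ≤ ENNReal.ofReal (b * √w) := by
    rw [eLpNorm_indicator_const hSm (by norm_num) (by norm_num), ENNReal.ofReal_mul hb,
      Real.enorm_of_nonneg hb]
    refine mul_le_mul_right ?_ _
    rw [Real.sqrt_eq_rpow]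
    rcases le_or_gt 0 w with hw0 | hw0
    · rw [← ENNReal.ofReal_rpow_of_nonneg hw0 (by norm_num)]
      simp only [ENNReal.toReal_ofNat]
      exact ENNReal.rpow_le_rpow hSv (by norm_num)
    · rw [ENNReal.ofReal_of_nonpos hw0.le] at hSv
      rw [nonpos_iff_eq_zero.1 hSv]
      simp
  have h5 : eLpNorm (fun x => f x - g x) 2 μ ≤ eLpNorm (u + v) 2 μ := eLpNorm_mono_ae_real h1
  refine h5.trans ((eLpNorm_add_le aestronglyMeasurable_const
    (stronglyMeasurable_const.indicator hSm).aestronglyMeasurable (by norm_num)).trans ?_)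
  rw [ENNReal.ofReal_add htol (by positivity), h3]
  exact add_le_add_right h4 _


/-! ### The circuit for a piecewise smooth function -/

/-- The accuracy of the digital approximation on a grid. -/
def gridErr (p : ℕ) (β F : ℝ) (N n m : ℕ) : ℝ :=
  F * (p ^ (⌊β⌋₊ + 1) * (1 / N : ℝ) ^ β + (multiIdx (Fin p) ⌊β⌋₊).card *
    (⌊β⌋₊ * ((1 / 2) ^ n * (1 / N)) + 2 * (1 / 2) ^ m))

/-- The sides of the graphs on which a point lies. -/
def sides {p J : ℕ} (k : Fin J → Fin (p + 1)) (h : Fin J → (Fin p → ℝ) → ℝ)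
    (x : Fin (p + 1) → ℝ) (j : Fin J) : Bool :=
  decide (h j (fun i => x ((k j).succAbove i)) ≤ x (k j))

namespace Frame

theorem TC.cast {D : ℕ} {η : ℝ → ℝ} {Fr : Frame D η} {ι : Type} {β : ι → (Fin D → ℝ) → ℝ}
    {l l' s s' : ℕ} (h : Fr.TC β l s) (hl : l = l') (hs : s ≤ s') : Fr.TC β l' s' :=
  hl ▸ h.mono hs

section

variable {p : ℕ} {η : ℝ → ℝ} {Fr : Frame (p + 1) η}

/-- On the good set `|x_k - h_j|` exceeds the error of the digital approximation of `h_j` by `κ`, so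
comparing with the approximation decides the side with margin `κ`. Each side bit is produced with
its negation, so that the test for any sign vector is a conjunction. -/
theorem TC.literals [NeZero p] {α F : ℝ} (hα : 0 < α) (hF : 0 < F) {J : ℕ}
    (k : Fin J → Fin (p + 1)) {h : Fin J → (Fin p → ℝ) → ℝ}
    (hh : ∀ j, h j ∈ holderBall (Fin p) α F) (N n m : ℕ) [NeZero N]
    (hl : n + 2 * p + 6 ≤ Fr.depth) (hΦ : (N : ℝ) ^ 2 + N + 4 ≤ Fr.Φ)
    (hΦK : 2 * (⌊α⌋₊ : ℝ) + 3 ≤ Fr.Φ)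
    (hΦW : F * (3 * (multiIdx (Fin p) ⌊α⌋₊).card) + 1 ≤ Fr.Φ)
    (hG : ∀ x ∈ Fr.G, ∀ d, 0 < x d ∧ x d < 1)
    (hoff : ∀ x ∈ Fr.G, ∀ d, ∀ j : ℤ, Fr.κ ≤ |x d - j / (N * 2 ^ n)|)
    (hgr : ∀ x ∈ Fr.G, ∀ j, Fr.κ + gridErr p α F N n m ≤
      |x (k j) - h j (fun i => x ((k j).succAbove i))|) :
    Fr.TC (fun (q : Fin J × Bool) x => if sides k h x q.1 = q.2 then 1 else 0) (n + 2 * p + 6)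
      (Fr.Q * (2 * (p + 2) + (2 * p + 3 * n + 10) * (p + 2 + (p + 1) * (N + n + 3)) +
        (10 * p + 3) * (J * ((multiIdx (Fin p) ⌊α⌋₊).card * (m + 1)) * N ^ p) +
        J * ((multiIdx (Fin p) ⌊α⌋₊).card * (m + 1)) * (n + 1) ^ ⌊α⌋₊ * (⌊α⌋₊ + 6) + 4 * J)) := by
  classical
  set K := ⌊α⌋₊ with hK
  choose T hT using fun j => exists_gridApprox hα hF (hh j) N n m
  have h1 := (TC.init Fr).gridTerms N n K p (by omega) hΦ hΦK hG hoff
    (κ := Fin J × (multiIdx (Fin p) K × Option (Fin m))) (fun q => T q.1 q.2)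
    (fun q => (k q.1).succAbove) (fun q j => (monFactors K q.2.1 j).map (k q.1).succAbove)
  have h2 := h1.extend (by omega) (γ := Fin J × Bool)
    (A := Option ((multiIdx (Fin p) K × Option (Fin m)) × (Fin K → Option (Fin n))))
    (fun q a => a.elim (some (.inl (k q.1))) fun b => some (.inr (.inr ((q.1, b.1), b.2))))
    (fun q a => (if q.2 then 1 else -1) * a.elim 1 fun b => -(F * gridWeight K n m b))
    (fun q => by
      have e1 : ∀ a : Option ((multiIdx (Fin p) K × Option (Fin m)) × (Fin K → Option (Fin n))),
          |(if q.2 then (1 : ℝ) else -1) * a.elim 1 fun b => -(F * gridWeight K n m b)| =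
            a.elim 1 fun b => F * |gridWeight K n m b| := by
        intro a
        rw [abs_mul]
        have : |(if q.2 then (1 : ℝ) else -1)| = 1 := by split_ifs <;> simp
        rw [this, one_mul]
        cases a <;> simp [abs_mul, abs_of_pos hF]
      rw [Finset.sum_congr rfl fun a _ => e1 a, Fintype.sum_option]
      simp only [Option.elim_none, Option.elim_some, ← Finset.mul_sum]
      have := mul_le_mul_of_nonneg_left (sum_abs_gridWeight_le (ι := Fin p) K n m) hF.le
      linarith)
    (fun q x => if sides k h x q.1 = q.2 then 1 else 0)
    (fun x hx q => by
      rw [Fintype.sum_option]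
      have e1 := hT q.1 (fun i => x ((k q.1).succAbove i)) fun d => hG x hx _
      have e2 := hgr x hx q.1
      set a := h q.1 (fun i => x ((k q.1).succAbove i)) with ha
      simp only [Option.elim_none, Option.elim_some, idxVal, Sum.elim_inr, digit_map]
      have e3 : ∀ b : (multiIdx (Fin p) K × Option (Fin m)) × (Fin K → Option (Fin n)),
          (if q.2 then (1 : ℝ) else -1) * -(F * gridWeight K n m b) *
          ((if T q.1 b.1 (fun i => cellFin N (x ((k q.1).succAbove i))) then 1 else 0) *
            ∏ j, digit N n (monFactors K b.1.1 j) (b.2 j) fun i => x ((k q.1).succAbove i)) =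
          (if q.2 then (1 : ℝ) else -1) * -(F * gridWeight K n m b *
          ((if T q.1 b.1 (fun i => cellFin N (x ((k q.1).succAbove i))) then 1 else 0) *
            ∏ j, digit N n (monFactors K b.1.1 j) (b.2 j) fun i => x ((k q.1).succAbove i))) :=
        fun b => by ring
      rw [Finset.sum_congr rfl fun b _ => e3 b, ← Finset.mul_sum, Finset.sum_neg_distrib]
      set t := ∑ b : (multiIdx (Fin p) K × Option (Fin m)) × (Fin K → Option (Fin n)),
        F * gridWeight K n m b *
          ((if T q.1 b.1 (fun i => cellFin N (x ((k q.1).succAbove i))) then 1 else 0) *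
            ∏ j, digit N n (monFactors K b.1.1 j) (b.2 j) fun i => x ((k q.1).succAbove i)) with ht
      have e1' : |a - t| ≤ gridErr p α F N n m := e1
      rw [abs_le] at e1'
      have hs : sides k h x q.1 = decide (a ≤ x (k q.1)) := rfl
      have hκ := Fr.κ_pos
      rcases le_abs.1 e2 with e4 | e4
      · have e5 : a ≤ x (k q.1) := by linarith
        have : sides k h x q.1 = true := by rw [hs]; exact decide_eq_true e5
        rw [this]
        cases q.2
        · right
          constructor
          · simp only [Bool.false_eq_true, if_false]; linarith
          · simp
        · left
          constructor
          · simp only [if_true]; linarith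
          · simp
      · have e5 : ¬ a ≤ x (k q.1) := by linarith
        have : sides k h x q.1 = false := by rw [hs]; exact decide_eq_false e5
        rw [this]
        cases q.2
        · left
          constructor
          · simp only [Bool.false_eq_true, if_false]; linarith
          · simp
        · right
          constructor
          · simp only [if_true]; linarith
          · simp)
  refine ((h2.reindex (β' := fun (q : Fin J × Bool) x => if sides k h x q.1 = q.2 then 1 else 0)
    Sum.inr fun x _ q => rfl).cast (by omega) (le_of_eq ?_))
  simp only [Fintype.card_sum, Fintype.card_prod, Fintype.card_option, Fintype.card_fin,
    Fintype.card_coe, Fintype.card_empty, Fintype.card_bool, Fintype.card_pi, Finset.prod_const,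
    Finset.card_univ, zero_add]
  ring

open Classical in
-- Every sign vector has its own table. A conjunction with `J` literals kills all terms except those
-- of the sign vector of the input, so the sum of all terms is the polynomial of the right piece.
theorem TC.maskedTerms [NeZero p] {J : ℕ} {t : (Fin (p + 1) → ℝ) → Fin J → Bool} {l s : ℕ}
    (h : Fr.TC (fun (q : Fin J × Bool) x => if t x q.1 = q.2 then 1 else 0) l s) (N n m K : ℕ)
    [NeZero N] (hl : l + (n + 2 * p + 7) ≤ Fr.depth) (hΦ : (N : ℝ) ^ 2 + N + 4 ≤ Fr.Φ)
    (hΦK : 2 * (K : ℝ) + 3 ≤ Fr.Φ) (hΦJ : 2 * (J : ℝ) + 3 ≤ Fr.Φ)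
    (hG : ∀ x ∈ Fr.G, ∀ d, 0 < x d ∧ x d < 1)
    (hoff : ∀ x ∈ Fr.G, ∀ d, ∀ j : ℤ, Fr.κ ≤ |x d - j / (N * 2 ^ n)|)
    (T : (Fin J → Bool) → multiIdx (Fin (p + 1)) K × Option (Fin m) →
      (Fin (p + 1) → Fin N) → Prop) :
    Fr.TC (fun (q : ((Fin J → Bool) × (multiIdx (Fin (p + 1)) K × Option (Fin m))) ×
        (Fin K → Option (Fin n))) x => if t x = q.1.1 then
          (if T q.1.1 q.1.2 (fun i => cellFin N (x i)) then 1 else 0) *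
            ∏ j, digit N n (monFactors K q.1.2.1 j) (q.2 j) x else 0)
      (l + (n + 2 * p + 7))
      (s + Fr.Q * ((2 * p + 3 * n + 13) * (p + 2 + 2 * J + (p + 1) * (N + n + 3)) +
        (10 * p + 13) * (2 ^ J * ((multiIdx (Fin (p + 1)) K).card * (m + 1)) * N ^ (p + 1)) +
        2 ^ J * ((multiIdx (Fin (p + 1)) K).card * (m + 1)) * (n + 1) ^ K * (K + J + 7))) := by
  have h1 := h.gridTerms N n K (p + 1) (by omega) hΦ hΦK hG hoff
    (κ := (Fin J → Bool) × (multiIdx (Fin (p + 1)) K × Option (Fin m))) (fun q => T q.1 q.2)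
    (fun q => id) (fun q j => monFactors K q.2.1 j)
  have h2 := h1.and (by omega) (γ := ((Fin J → Bool) × (multiIdx (Fin (p + 1)) K ×
      Option (Fin m))) × (Fin K → Option (Fin n))) (A := Option (Fin J)) (by
      rw [Fintype.card_option, Fintype.card_fin]; push_cast; linarith)
    (fun q a => a.elim (some (.inr (.inr q))) fun j => some (.inr (.inl (j, q.1.1 j))))
    (fun x hx q a => by
      rcases a with _ | j
      · exact h1.1 x hx (.inr q)
      · exact h1.1 x hx (.inl (j, q.1.1 j)))
  refine ((h2.reindex Sum.inr fun x _ q => ?_).cast (by omega) ?_)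
  · change _ = ∏ a : Option (Fin J), idxVal _ _ x
    rw [Fintype.prod_option]
    simp only [Option.elim_none, Option.elim_some, idxVal, Sum.elim_inr, Sum.elim_inl, id]
    by_cases ht : t x = q.1.1
    · simp [ht]
    · rw [if_neg ht]
      obtain ⟨j, hj⟩ := Function.ne_iff.1 ht
      rw [Finset.prod_eq_zero (Finset.mem_univ j) (if_neg hj), mul_zero]
  · simp only [Fintype.card_sum, Fintype.card_prod, Fintype.card_option, Fintype.card_fin,
      Fintype.card_coe, Fintype.card_bool, Fintype.card_pi, Finset.prod_const, Finset.card_univ]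
    rw [add_assoc, ← mul_add]
    refine Nat.add_le_add_left (Nat.mul_le_mul_left _ ?_) s
    ring_nf
    omega

/-- Analog output: a linear combination of bits is digitized, and its digits are read off by a
bounded gadget. -/
theorem TC.analogOutput {D : ℕ} {Fr : Frame D η} {ι : Type} [Fintype ι]
    {β : ι → (Fin D → ℝ) → ℝ} {l s : ℕ} (h : Fr.TC β l s) {E n : ℕ} (hl : l + n ≤ Fr.depth)
    (w : ι → ℝ) (hw : ∀ i, ∃ j : ℤ, w i = j * (1 / 2) ^ E) (hΦ : ∑ i, |w i| + 3 ≤ Fr.Φ)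
    (hκ : Fr.κ ≤ (1 / 2) ^ (n + E + 2)) {F tol : ℝ} (hF : 0 < F) (hFP : F * Fr.P ≤ Fr.m * Fr.B)
    {v : (Fin D → ℝ) → ℝ} (hv : ∀ x ∈ Fr.G, |v x| ≤ F)
    (htol : ∀ x ∈ Fr.G, |v x - F * ∑ i, w i * β i x| ≤ tol)
    {a u b : Fin 4 → ℝ} (ha : ∀ r, |a r| ≤ Fr.P) (hu : ∀ r, |u r| ≤ Fr.P) (hb : ∀ r, |b r| ≤ Fr.P)
    {e : ℝ} (he : 0 ≤ e)
    (hrange : ∀ z, -e ≤ gadget η a u b z ∧ gadget η a u b z ≤ 1 + e)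
    (h1 : ∀ z, |z - 1| ≤ (l + n : ℕ) * Fr.δ → |gadget η a u b z - 1| ≤ e)
    (h0 : ∀ z, |z| ≤ (l + n : ℕ) * Fr.δ → |gadget η a u b z| ≤ e) :
    ∃ N : Net D 1, (∀ x, |N.eval η x 0| ≤ F) ∧
      (∀ x ∈ Fr.G, |N.eval η x 0 - v x| ≤ tol + 4 * F * e + 4 * F * (1 / 2) ^ n) ∧
      N.numLayers = l + n + 2 ∧
      N.numParams ≤ s + Fr.Q * (n * (D + 2 * Fintype.card ι + 2 * n + 4) + n + 1) ∧
      (N.maxParam : ℝ) ≤ Fr.B := by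
  -- The value in `[-F, F]` is mapped to `[0, 1]`. The shift by `2 ^ (-(n + E + 2))` keeps the
  -- result off the lattice of multiples of `2 ^ (-n)`, without any condition on the input.
  let U : (Fin D → ℝ) → ℝ := fun x => (1 / 2 + (1 / 2) ^ (n + E + 2)) + ∑ i, w i / 2 * β i x
  have hpos : (0 : ℝ) < (1 / 2) ^ (n + E + 2) := by positivity
  have hle : (1 / 2 : ℝ) ^ (n + E + 2) ≤ (1 / 2) ^ n :=
    pow_le_pow_of_le_one (by norm_num) (by norm_num) (by omega)
  have hle' : (1 / 2 : ℝ) ^ (n + E + 2) ≤ 1 / 2 :=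
    (pow_le_pow_of_le_one (by norm_num) (by norm_num) (by omega : 1 ≤ n + E + 2)).trans_eq (pow_one _)
  have h2 := h.digits n hl (γ := Unit) (A := Option ι) (fun _ a => a.map .inr)
    (fun _ a => a.elim (1 / 2 + (1 / 2) ^ (n + E + 2)) fun i => w i / 2) (fun _ => by
      rw [Fintype.sum_option]
      simp only [Option.elim_none, Option.elim_some, abs_div, abs_two]
      rw [← Finset.sum_div, abs_of_pos (by positivity)]
      have : 0 ≤ ∑ i, |w i| := Finset.sum_nonneg fun _ _ => abs_nonneg _
      linarith) (fun _ => U) (fun x _ _ => by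
      rw [Fintype.sum_option]
      simp [U, idxVal]) (fun x hx _ j => by
      refine hκ.trans ?_
      have hz : ∀ i, ∃ j : ℤ, w i * β i x = j * (1 / 2) ^ E := by
        intro i
        obtain ⟨j, hj⟩ := hw i
        rcases h.1 x hx i with h | h
        · exact ⟨0, by simp [h]⟩
        · exact ⟨j, by rw [h, mul_one, hj]⟩
      choose y hy using hz
      have e1 : U x - j * (1 / 2) ^ n = (1 / 2) ^ (n + E + 2) *
          ((2 ^ (n + E + 1) + 1 + 2 ^ (n + 1) * ∑ i, y i - j * 2 ^ (E + 2) : ℤ) : ℝ) := by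
        have e2 : ∑ i, w i / 2 * β i x = (∑ i, (y i : ℝ)) * (1 / 2) ^ E / 2 := by
          rw [Finset.sum_mul, Finset.sum_div]
          refine Finset.sum_congr rfl fun i _ => ?_
          rw [← hy]; ring
        simp only [U, e2]
        push_cast
        have q2 : ∀ k : ℕ, (1 / 2 : ℝ) ^ k * 2 ^ k = 1 := fun k => by rw [← mul_pow]; norm_num
        have e3 := q2 n
        have e4 := q2 E
        simp only [pow_add, one_div, inv_pow]
        field_simp
      rw [e1, abs_mul, abs_of_pos hpos]
      refine le_mul_of_one_le_right hpos.le ?_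
      -- The integer is odd, so it is not zero.
      have e5 : (2 ^ (n + E + 1) + 1 + 2 ^ (n + 1) * ∑ i, y i - j * 2 ^ (E + 2) : ℤ) ≠ 0 := by
        intro h0
        have : (2 ^ (n + E + 1) + 1 + 2 ^ (n + 1) * ∑ i, y i - j * 2 ^ (E + 2) : ℤ) =
          2 * (2 ^ (n + E) + 2 ^ n * ∑ i, y i - j * 2 ^ (E + 1)) + 1 := by ring
        omega
      exact_mod_cast Int.one_le_abs e5)
  have h3 := h2.reindex (β' := fun (i : Fin n) x => greedyBit (U x) i) (fun i => .inr ((), i))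
    fun x _ i => rfl
  -- The digits realized by the gadget lie in `[-e, 1 + e]`, so the value before scaling has
  -- absolute value at most `1 + 2 e`. Division by this number makes the bound `F` exact at all
  -- points.
  have hθ : 0 < 1 + 2 * e := by linarith
  have hF' : 0 < F / (1 + 2 * e) := by positivity
  have hF'' : F / (1 + 2 * e) ≤ F := div_le_self hF.le (by linarith)
  have hs0 : ∀ i : ℕ, (0 : ℝ) ≤ (1 / 2) ^ (i + 1) := fun i => by positivity
  obtain ⟨f, N, g1, g2, g3, g4, g5, g6⟩ := h3.output ha hu hb hrange h1 h0
    (fun i => F / (1 + 2 * e) * (2 * (1 / 2) ^ (i.val + 1))) (-(F / (1 + 2 * e))) (fun i => by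
      have : (1 / 2 : ℝ) ^ i.val ≤ 1 := pow_le_one₀ (by norm_num) (by norm_num)
      have h5 : (2 : ℝ) * (1 / 2) ^ (i.val + 1) ≤ 1 := by rw [pow_succ]; linarith
      rw [abs_of_nonneg (by positivity)]
      refine le_trans (mul_le_mul_of_nonneg_right ?_ Fr.P_nonneg) hFP
      exact (mul_le_of_le_one_right hF'.le h5).trans hF'') (by
      rw [abs_neg, abs_of_pos hF']
      exact (mul_le_mul_of_nonneg_right hF'' Fr.P_nonneg).trans hFP)
  have hev : ∀ x, N.eval η x 0 = F / (1 + 2 * e) *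
      (-1 + 2 * ∑ i : Fin n, (1 / 2) ^ (i.val + 1) * f i x) := by
    intro x
    rw [g3, mul_add, Finset.mul_sum, Finset.mul_sum]
    congr 1
    · ring
    · exact Finset.sum_congr rfl fun i _ => by ring
  have hsum1 : ∑ i : Fin n, (1 / 2 : ℝ) ^ (i.val + 1) ≤ 1 := by
    rw [sum_half_pow]
    have : (0 : ℝ) ≤ (1 / 2) ^ n := by positivity
    linarith
  have hsum0 : 0 ≤ ∑ i : Fin n, (1 / 2 : ℝ) ^ (i.val + 1) := Finset.sum_nonneg fun i _ => hs0 i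
  have habs : ∀ x, |-1 + 2 * ∑ i : Fin n, (1 / 2) ^ (i.val + 1) * f i x| ≤ 1 + 2 * e := by
    intro x
    have hlo : (∑ i : Fin n, (1 / 2 : ℝ) ^ (i.val + 1)) * (-e) ≤
        ∑ i : Fin n, (1 / 2) ^ (i.val + 1) * f i x := by
      rw [Finset.sum_mul]
      exact Finset.sum_le_sum fun i _ => mul_le_mul_of_nonneg_left (g1 x i).1 (hs0 i)
    have hhi : ∑ i : Fin n, (1 / 2) ^ (i.val + 1) * f i x ≤
        (∑ i : Fin n, (1 / 2 : ℝ) ^ (i.val + 1)) * (1 + e) := by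
      rw [Finset.sum_mul]
      exact Finset.sum_le_sum fun i _ => mul_le_mul_of_nonneg_left (g1 x i).2 (hs0 i)
    rw [abs_le]
    constructor <;> nlinarith
  refine ⟨N, fun x => ?_, fun x hx => ?_, g4, ?_, g6⟩
  · rw [hev, abs_mul, abs_of_pos hF']
    calc F / (1 + 2 * e) * _ ≤ F / (1 + 2 * e) * (1 + 2 * e) :=
          mul_le_mul_of_nonneg_left (habs x) hF'.le
      _ = F := by field_simp
  · set S := ∑ i : Fin n, (1 / 2) ^ (i.val + 1) * f i x with hS
    have e1 : |S - greedySum (U x) n| ≤ e := by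
      rw [greedySum_eq_sum, hS, ← Finset.sum_sub_distrib]
      refine (Finset.abs_sum_le_sum_abs _ _).trans ?_
      calc ∑ i : Fin n, |(1 / 2) ^ (i.val + 1) * f i x - (1 / 2) ^ (i.val + 1) * greedyBit (U x) i|
          ≤ ∑ i : Fin n, (1 / 2) ^ (i.val + 1) * e := Finset.sum_le_sum fun i _ => by
            rw [← mul_sub, abs_mul, abs_of_nonneg (hs0 _)]
            exact mul_le_mul_of_nonneg_left (g2 x hx i) (hs0 _)
        _ ≤ e := by rw [← Finset.sum_mul]; exact mul_le_of_le_one_left he hsum1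
    have hvx := abs_le.1 (hv x hx)
    set c := (v x / F + 1) / 2 with hc
    have hc0 : 0 ≤ c := by
      have : -1 ≤ v x / F := by rw [le_div_iff₀ hF]; linarith
      linarith
    have hc1 : c ≤ 1 := by
      have : v x / F ≤ 1 := by rw [div_le_iff₀ hF]; linarith
      linarith
    have e2 := abs_greedySum_sub_le (u := U x) hc0 hc1 n
    have e3 : |2 * F * (U x - c)| ≤ tol + 2 * F * (1 / 2) ^ (n + E + 2) := by
      have : 2 * F * (U x - c) = -(v x - F * ∑ i, w i * β i x) + 2 * F * (1 / 2) ^ (n + E + 2) := by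
        have e4 : ∑ i, w i / 2 * β i x = (∑ i, w i * β i x) / 2 := by
          rw [Finset.sum_div]; exact Finset.sum_congr rfl fun i _ => by ring
        simp only [U, hc, e4]
        field_simp
        ring
      rw [this]
      refine (abs_add_le _ _).trans ?_
      rw [abs_neg, abs_of_pos (by positivity : 0 < 2 * F * (1 / 2 : ℝ) ^ (n + E + 2))]
      linarith [htol x hx]
    rw [abs_mul, abs_of_pos (by positivity : 0 < 2 * F)] at e3
    -- Three errors: of the digits realized by the gadget, of the truncated binary expansion, and of
    -- the scaling by `1 / (1 + 2 e)`.
    have e5 : N.eval η x 0 - v x = 2 * F * (S - greedySum (U x) n) +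
        2 * F * (greedySum (U x) n - c) - F / (1 + 2 * e) * (2 * e) * (-1 + 2 * S) := by
      rw [hev x]
      simp only [hc]
      field_simp
      ring
    have e6 : |F / (1 + 2 * e) * (2 * e) * (-1 + 2 * S)| ≤ 2 * e * F := by
      rw [abs_mul, abs_of_nonneg (by positivity)]
      calc F / (1 + 2 * e) * (2 * e) * _ ≤ F / (1 + 2 * e) * (2 * e) * (1 + 2 * e) :=
            mul_le_mul_of_nonneg_left (habs x) (by positivity)
        _ = 2 * e * F := by field_simp
    have e7 : |2 * F * (S - greedySum (U x) n)| ≤ 2 * F * e := by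
      rw [abs_mul, abs_of_pos (by positivity)]
      exact mul_le_mul_of_nonneg_left e1 (by positivity)
    have e8 : |2 * F * (greedySum (U x) n - c)| ≤ tol + 4 * F * (1 / 2) ^ n := by
      rw [abs_mul, abs_of_pos (by positivity)]
      have := mul_le_mul_of_nonneg_left e2 (by positivity : 0 ≤ 2 * F)
      have := mul_le_mul_of_nonneg_left hle (by positivity : 0 ≤ 2 * F)
      linarith
    rw [e5]
    rw [abs_le] at *
    constructor <;> linarith [e6.1, e6.2, e7.1, e7.2, e8.1, e8.2]
  · refine g5.trans (le_of_eq ?_)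
    simp only [Fintype.card_option, Fintype.card_unit, Fintype.card_fin]
    ring
/-- Approximation of a piecewise smooth function on the good set of a frame. -/
theorem exists_net [NeZero p] (Fr : Frame (p + 1) η) {α β F : ℝ} (hα : 0 < α) (hβ : 0 < β)
    (hF : 0 < F) {J : ℕ} (k : Fin J → Fin (p + 1)) {h : Fin J → (Fin p → ℝ) → ℝ}
    (hh : ∀ j, h j ∈ holderBall (Fin p) α F) {f : (Fin J → Bool) → (Fin (p + 1) → ℝ) → ℝ}
    (hf : ∀ t, f t ∈ holderBall (Fin (p + 1)) β F) (N₁ n₁ m₁ N₂ n₂ m₂ n₃ : ℕ)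
    [NeZero N₁] [NeZero N₂] (hl : n₁ + n₂ + n₃ + 4 * p + 13 ≤ Fr.depth)
    (hΦN₁ : (N₁ : ℝ) ^ 2 + N₁ + 4 ≤ Fr.Φ) (hΦN₂ : (N₂ : ℝ) ^ 2 + N₂ + 4 ≤ Fr.Φ)
    (hΦα : 2 * (⌊α⌋₊ : ℝ) + 3 ≤ Fr.Φ) (hΦβ : 2 * (⌊β⌋₊ : ℝ) + 3 ≤ Fr.Φ)
    (hΦJ : 2 * (J : ℝ) + 3 ≤ Fr.Φ) (hΦα' : F * (3 * (multiIdx (Fin p) ⌊α⌋₊).card) + 1 ≤ Fr.Φ)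
    (hΦβ' : 2 ^ J * (3 * ((multiIdx (Fin (p + 1)) ⌊β⌋₊).card : ℝ)) + 3 ≤ Fr.Φ)
    (hκ : Fr.κ ≤ (1 / 2) ^ (n₃ + (m₁ + n₁ * ⌊β⌋₊) + 2)) (hFP : F * Fr.P ≤ Fr.m * Fr.B)
    (hG : ∀ x ∈ Fr.G, ∀ d, 0 < x d ∧ x d < 1)
    (hoff₁ : ∀ x ∈ Fr.G, ∀ d, ∀ j : ℤ, Fr.κ ≤ |x d - j / (N₁ * 2 ^ n₁)|)
    (hoff₂ : ∀ x ∈ Fr.G, ∀ d, ∀ j : ℤ, Fr.κ ≤ |x d - j / (N₂ * 2 ^ n₂)|)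
    (hgr : ∀ x ∈ Fr.G, ∀ j, Fr.κ + gridErr p α F N₂ n₂ m₂ ≤
      |x (k j) - h j (fun i => x ((k j).succAbove i))|)
    {a u b : Fin 4 → ℝ} (ha : ∀ r, |a r| ≤ Fr.P) (hu : ∀ r, |u r| ≤ Fr.P) (hb : ∀ r, |b r| ≤ Fr.P)
    {e : ℝ} (he : 0 ≤ e)
    (hrange : ∀ z, -e ≤ gadget η a u b z ∧ gadget η a u b z ≤ 1 + e)
    (h1 : ∀ z, |z - 1| ≤ Fr.depth * Fr.δ → |gadget η a u b z - 1| ≤ e)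
    (h0 : ∀ z, |z| ≤ Fr.depth * Fr.δ → |gadget η a u b z| ≤ e) :
    ∃ N : Net (p + 1) 1, (∀ x, |N.eval η x 0| ≤ F) ∧
      (∀ x ∈ Fr.G, |N.eval η x 0 - f (sides k h x) x| ≤
        gridErr (p + 1) β F N₁ n₁ m₁ + 4 * F * e + 4 * F * (1 / 2) ^ n₃) ∧
      N.numLayers = n₁ + n₂ + n₃ + 4 * p + 15 ∧
      N.numParams ≤ Fr.Q * ((2 * (p + 2) +
        (2 * p + 3 * n₂ + 10) * (p + 2 + (p + 1) * (N₂ + n₂ + 3)) +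
        (10 * p + 3) * (J * ((multiIdx (Fin p) ⌊α⌋₊).card * (m₂ + 1)) * N₂ ^ p) +
        J * ((multiIdx (Fin p) ⌊α⌋₊).card * (m₂ + 1)) * (n₂ + 1) ^ ⌊α⌋₊ * (⌊α⌋₊ + 6) + 4 * J) +
        ((2 * p + 3 * n₁ + 13) * (p + 2 + 2 * J + (p + 1) * (N₁ + n₁ + 3)) +
        (10 * p + 13) * (2 ^ J * ((multiIdx (Fin (p + 1)) ⌊β⌋₊).card * (m₁ + 1)) * N₁ ^ (p + 1)) +
        2 ^ J * ((multiIdx (Fin (p + 1)) ⌊β⌋₊).card * (m₁ + 1)) * (n₁ + 1) ^ ⌊β⌋₊ *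
          (⌊β⌋₊ + J + 7)) +
        (n₃ * (p + 1 + 2 * (2 ^ J * ((multiIdx (Fin (p + 1)) ⌊β⌋₊).card * (m₁ + 1)) *
          (n₁ + 1) ^ ⌊β⌋₊) + 2 * n₃ + 4) + n₃ + 1)) ∧
      (N.maxParam : ℝ) ≤ Fr.B := by
  classical
  have h2 := TC.literals hα hF k hh N₂ n₂ m₂ (by omega) hΦN₂ hΦα hΦα' hG hoff₂ hgr
  choose T hT using fun t => exists_gridApprox hβ hF (hf t) N₁ n₁ m₁
  have h3 := h2.maskedTerms N₁ n₁ m₁ ⌊β⌋₊ (by omega) hΦN₁ hΦβ hΦJ hG hoff₁ T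
  have hdep : ((n₂ + 2 * p + 6 + (n₁ + 2 * p + 7) + n₃ : ℕ) : ℝ) * Fr.δ ≤ Fr.depth * Fr.δ := by
    refine mul_le_mul_of_nonneg_right ?_ Fr.δ_nonneg
    exact_mod_cast (by omega)
  obtain ⟨N, g1, g2, g3, g4, g5⟩ := h3.analogOutput (E := m₁ + n₁ * ⌊β⌋₊) (n := n₃) (by omega)
    (fun q => gridWeight ⌊β⌋₊ n₁ m₁ (q.1.2, q.2)) (fun q => gridWeight_lattice _ _ _ _) (by
      rw [Fintype.sum_prod_type, Fintype.sum_prod_type]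
      have e1 := sum_abs_gridWeight_le (ι := Fin (p + 1)) ⌊β⌋₊ n₁ m₁
      rw [Fintype.sum_prod_type] at e1
      change (∑ _t : Fin J → Bool, ∑ y, ∑ r, |gridWeight ⌊β⌋₊ n₁ m₁ (y, r)|) + 3 ≤ _
      rw [Finset.sum_const, Finset.card_univ, nsmul_eq_mul]
      have e2 : ((Fintype.card (Fin J → Bool) : ℕ) : ℝ) = 2 ^ J := by simp
      rw [e2]
      have := mul_le_mul_of_nonneg_left e1 (by positivity : (0 : ℝ) ≤ 2 ^ J)
      linarith) hκ hF hFP (v := fun x => f (sides k h x) x) (tol := gridErr (p + 1) β F N₁ n₁ m₁)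
      (fun x hx => abs_le_of_mem_holderBall (hf _) ⟨fun i => (hG x hx i).1.le, fun i => (hG x hx i).2.le⟩)
      (fun x hx => by
        have e1 := hT (sides k h x) x (hG x hx)
        have e2 : F * ∑ q : ((Fin J → Bool) × (multiIdx (Fin (p + 1)) ⌊β⌋₊ × Option (Fin m₁))) ×
            (Fin ⌊β⌋₊ → Option (Fin n₁)), gridWeight ⌊β⌋₊ n₁ m₁ (q.1.2, q.2) *
            (if sides k h x = q.1.1 then
              (if T q.1.1 q.1.2 (fun i => cellFin N₁ (x i)) then 1 else 0) *
                ∏ j, digit N₁ n₁ (monFactors ⌊β⌋₊ q.1.2.1 j) (q.2 j) x else 0) =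
            ∑ q : (multiIdx (Fin (p + 1)) ⌊β⌋₊ × Option (Fin m₁)) × (Fin ⌊β⌋₊ → Option (Fin n₁)),
              F * gridWeight ⌊β⌋₊ n₁ m₁ q *
              ((if T (sides k h x) q.1 (fun i => cellFin N₁ (x i)) then 1 else 0) *
                ∏ j, digit N₁ n₁ (monFactors ⌊β⌋₊ q.1.1 j) (q.2 j) x) := by
          conv_rhs => rw [Fintype.sum_prod_type]
          rw [Fintype.sum_prod_type, Fintype.sum_prod_type, Finset.sum_eq_single (sides k h x),
            Finset.mul_sum]
          · refine Finset.sum_congr rfl fun c _ => ?_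
            rw [Finset.mul_sum]
            refine Finset.sum_congr rfl fun r _ => ?_
            simp only [if_true, mul_assoc]
          · intro t _ ht
            simp [ht.symm]
          · intro h; exact (h (Finset.mem_univ _)).elim
        rw [e2]
        exact e1) ha hu hb he hrange
      (fun z hz => h1 z (hz.trans hdep)) (fun z hz => h0 z (hz.trans hdep))
  refine ⟨N, g1, g2, by omega, g4.trans (le_of_eq ?_), g5⟩
  simp only [Fintype.card_prod, Fintype.card_option, Fintype.card_fin, Fintype.card_coe,
    Fintype.card_bool, Fintype.card_pi, Finset.prod_const, Finset.card_univ]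
  ring
end

end Frame


/-! ### The good set and the error of the network -/

/-- Off the graphs a point has exactly one sign vector, which belongs to exactly one block of the
partition. Indexing the smooth functions by sign vectors eliminates `M`. -/
theorem exists_sides_of_mem_piecewiseSmooth {p J M : ℕ} {α β F : ℝ} {f : (Fin (p + 1) → ℝ) → ℝ}
    (hf : f ∈ piecewiseSmooth (p + 1) J M α β F) :
    ∃ (k : Fin J → Fin (p + 1)) (h : Fin J → (Fin p → ℝ) → ℝ)
      (g : (Fin J → Bool) → (Fin (p + 1) → ℝ) → ℝ),
      (∀ j, h j ∈ holderBall (Fin p) α F) ∧ (∀ t, g t ∈ holderBall (Fin (p + 1)) β F) ∧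
      ∀ x ∈ unitCube (Fin (p + 1)), (∀ j, x (k j) ≠ h j (fun i => x ((k j).succAbove i))) →
        f x = g (sides k h x) x := by
  obtain ⟨k, h, T, fm, h1, h2, h3, h4, h5⟩ := hf
  have hm : ∀ t, ∃ m, t ∈ T m := fun t => Set.mem_iUnion.1 (h3 ▸ Set.mem_univ t)
  choose m hm using hm
  refine ⟨k, fun j y => h j (fun i => y ((finSuccAboveEquiv (k j)).symm i)), fun t => fm (m t),
    fun j => holderBall_comp_equiv (finSuccAboveEquiv (k j)) (h1 j), fun t => h4 _,
    fun x hx hne => ?_⟩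
  have e0 : ∀ j, (fun i => x ((k j).succAbove ((finSuccAboveEquiv (k j)).symm i))) =
      fun i : {i : Fin (p + 1) // i ≠ k j} => x i := by
    intro j
    funext i
    congr 1
    have := (finSuccAboveEquiv (k j)).apply_symm_apply i
    rw [finSuccAboveEquiv_apply] at this
    exact congrArg Subtype.val this
  simp only [e0] at hne
  set t := sides k (fun j y => h j (fun i => y ((finSuccAboveEquiv (k j)).symm i))) x with ht
  have ht' : ∀ j, t j = decide (h j (fun i => x i) ≤ x (k j)) := by
    intro j
    simp only [ht, sides, e0]
  have hside : ∀ s : Fin J → Bool, (∀ j, x ∈ graphSide (k j) (h j) (s j)) ↔ s = t := by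
    intro s
    constructor
    · intro hs
      funext j
      have h6 := (hs j).2
      rw [ht' j]
      cases hsj : s j
      · rw [hsj] at h6
        simp only [Bool.false_eq_true, if_false] at h6
        exact (decide_eq_false (not_le.2 (lt_of_le_of_ne h6 (hne j)))).symm
      · rw [hsj] at h6
        simp only [if_true] at h6
        exact (decide_eq_true h6).symm
    · rintro rfl j
      refine ⟨hx, ?_⟩
      rw [ht' j]
      by_cases h6 : h j (fun i => x i) ≤ x (k j)
      · simp [h6]
      · simp [h6, (not_le.1 h6).le]
  have hpiece : ∀ m', x ∈ piece k h (T m') ↔ t ∈ T m' := by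
    intro m'
    simp only [piece, Set.mem_iUnion, Set.mem_ofPred_eq, hside, hx, true_and]
    constructor
    · rintro ⟨s, hs, rfl⟩; exact hs
    · intro h; exact ⟨t, h, rfl⟩
  rw [h5, Finset.sum_eq_single (m t)]
  · rw [Set.indicator_of_mem ((hpiece _).2 (hm t))]
  · intro m' _ hne'
    refine Set.indicator_of_notMem (fun h6 => ?_) _
    exact Set.disjoint_left.1 (h2 hne') ((hpiece m').1 h6) (hm t)
  · intro h; exact (h (Finset.mem_univ _)).elim

/-- A single parameter `X` controls everything: margin `1 / X`, coefficient sums and depth at most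
`X`. -/
theorem exists_frame {D : ℕ} {η : ℝ → ℝ} {K : ℝ} (hη : HasGadgets η K) {G : Set (Fin D → ℝ)}
    (hG : G ⊆ unitCube (Fin D)) {X : ℝ} (hX : 2 ≤ X) {d m : ℕ} (hd : (d : ℝ) ≤ X) (hm : 1 ≤ m)
    {B : ℝ} (hKB : K ≤ B) (hB : 32 * K ^ 6 * X ^ 13 ≤ m * B) :
    ∃ Fr : Frame D η, Fr.G = G ∧ Fr.m = m ∧ Fr.B = B ∧ Fr.κ = 1 / X ∧ Fr.Φ = X ∧ Fr.depth = d ∧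
      X * Fr.P ≤ m * B ∧ ∃ a u b : Fin 4 → ℝ,
        (∀ r, |a r| ≤ Fr.P) ∧ (∀ r, |u r| ≤ Fr.P) ∧ (∀ r, |b r| ≤ Fr.P) ∧
        (∀ z, -(1 / X) ≤ gadget η a u b z ∧ gadget η a u b z ≤ 1 + 1 / X) ∧
        (∀ z, |z - 1| ≤ Fr.depth * Fr.δ → |gadget η a u b z - 1| ≤ 1 / X) ∧
        ∀ z, |z| ≤ Fr.depth * Fr.δ → |gadget η a u b z| ≤ 1 / X := by
  obtain ⟨hK, ⟨b₀, hb₀, hηb⟩, hid, hstep, hclip⟩ := hη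
  have hX1 : 1 ≤ X := by linarith
  have hX0 : 0 < X := by linarith
  have hK0 : 0 < K := by linarith
  -- With `δ = 1 / Y` the drift `depth * δ` is at most `1 / (K X ^ 2)`, the tolerance of the
  -- clipping gadget, and `Φ * depth * δ` is at most half of the margin. Then `P ^ 2 (X + 1)` is of
  -- order `K ^ 6 X ^ 13`.
  set Y : ℝ := 2 * K * X ^ 3 with hY
  have hX3 : 1 ≤ X ^ 3 := one_le_pow₀ hX1
  have hY1 : 1 ≤ Y := by
    have : 1 * 1 ≤ K * X ^ 3 := mul_le_mul hK hX3 (by norm_num) hK0.le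
    rw [hY]; linarith
  have hY0 : 0 < Y := by linarith
  set P : ℝ := K * Y ^ 2 with hP
  have hYP : K * Y ≤ P := by
    rw [hP]; exact mul_le_mul_of_nonneg_left (by nlinarith) hK0.le
  have hKP : K ≤ P := (le_mul_of_one_le_right hK0.le hY1).trans hYP
  have hXY : X ≤ Y := by
    have h1 : X ≤ X ^ 3 := le_self_pow₀ hX1 (by norm_num)
    have h2 : 1 * X ^ 3 ≤ K * X ^ 3 := mul_le_mul_of_nonneg_right hK (by positivity)
    rw [hY]; nlinarith
  have hXP : K * X ^ 2 ≤ P := by rw [hP]; gcongr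
  have hP0 : 0 ≤ P := by positivity
  have hPe : P = 4 * K ^ 3 * X ^ 6 := by rw [hP, hY]; ring
  have hPP : P * (X + 1) * P ≤ m * B := by
    refine le_trans ?_ hB
    have : P * (X + 1) * P = 16 * K ^ 6 * X ^ 12 * (X + 1) := by rw [hPe]; ring
    rw [this]
    calc 16 * K ^ 6 * X ^ 12 * (X + 1) ≤ 16 * K ^ 6 * X ^ 12 * (2 * X) := by gcongr; linarith
      _ = _ := by ring
  have hXP' : X * P ≤ m * B := by
    refine le_trans ?_ hPP
    have h1 : 1 ≤ P := hK.trans hKP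
    nlinarith [mul_nonneg hP0 hX0.le, mul_le_mul_of_nonneg_left h1 (mul_nonneg hP0 hX0.le)]
  have hηb0 : η b₀ ≠ 0 := by
    intro h; rw [h, abs_zero, mul_zero] at hηb; linarith
  obtain ⟨pS, uS, vS, s1, s2, s3, s4⟩ := hstep Y hY1
  obtain ⟨pI, uI, vI, i1, i2, i3, i4⟩ := hid Y hY1
  obtain ⟨pC, uC, vC, c1, c2, c3, c4⟩ := hclip X hX1
  have hinv : |(η b₀)⁻¹| ≤ K := by
    rw [abs_inv, inv_le_comm₀ (abs_pos.2 hηb0) hK0, inv_eq_one_div, div_le_iff₀ hK0]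
    linarith
  have hdδ : (d : ℝ) * (1 / Y) ≤ 1 / (K * X ^ 2) := by
    rw [mul_one_div, div_le_div_iff₀ hY0 (by positivity), hY]
    have : (d : ℝ) * (K * X ^ 2) ≤ X * (K * X ^ 2) := by gcongr
    nlinarith [show X * (K * X ^ 2) = K * X ^ 3 by ring, mul_pos hK0 (by positivity : 0 < X ^ 3)]
  have hstepκ : 1 / Y ≤ 1 / X / 2 := by
    rw [div_div]
    refine one_div_le_one_div_of_le (by positivity) ?_
    rw [hY]
    have h1 : X ≤ X ^ 3 := le_self_pow₀ hX1 (by norm_num)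
    have h2 : 1 * X ^ 3 ≤ K * X ^ 3 := mul_le_mul_of_nonneg_right hK (by positivity)
    linarith
  refine ⟨{ G := G, m := m, B := B, κ := 1 / X, Φ := X, δ := 1 / Y, P := P, depth := d,
            one_le_m := hm, B_nonneg := hK0.le.trans hKB, κ_pos := by positivity,
            κ_le := one_div_le_one_div_of_le (by norm_num) hX, δ_nonneg := by positivity,
            le_Φ := by linarith, P_nonneg := hP0, weights := hPP, small := ?_,
            cube := fun x hx i => ?_, one := ?_, ident := ?_, step := ?_ },
    rfl, rfl, rfl, rfl, rfl, rfl, hXP', pC, uC, vC, fun r => (c1 r).trans hXP,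
    fun r => (c2 r).trans hXP, fun r => (c3 r).trans hXP, fun z => ⟨(c4 z).1, (c4 z).2.1⟩,
    fun z hz => (c4 z).2.2.1 (hz.trans hdδ), fun z hz => (c4 z).2.2.2 (hz.trans hdδ)⟩
  · rw [mul_one_div, mul_div_assoc', div_div, div_le_div_iff₀ hY0 (by positivity), hY]
    have h1 : X * d * (X * 2) ≤ X * X * (X * 2) := by gcongr
    have h2 : 1 * X ^ 3 ≤ K * X ^ 3 := mul_le_mul_of_nonneg_right hK (by positivity)
    nlinarith
  · have := hG hx
    rw [abs_of_nonneg (this.1 i)]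
    exact this.2 i
  · refine ⟨fun r => if r = 0 then (η b₀)⁻¹ else 0, fun _ => b₀, fun r => ?_,
      fun r => hb₀.trans hKP, fun r => hb₀.trans hKB, fun z => ?_⟩
    · dsimp only
      split_ifs
      · exact hinv.trans hKP
      · simpa using hP0
    · simp [gadget, hηb0]
  · exact ⟨pI, uI, vI, fun r => (i1 r).trans hYP, fun r => (i2 r).trans hKP,
      fun r => (i3 r).trans hKP, fun r => (i2 r).trans hKB, fun r => (i3 r).trans hKB, i4⟩
  · exact ⟨pS, uS, vS, s1, s2, s3, fun z => ⟨fun hz => (s4 z).1 (hstepκ.trans hz),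
      fun hz => (s4 z).2 (by linarith)⟩⟩


/-- The points of the cube that keep the distance `κ` from the hyperplanes of both grids and the
distance `r` from the graphs. -/
def goodSet {p J : ℕ} (k : Fin J → Fin (p + 1)) (h : Fin J → (Fin p → ℝ) → ℝ) (N₁ N₂ : ℕ)
    (κ r : ℝ) : Set (Fin (p + 1) → ℝ) :=
  {x | x ∈ unitCube (Fin (p + 1)) ∧ (∀ d, ∀ j : ℤ, κ ≤ |x d - j / N₁|) ∧
    (∀ d, ∀ j : ℤ, κ ≤ |x d - j / N₂|) ∧
    ∀ j, r ≤ |x (k j) - h j (fun i => x ((k j).succAbove i))|}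

theorem volume_compl_goodSet_le {p J : ℕ} (k : Fin J → Fin (p + 1)) {h : Fin J → (Fin p → ℝ) → ℝ}
    (hh : ∀ j, ContinuousOn (h j) (unitCube (Fin p))) {N₁ N₂ : ℕ} (hN₁ : 1 ≤ N₁) (hN₂ : 1 ≤ N₂)
    {κ r : ℝ} (hκ₀ : 0 ≤ κ) (hr : 0 ≤ r) (hκ₁ : κ * N₁ ≤ 1) (hκ₂ : κ * N₂ ≤ 1) :
    volume (unitCube (Fin (p + 1)) \ goodSet k h N₁ N₂ κ r) ≤
      ENNReal.ofReal ((p + 1) * ((N₁ + 1) * (2 * κ)) + (p + 1) * ((N₂ + 1) * (2 * κ)) +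
        J * (2 * r)) := by
  have h1 : unitCube (Fin (p + 1)) \ goodSet k h N₁ N₂ κ r ⊆
      ({x | x ∈ unitCube (Fin (p + 1)) ∧ ∃ d, ∃ j : ℤ, |x d - j / N₁| < κ} ∪
       {x | x ∈ unitCube (Fin (p + 1)) ∧ ∃ d, ∃ j : ℤ, |x d - j / N₂| < κ}) ∪
      ⋃ j, {x | x ∈ unitCube (Fin (p + 1)) ∧
        |x (k j) - h j (fun i => x ((k j).succAbove i))| < r} := by
    rintro x ⟨hx, hxG⟩
    by_contra hcon
    simp only [Set.mem_union, Set.mem_iUnion, Set.mem_ofPred_eq, hx, true_and, not_or, not_exists,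
      not_lt] at hcon
    exact hxG ⟨hx, hcon.1.1, hcon.1.2, hcon.2⟩
  refine (measure_mono h1).trans ((measure_union_le _ _).trans ?_)
  rw [ENNReal.ofReal_add (by positivity) (by positivity),
    ENNReal.ofReal_add (by positivity) (by positivity)]
  refine add_le_add ((measure_union_le _ _).trans (add_le_add (volume_nearGrid_le hN₁ hκ₁)
    (volume_nearGrid_le hN₂ hκ₂))) ?_
  refine (measure_iUnion_fintype_le _ _).trans
    ((Finset.sum_le_sum fun j _ => volume_slab_le (k j) (hh j) r).trans (le_of_eq ?_))
  rw [Finset.sum_const, Finset.card_univ, Fintype.card_fin, nsmul_eq_mul,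
    ENNReal.ofReal_mul (Nat.cast_nonneg J), ENNReal.ofReal_natCast]

theorem mem_Ioo_of_mem_goodSet {p J : ℕ} {k : Fin J → Fin (p + 1)} {h : Fin J → (Fin p → ℝ) → ℝ}
    {N₁ N₂ : ℕ} (hN₁ : 1 ≤ N₁) {κ r : ℝ} (hκ : 0 < κ) {x : Fin (p + 1) → ℝ}
    (hx : x ∈ goodSet k h N₁ N₂ κ r) (d : Fin (p + 1)) : 0 < x d ∧ x d < 1 := by
  have h0 := hx.2.1 d 0
  have h1 := hx.2.1 d N₁
  have hN : (N₁ : ℝ) ≠ 0 := by positivity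
  rw [Int.cast_zero, zero_div, sub_zero] at h0
  rw [Int.cast_natCast, div_self hN] at h1
  have h2 : 0 ≤ x d := hx.1.1 d
  have h3 : x d ≤ 1 := hx.1.2 d
  constructor
  · refine lt_of_le_of_ne h2 fun h => ?_
    rw [← h, abs_zero] at h0
    linarith
  · refine lt_of_le_of_ne h3 fun h => ?_
    rw [h, sub_self, abs_zero] at h1
    linarith

/-- The number of parameters for the graphs, up to a constant factor. -/
def graphCost (p J b K N n m : ℕ) : ℕ :=
  2 * (p + 2) + (2 * p + 3 * n + 10) * (p + 2 + (p + 1) * (N + n + 3)) +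
    (10 * p + 3) * (J * (b * (m + 1)) * N ^ p) +
    J * (b * (m + 1)) * (n + 1) ^ K * (K + 6) + 4 * J

/-- The number of parameters for the smooth pieces, up to a constant factor. -/
def pieceCost (p J b K N n m n' : ℕ) : ℕ :=
  ((2 * p + 3 * n + 13) * (p + 2 + 2 * J + (p + 1) * (N + n + 3)) +
    (10 * p + 13) * (2 ^ J * (b * (m + 1)) * N ^ (p + 1)) +
    2 ^ J * (b * (m + 1)) * (n + 1) ^ K * (K + J + 7)) +
    (n' * (p + 1 + 2 * (2 ^ J * (b * (m + 1)) * (n + 1) ^ K) + 2 * n' + 4) + n' + 1)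

/-- Approximation of a piecewise smooth function by a network, for suitable parameters. -/
theorem exists_net_l2Dist_le {p : ℕ} [NeZero p] {η : ℝ → ℝ} {K₀ : ℝ} (hη : HasGadgets η K₀)
    {α β F : ℝ} (hα : 0 < α) (hβ : 0 < β) (hF : 0 < F) {J M : ℕ} {f : (Fin (p + 1) → ℝ) → ℝ}
    (hf : f ∈ piecewiseSmooth (p + 1) J M α β F) (N₁ n₁ m₁ N₂ n₂ m₂ n₃ : ℕ) [NeZero N₁] [NeZero N₂]
    {X : ℝ} (hX : 2 ≤ X) (hl : ((n₁ + n₂ + n₃ + 4 * p + 13 : ℕ) : ℝ) ≤ X)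
    (hΦN₁ : (N₁ : ℝ) ^ 2 + N₁ + 4 ≤ X) (hΦN₂ : (N₂ : ℝ) ^ 2 + N₂ + 4 ≤ X)
    (hΦα : 2 * (⌊α⌋₊ : ℝ) + 3 ≤ X) (hΦβ : 2 * (⌊β⌋₊ : ℝ) + 3 ≤ X)
    (hΦJ : 2 * (J : ℝ) + 3 ≤ X) (hΦα' : F * (3 * (multiIdx (Fin p) ⌊α⌋₊).card) + 1 ≤ X)
    (hΦβ' : 2 ^ J * (3 * ((multiIdx (Fin (p + 1)) ⌊β⌋₊).card : ℝ)) + 3 ≤ X)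
    (hκ : 2 ^ (n₃ + (m₁ + n₁ * ⌊β⌋₊) + 2) ≤ X) (hFX : F ≤ X)
    (hκ₁ : (N₁ : ℝ) * 2 ^ n₁ ≤ X) (hκ₂ : (N₂ : ℝ) * 2 ^ n₂ ≤ X)
    {m : ℕ} (hm : 1 ≤ m) {B : ℝ} (hKB : K₀ ≤ B) (hB : 32 * K₀ ^ 6 * X ^ 13 ≤ m * B) :
    ∃ N : Net (p + 1) 1, (∀ x, |N.eval η x 0| ≤ F) ∧
      N.numLayers = n₁ + n₂ + n₃ + 4 * p + 15 ∧
      N.numParams ≤ 48 * m ^ 2 * (graphCost p J (multiIdx (Fin p) ⌊α⌋₊).card ⌊α⌋₊ N₂ n₂ m₂ +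
        pieceCost p J (multiIdx (Fin (p + 1)) ⌊β⌋₊).card ⌊β⌋₊ N₁ n₁ m₁ n₃) ∧
      (N.maxParam : ℝ) ≤ B ∧
      l2Dist (fun x => N.eval η x 0) f ≤ ENNReal.ofReal
        (gridErr (p + 1) β F N₁ n₁ m₁ + 4 * F * (1 / X) + 4 * F * (1 / 2) ^ n₃ +
          2 * F * √(4 * (p + 1) * ((N₁ * 2 ^ n₁ + N₂ * 2 ^ n₂) * (1 / X)) +
            2 * J * (1 / X + gridErr p α F N₂ n₂ m₂))) := by
  obtain ⟨k, h, g, hh, hg, hfg⟩ := exists_sides_of_mem_piecewiseSmooth hf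
  have hX0 : 0 < X := by linarith
  have hN₁ : 1 ≤ N₁ := Nat.pos_of_ne_zero (NeZero.ne N₁)
  have hN₂ : 1 ≤ N₂ := Nat.pos_of_ne_zero (NeZero.ne N₂)
  have hM₁ : 1 ≤ N₁ * 2 ^ n₁ := Nat.mul_pos hN₁ (by positivity)
  have hM₂ : 1 ≤ N₂ * 2 ^ n₂ := Nat.mul_pos hN₂ (by positivity)
  have hE₀ : ∀ (p : ℕ) (β : ℝ) (N n m : ℕ), 0 ≤ gridErr p β F N n m := fun p β N n m => by
    unfold gridErr; positivity
  have hcont : ∀ j, ContinuousOn (h j) (unitCube (Fin p)) := fun j =>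
    continuousOn_of_mem_holderBall hα (hh j)
  -- The slabs around the graphs must contain the error of their approximation in addition to the
  -- margin.
  set r := 1 / X + gridErr p α F N₂ n₂ m₂ with hr
  have hr0 : 0 < r := add_pos_of_pos_of_nonneg (by positivity) (hE₀ _ _ _ _ _)
  set G := goodSet k h (N₁ * 2 ^ n₁) (N₂ * 2 ^ n₂) (1 / X) r with hGdef
  obtain ⟨Fr, q1, q2, q3, q4, q5, q6, q7, a, u, b, a1, a2, a3, a4, a5, a6⟩ :=
    exists_frame hη (G := G) (fun x hx => hx.1) hX hl hm hKB hB
  obtain ⟨N, g1, g2, g3, g4, g5⟩ := Frame.exists_net Fr hα hβ hF k hh hg N₁ n₁ m₁ N₂ n₂ m₂ n₃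
    q6.ge (by rwa [q5]) (by rwa [q5]) (by rwa [q5]) (by rwa [q5]) (by rwa [q5]) (by rwa [q5])
    (by rwa [q5]) (by
      rw [q4, one_div_pow]
      exact one_div_le_one_div_of_le (by positivity) hκ)
    (by
      rw [q2, q3]
      exact (mul_le_mul_of_nonneg_right hFX Fr.P_nonneg).trans q7)
    (fun x hx d => by
      rw [q1] at hx
      exact mem_Ioo_of_mem_goodSet hM₁ (by positivity) hx d)
    (fun x hx d j => by
      rw [q1] at hx
      rw [q4]
      simpa using hx.2.1 d j)
    (fun x hx d j => by
      rw [q1] at hx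
      rw [q4]
      simpa using hx.2.2.1 d j)
    (fun x hx j => by
      rw [q1] at hx
      rw [q4]
      exact hx.2.2.2 j) a1 a2 a3 (by positivity) a4 a5 a6
  refine ⟨N, g1, g3, ?_, q3 ▸ g5, ?_⟩
  · refine g4.trans (le_of_eq ?_)
    rw [Frame.Q, q2]
    simp only [graphCost, pieceCost]
    ring
  · refine (l2Dist_le (G := G) (b := 2 * F) (w := (p + 1) * (((N₁ * 2 ^ n₁ : ℕ) + 1) * (2 * (1 / X)))
      + (p + 1) * (((N₂ * 2 ^ n₂ : ℕ) + 1) * (2 * (1 / X))) + J * (2 * r))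
      (tol := gridErr (p + 1) β F N₁ n₁ m₁ + 4 * F * (1 / X) + 4 * F * (1 / 2) ^ n₃)
      (by have := hE₀ (p + 1) β N₁ n₁ m₁; positivity) (by positivity) (fun x hx hxG => ?_) ?_
      (volume_compl_goodSet_le k hcont hM₁ hM₂ (by positivity) hr0.le (by
        rw [one_div_mul_eq_div, div_le_one hX0]; push_cast; exact hκ₁) (by
        rw [one_div_mul_eq_div, div_le_one hX0]; push_cast; exact hκ₂))).trans ?_
    · have e1 : ∀ j, x (k j) ≠ h j (fun i => x ((k j).succAbove i)) := by
        intro j hj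
        have := hxG.2.2.2 j
        rw [hj, sub_self, abs_zero] at this
        linarith
      rw [hfg x hx e1]
      exact g2 x (by rw [q1]; exact hxG)
    · have hnull : ∀ᵐ x ∂volume.restrict (unitCube (Fin (p + 1))),
          ∀ j, x (k j) ≠ h j (fun i => x ((k j).succAbove i)) := by
        rw [ae_all_iff]
        intro j
        rw [ae_restrict_iff' (measurableSet_unitCube _)]
        refine measure_mono_null (fun x hx => ?_) (volume_graph_eq_zero (k j) (hcont j))
        have hx' : ¬(x ∈ unitCube (Fin (p + 1)) →
          x (k j) ≠ h j (fun i => x ((k j).succAbove i))) := hx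
        push Not at hx'
        exact hx'
      filter_upwards [hnull, ae_restrict_mem (measurableSet_unitCube _)] with x hx hxc
      rw [hfg x hxc hx]
      have e1 := abs_le.1 (g1 x)
      have e2 := abs_le.1 (abs_le_of_mem_holderBall (hg (sides k h x)) hxc)
      rw [abs_le]
      constructor <;> linarith
    · refine ENNReal.ofReal_le_ofReal ?_
      gcongr _ + 2 * F * √?_
      have e1 : (1 : ℝ) ≤ N₁ * 2 ^ n₁ := by exact_mod_cast hM₁
      have e2 : (1 : ℝ) ≤ N₂ * 2 ^ n₂ := by exact_mod_cast hM₂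
      have e3 : (0 : ℝ) ≤ (p + 1) * (1 / X) := by positivity
      push_cast
      nlinarith [mul_le_mul_of_nonneg_left e1 e3, mul_le_mul_of_nonneg_left e2 e3]


/-! ### Choice of the grids and counting of parameters -/

/-- Used to absorb the polynomial number of digit tuples into the exponential number of cells. -/
theorem exists_pow_le_mul_rpow (K : ℕ) {s : ℝ} (hs : 0 < s) :
    ∃ C : ℝ, 0 ≤ C ∧ ∀ n : ℕ, (n : ℝ) ^ K ≤ C * 2 ^ (n * s) := by
  have hr : (1 : ℝ) < 2 ^ s := Real.one_lt_rpow (by norm_num) hs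
  obtain ⟨C, hC⟩ := (tendsto_pow_const_div_const_pow_of_one_lt K hr).bddAbove_range
  have h1 : ∀ n : ℕ, (n : ℝ) ^ K ≤ C * 2 ^ (n * s) := by
    intro n
    have := hC ⟨n, rfl⟩
    rw [div_le_iff₀ (by positivity)] at this
    rwa [mul_comm (n : ℝ), Real.rpow_mul_natCast (by norm_num)]
  refine ⟨max C 0, le_max_right _ _, fun n => (h1 n).trans ?_⟩
  gcongr
  exact le_max_left _ _

theorem exists_mul_one_div_rpow_le (C : ℝ) {s κ : ℝ} (hs : 0 < s) (hκ : 0 < κ) :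
    ∀ᶠ A : ℕ in atTop, C * (1 / (A : ℝ)) ^ s ≤ κ := by
  have h1 : Tendsto (fun A : ℕ => C * (1 / (A : ℝ)) ^ s) atTop (nhds (C * 0)) := by
    refine Tendsto.const_mul C ?_
    have := (tendsto_rpow_neg_atTop hs).comp (tendsto_natCast_atTop_atTop (R := ℝ))
    refine this.congr fun n => ?_
    rw [Function.comp_apply, one_div, Real.inv_rpow (Nat.cast_nonneg n), Real.rpow_neg (Nat.cast_nonneg n)]
  rw [mul_zero] at h1
  exact (h1.eventually (gt_mem_nhds hκ)).mono fun _ h => h.le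

/-- A grid on which Hölder functions are approximated with the accuracy `κ * (1 / 2) ^ l`. -/
theorem exists_grid {p : ℕ} (hp : 1 ≤ p) {β F κ : ℝ} (hβ : 0 < β) (hF : 0 < F) (hκ : 0 < κ) :
    ∃ (a A : ℕ) (c : ℝ), 0 ≤ c ∧ ∀ l : ℕ, 1 ≤ l → ∃ N : ℕ, 1 ≤ N ∧
      gridErr p β F N l (l + a) ≤ κ * (1 / 2) ^ l ∧ (N : ℝ) ≤ c * 2 ^ (l * (p / β)) ∧
      (N : ℝ) ^ p ≤ c * 2 ^ (l * (p / β)) ∧ ((l : ℝ) + 1) ^ ⌊β⌋₊ ≤ c * 2 ^ (l * (p / β)) ∧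
      (N : ℝ) ≤ A * 2 ^ (⌈1 / β⌉₊ * l) := by
  set K := ⌊β⌋₊
  set b := (multiIdx (Fin p) K).card
  have hp0 : (0 : ℝ) < p := by exact_mod_cast hp
  have hκ3 : 0 < κ / 3 := by positivity
  -- The accuracy has three terms, each of which receives `κ / 3`: `A` handles the Taylor remainder
  -- and the rounded point, the `a` extra digits the rounded coefficients.
  obtain ⟨A, hA1, hA2, hA3⟩ := ((exists_mul_one_div_rpow_le (F * p ^ (K + 1)) hβ hκ3).and
    ((exists_mul_one_div_rpow_le (F * b * K) one_pos hκ3).and (eventually_ge_atTop 1))).exists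
  rw [Real.rpow_one] at hA2
  obtain ⟨a, ha⟩ : ∃ a : ℕ, F * b * 2 * (1 / 2 : ℝ) ^ a ≤ κ / 3 := by
    have h1 : Tendsto (fun a : ℕ => F * b * 2 * (1 / 2 : ℝ) ^ a) atTop (nhds (F * b * 2 * 0)) :=
      (tendsto_pow_atTop_nhds_zero_of_lt_one (by norm_num) (by norm_num)).const_mul _
    rw [mul_zero] at h1
    exact ((h1.eventually (gt_mem_nhds hκ3)).mono fun _ h => h.le).exists
  obtain ⟨C, hC0, hC⟩ := exists_pow_le_mul_rpow K (s := p / β) (by positivity)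
  have hA0 : (0 : ℝ) < A := by exact_mod_cast hA3
  have hA1' : (1 : ℝ) ≤ 2 * A := by
    have : (1 : ℝ) ≤ A := by exact_mod_cast hA3
    linarith
  refine ⟨a, 2 * A, (2 * A) ^ p + 2 ^ K * C, by positivity, fun l hl => ?_⟩
  have hl1 : (1 : ℝ) ≤ l := by exact_mod_cast hl
  -- With `N = A ⌈R₀⌉` the Taylor remainder is of order `N ^ (-β) ≤ A ^ (-β) 2 ^ (-l)`.
  set R₀ : ℝ := 2 ^ (l / β) with hR₀
  have hR₀1 : 1 ≤ R₀ := Real.one_le_rpow (by norm_num) (by positivity)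
  have hR₀p : R₀ ^ p = 2 ^ (l * (p / β)) := by
    rw [hR₀, ← Real.rpow_mul_natCast (by norm_num)]
    congr 1
    ring
  have hNlo : A * R₀ ≤ (A * ⌈R₀⌉₊ : ℕ) := by
    push_cast
    exact mul_le_mul_of_nonneg_left (Nat.le_ceil _) hA0.le
  have hNhi : ((A * ⌈R₀⌉₊ : ℕ) : ℝ) ≤ 2 * A * R₀ := by
    push_cast
    have := Nat.ceil_lt_add_one (zero_le_one.trans hR₀1)
    nlinarith
  have hN1 : 1 ≤ A * ⌈R₀⌉₊ := Nat.mul_pos hA3 (Nat.ceil_pos.2 (by linarith))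
  set N : ℕ := A * ⌈R₀⌉₊
  have hN0 : (0 : ℝ) < N := by exact_mod_cast hN1
  have hNp : (N : ℝ) ^ p ≤ (2 * A) ^ p * R₀ ^ p := by
    rw [← mul_pow]; gcongr
  have hR : 0 ≤ R₀ ^ p := by positivity
  have hCR : 0 ≤ 2 ^ K * C * R₀ ^ p := by positivity
  refine ⟨N, hN1, ?_, ?_, ?_, ?_, ?_⟩
  · have e1 : (1 / N : ℝ) ^ β ≤ (1 / A : ℝ) ^ β * (1 / 2) ^ l := by
      calc (1 / N : ℝ) ^ β ≤ (1 / (A * R₀)) ^ β := by gcongr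
        _ = (1 / A : ℝ) ^ β * (1 / R₀) ^ β := by
          rw [← Real.mul_rpow (by positivity) (by positivity)]; congr 1; field_simp
        _ = (1 / A : ℝ) ^ β * (1 / 2) ^ l := by
          congr 1
          rw [Real.div_rpow (by norm_num) (by positivity), Real.one_rpow, hR₀,
            ← Real.rpow_mul (by norm_num), div_mul_cancel₀ _ hβ.ne', Real.rpow_natCast, one_div_pow]
    have e2 : (1 / N : ℝ) ≤ 1 / A := by
      refine one_div_le_one_div_of_le hA0 (le_trans ?_ hNlo)
      exact le_mul_of_one_le_right hA0.le hR₀1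
    have hq : (0 : ℝ) ≤ (1 / 2) ^ l := by positivity
    calc gridErr p β F N l (l + a) = F * p ^ (K + 1) * (1 / N : ℝ) ^ β +
          (F * b * K * (1 / N)) * (1 / 2) ^ l + (F * b * 2 * (1 / 2) ^ a) * (1 / 2) ^ l := by
          simp only [gridErr, pow_add]; ring
      _ ≤ F * p ^ (K + 1) * ((1 / A : ℝ) ^ β * (1 / 2) ^ l) +
          (F * b * K * (1 / A)) * (1 / 2) ^ l + κ / 3 * (1 / 2) ^ l := by gcongr
      _ = (F * p ^ (K + 1) * (1 / A : ℝ) ^ β) * (1 / 2) ^ l +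
          (F * b * K * (1 / A)) * (1 / 2) ^ l + κ / 3 * (1 / 2) ^ l := by ring
      _ ≤ κ / 3 * (1 / 2) ^ l + κ / 3 * (1 / 2) ^ l + κ / 3 * (1 / 2) ^ l := by gcongr
      _ = _ := by ring
  · rw [← hR₀p, add_mul]
    have h1 : 2 * A * R₀ ≤ (2 * A) ^ p * R₀ ^ p :=
      mul_le_mul (le_self_pow₀ hA1' (by omega)) (le_self_pow₀ hR₀1 (by omega)) (by positivity)
        (by positivity)
    linarith
  · rw [← hR₀p, add_mul]
    linarith
  · rw [← hR₀p, add_mul]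
    have h1 : ((l : ℝ) + 1) ^ K ≤ (2 * l) ^ K := by gcongr; linarith
    have h2 := mul_le_mul_of_nonneg_left (hC l) (by positivity : (0 : ℝ) ≤ 2 ^ K)
    rw [mul_pow] at h1
    rw [← hR₀p] at h2
    have h3 : 0 ≤ (2 * (A : ℝ)) ^ p * R₀ ^ p := by positivity
    linarith
  · refine hNhi.trans ?_
    push_cast
    gcongr
    rw [hR₀, ← Real.rpow_natCast]
    refine Real.rpow_le_rpow_of_exponent_le (by norm_num) ?_
    push_cast
    rw [div_eq_mul_one_div, mul_comm]
    gcongr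
    exact Nat.le_ceil _

/-- Here `R` stands for the number of cells up to a constant. In each product `N`, `N ^ p` or the
number of digit tuples contributes a factor `R`, and the numbers of digits contribute at most two
factors `l`. -/
theorem exists_graphCost_le (p J b K a : ℕ) {c : ℝ} (hc : 0 ≤ c) :
    ∃ C : ℝ, 0 ≤ C ∧ ∀ (N n m l : ℕ) (R : ℝ), 1 ≤ l → 1 ≤ R → n ≤ 2 * l → m ≤ 2 * l + a →
      (N : ℝ) ≤ c * R → (N : ℝ) ^ p ≤ c * R → ((n : ℝ) + 1) ^ K ≤ c * R →
      (graphCost p J b K N n m : ℝ) ≤ C * (R * l ^ 2) := by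
  refine ⟨2 * (p + 2) + (2 * p + 16) * (p + 2 + (p + 1) * (c + 5)) +
    (10 * p + 3) * (J * (b * (a + 3)) * c) + J * (b * (a + 3)) * c * (K + 6) + 4 * J, by positivity,
    fun N n m l R hl hR hn hm hN hNp hnK => ?_⟩
  have hL : (1 : ℝ) ≤ l := by exact_mod_cast hl
  have hn' : (n : ℝ) ≤ 2 * l := by exact_mod_cast hn
  have hm' : (m : ℝ) + 1 ≤ (a + 3) * l := by
    have : (m : ℝ) ≤ 2 * l + a := by exact_mod_cast hm
    have h2 : (a : ℝ) * 1 ≤ a * l := by gcongr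
    linarith
  have hR0 : 0 ≤ R := by linarith
  have hRL : 1 ≤ R * l := by nlinarith
  have hLRL : (l : ℝ) ≤ R * l := le_mul_of_one_le_left (by linarith) hR
  have hRRL : R ≤ R * l := le_mul_of_one_le_right hR0 hL
  have hZ1 : R * l ≤ R * l ^ 2 := by rw [sq, ← mul_assoc]; exact le_mul_of_one_le_right (by linarith) hL
  have hZ : 1 ≤ R * (l : ℝ) ^ 2 := hRL.trans hZ1
  have t2 : (2 * p + 3 * n + 10 : ℝ) * (p + 2 + (p + 1) * (N + n + 3)) ≤
      (2 * p + 16) * (p + 2 + (p + 1) * (c + 5)) * (R * l ^ 2) := by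
    have e1 : (2 * p + 3 * n + 10 : ℝ) ≤ (2 * p + 16) * l := by
      have h2 : (p : ℝ) * 1 ≤ p * l := by gcongr
      linarith
    have e2 : (p + 2 + (p + 1) * (N + n + 3) : ℝ) ≤ (p + 2 + (p + 1) * (c + 5)) * (R * l) := by
      have e3 : (N + n + 3 : ℝ) ≤ (c + 5) * (R * l) := by
        have : c * R ≤ c * (R * l) := by gcongr
        linarith
      have e4 : (p + 1 : ℝ) * (N + n + 3) ≤ (p + 1) * ((c + 5) * (R * l)) := by gcongr
      have e5 : (p + 2 : ℝ) * 1 ≤ (p + 2) * (R * l) := by gcongr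
      linarith
    calc _ ≤ ((2 * p + 16) * (l : ℝ)) * ((p + 2 + (p + 1) * (c + 5)) * (R * l)) := by gcongr
      _ = _ := by ring
  have hRl2 : (l : ℝ) * R ≤ R * l ^ 2 := by linarith [mul_comm (l : ℝ) R]
  have t3 : (10 * p + 3 : ℝ) * (J * (b * (m + 1)) * N ^ p) ≤
      (10 * p + 3) * (J * (b * (a + 3)) * c) * (R * l ^ 2) := by
    calc _ ≤ (10 * p + 3 : ℝ) * (J * (b * ((a + 3) * l)) * (c * R)) := by gcongr
      _ = (10 * p + 3) * (J * (b * (a + 3)) * c) * (l * R) := by ring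
      _ ≤ _ := by gcongr
  have t4 : (J * (b * (m + 1)) * (n + 1) ^ K * (K + 6) : ℝ) ≤
      J * (b * (a + 3)) * c * (K + 6) * (R * l ^ 2) := by
    calc _ ≤ (J * (b * ((a + 3) * l)) * (c * R) * (K + 6) : ℝ) := by gcongr
      _ = J * (b * (a + 3)) * c * (K + 6) * (l * R) := by ring
      _ ≤ _ := by gcongr
  have t1 : (2 * (p + 2) : ℝ) ≤ 2 * (p + 2) * (R * l ^ 2) := le_mul_of_one_le_right (by positivity) hZ
  have t5 : (4 * J : ℝ) ≤ 4 * J * (R * l ^ 2) := le_mul_of_one_le_right (by positivity) hZ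
  simp only [graphCost]
  push_cast
  linarith

theorem exists_pieceCost_le (p J b K a : ℕ) {c : ℝ} (hc : 0 ≤ c) :
    ∃ C : ℝ, 0 ≤ C ∧ ∀ (N n m n' l : ℕ) (R : ℝ), 1 ≤ l → 1 ≤ R → n ≤ l → m ≤ l + a → n' ≤ l + a →
      (N : ℝ) ≤ c * R → (N : ℝ) ^ (p + 1) ≤ c * R → ((n : ℝ) + 1) ^ K ≤ c * R →
      (pieceCost p J b K N n m n' : ℝ) ≤ C * (R * l ^ 2) := by
  refine ⟨(2 * p + 16) * (p + 2 + 2 * J + (p + 1) * (c + 4)) +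
    (10 * p + 13) * (2 ^ J * (b * (a + 2)) * c) + 2 ^ J * (b * (a + 2)) * c * (K + J + 7) +
    (a + 1) * (p + 1 + 2 * (2 ^ J * (b * (a + 2)) * c) + 2 * (a + 1) + 4) + (a + 1) + 1, by positivity,
    fun N n m n' l R hl hR hn hm hk hN hNp hnK => ?_⟩
  have hL : (1 : ℝ) ≤ l := by exact_mod_cast hl
  have hn' : (n : ℝ) ≤ l := by exact_mod_cast hn
  have haL : (a : ℝ) * 1 ≤ a * l := by gcongr
  have hm' : (m : ℝ) + 1 ≤ (a + 2) * l := by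
    have : (m : ℝ) ≤ l + a := by exact_mod_cast hm
    linarith
  have hk' : (n' : ℝ) ≤ (a + 1) * l := by
    have : (n' : ℝ) ≤ l + a := by exact_mod_cast hk
    linarith
  have hR0 : 0 ≤ R := by linarith
  have hRL : 1 ≤ R * l := by nlinarith
  have hLRL : (l : ℝ) ≤ R * l := le_mul_of_one_le_left (by linarith) hR
  have hRRL : R ≤ R * l := le_mul_of_one_le_right hR0 hL
  have hZ1 : R * l ≤ R * l ^ 2 := by rw [sq, ← mul_assoc]; exact le_mul_of_one_le_right (by linarith) hL
  have hZ : 1 ≤ R * (l : ℝ) ^ 2 := hRL.trans hZ1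
  have t2 : (2 * p + 3 * n + 13 : ℝ) * (p + 2 + 2 * J + (p + 1) * (N + n + 3)) ≤
      (2 * p + 16) * (p + 2 + 2 * J + (p + 1) * (c + 4)) * (R * l ^ 2) := by
    have e1 : (2 * p + 3 * n + 13 : ℝ) ≤ (2 * p + 16) * l := by
      have h2 : (p : ℝ) * 1 ≤ p * l := by gcongr
      linarith
    have e2 : (p + 2 + 2 * J + (p + 1) * (N + n + 3) : ℝ) ≤
        (p + 2 + 2 * J + (p + 1) * (c + 4)) * (R * l) := by
      have e3 : (N + n + 3 : ℝ) ≤ (c + 4) * (R * l) := by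
        have : c * R ≤ c * (R * l) := by gcongr
        linarith
      have e4 : (p + 1 : ℝ) * (N + n + 3) ≤ (p + 1) * ((c + 4) * (R * l)) := by gcongr
      have e5 : (p + 2 + 2 * J : ℝ) * 1 ≤ (p + 2 + 2 * J) * (R * l) := by gcongr
      linarith
    calc _ ≤ ((2 * p + 16) * (l : ℝ)) * ((p + 2 + 2 * J + (p + 1) * (c + 4)) * (R * l)) := by gcongr
      _ = _ := by ring
  have hRl2 : (l : ℝ) * R ≤ R * l ^ 2 := by linarith [mul_comm (l : ℝ) R]
  have t3 : (10 * p + 13 : ℝ) * (2 ^ J * (b * (m + 1)) * N ^ (p + 1)) ≤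
      (10 * p + 13) * (2 ^ J * (b * (a + 2)) * c) * (R * l ^ 2) := by
    calc _ ≤ (10 * p + 13 : ℝ) * (2 ^ J * (b * ((a + 2) * l)) * (c * R)) := by gcongr
      _ = (10 * p + 13) * (2 ^ J * (b * (a + 2)) * c) * (l * R) := by ring
      _ ≤ _ := by gcongr
  have t0 : (2 ^ J * (b * (m + 1)) * (n + 1) ^ K : ℝ) ≤ 2 ^ J * (b * (a + 2)) * c * (R * l) := by
    calc _ ≤ (2 ^ J * (b * ((a + 2) * l)) * (c * R) : ℝ) := by gcongr
      _ = _ := by ring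
  have t4 : (2 ^ J * (b * (m + 1)) * (n + 1) ^ K * (K + J + 7) : ℝ) ≤
      2 ^ J * (b * (a + 2)) * c * (K + J + 7) * (R * l ^ 2) := by
    calc _ ≤ (2 ^ J * (b * (a + 2)) * c * (R * l) * (K + J + 7) : ℝ) := by gcongr
      _ = 2 ^ J * (b * (a + 2)) * c * (K + J + 7) * (R * l) := by ring
      _ ≤ _ := by gcongr
  have t5 : (n' * (p + 1 + 2 * (2 ^ J * (b * (m + 1)) * (n + 1) ^ K) + 2 * n' + 4) : ℝ) ≤
      (a + 1) * (p + 1 + 2 * (2 ^ J * (b * (a + 2)) * c) + 2 * (a + 1) + 4) * (R * l ^ 2) := by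
    have e1 : (p + 1 + 2 * (2 ^ J * (b * (m + 1)) * (n + 1) ^ K) + 2 * n' + 4 : ℝ) ≤
        (p + 1 + 2 * (2 ^ J * (b * (a + 2)) * c) + 2 * (a + 1) + 4) * (R * l) := by
      have e5 : (p + 1 + 4 : ℝ) * 1 ≤ (p + 1 + 4) * (R * l) := by gcongr
      have e6 : (a + 1 : ℝ) * l ≤ (a + 1) * (R * l) := by gcongr
      linarith
    calc _ ≤ ((a + 1) * (l : ℝ)) *
          ((p + 1 + 2 * (2 ^ J * (b * (a + 2)) * c) + 2 * (a + 1) + 4) * (R * l)) := by gcongr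
      _ = _ := by ring
  have t6 : (n' : ℝ) ≤ (a + 1) * (R * l ^ 2) := hk'.trans (by gcongr; linarith)
  simp only [pieceCost]
  push_cast
  linarith


/-! ### The theorem for dyadic accuracies -/

theorem exists_upper_bound (L : List ℝ) : ∃ S, ∀ k ∈ L, k ≤ S := by
  induction L with
  | nil => exact ⟨0, by simp⟩
  | cons a L ih =>
    obtain ⟨S, hS⟩ := ih
    refine ⟨max a S, fun k hk => ?_⟩
    rcases List.mem_cons.1 hk with rfl | hk
    · exact le_max_left _ _
    · exact (hS k hk).trans (le_max_right _ _)

set_option maxHeartbeats 1000000 in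
/-- The approximation theorem for dyadic accuracies. -/
theorem exists_approx {α β : ℝ} (hα : 0 < α) (hβ : 0 < β) : ∃ c : ℕ, ∀ (p : ℕ) [NeZero p] (F : ℝ),
    0 < F → ∃ CL : ℕ, ∀ J : ℕ, ∃ CS : ℝ, 0 < CS ∧ ∀ (η : ℝ → ℝ) (K₀ : ℝ), HasGadgets η K₀ →
      ∀ (M : ℕ), ∀ f ∈ piecewiseSmooth (p + 1) J M α β F, ∀ l₁ l₂ : ℕ, 1 ≤ l₁ → 1 ≤ l₂ → ∀ B : ℝ,
        K₀ ≤ B → K₀ ^ 6 * 2 ^ (c * (l₁ + l₂)) ≤ 4 ^ c * B →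
        ∃ N : Net (p + 1) 1, (∀ x, |N.eval η x 0| ≤ F) ∧ N.numLayers ≤ CL * (l₁ + l₂) ∧
          (N.numParams : ℝ) ≤ CS * (2 ^ (l₁ * ((p + 1) / β)) * l₁ ^ 2 +
            2 ^ (l₂ * (2 * p / α)) * l₂ ^ 2) ∧ (N.maxParam : ℝ) ≤ B ∧
          l2Dist (fun x => N.eval η x 0) f ≤ ENNReal.ofReal ((1 / 2) ^ l₁ + (1 / 2) ^ l₂) := by
  set K₁ := ⌊β⌋₊ with hK₁
  set K₂ := ⌊α⌋₊ with hK₂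
  -- All requirements on `X` must be met by a constant times `2 ^ (c₁ (l₁ + l₂))`: `N₁ ^ 2` and `N₂
  -- ^ 2` give `2 ⌈1 / β⌉` and `4 ⌈1 / α⌉`, the output lattice gives `K₁ + 2`. The weights involve
  -- `X ^ 13`, whence the exponent `13 c₁`.
  obtain ⟨c₁, hc₁⟩ : ∃ c, c = 2 * ⌈1 / β⌉₊ + 4 * ⌈1 / α⌉₊ + K₁ + 6 := ⟨_, rfl⟩
  refine ⟨13 * c₁, fun p _ F hF => ?_⟩
  have hp : 1 ≤ p := Nat.pos_of_ne_zero (NeZero.ne p)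
  obtain ⟨a₃, ha₃⟩ : ∃ a : ℕ, 4 * F * (1 / 2 : ℝ) ^ a ≤ 1 / 8 := by
    have h1 : Tendsto (fun a : ℕ => 4 * F * (1 / 2 : ℝ) ^ a) atTop (nhds (4 * F * 0)) :=
      (tendsto_pow_atTop_nhds_zero_of_lt_one (by norm_num) (by norm_num)).const_mul _
    rw [mul_zero] at h1
    exact ((h1.eventually (gt_mem_nhds (by norm_num : (0 : ℝ) < 1 / 8))).mono fun _ h => h.le).exists
  -- The depth depends on `J` nowhere: table digits and sign vectors are processed in parallel, and
  -- `a₃` is determined by `F`.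
  refine ⟨a₃ + 4 * p + 17, fun J => ?_⟩
  obtain ⟨a₁, A₁, d₁, hd₁, hgrid₁⟩ := exists_grid (p := p + 1) (by omega) hβ hF
    (by norm_num : (0 : ℝ) < 1 / 8)
  obtain ⟨a₂, A₂, d₂, hd₂, hgrid₂⟩ := exists_grid (p := p) hp hα hF
    (by positivity : 0 < 1 / (32 * F ^ 2 * (J + 1)))
  set b₁ := (multiIdx (Fin (p + 1)) K₁).card with hb₁
  set b₂ := (multiIdx (Fin p) K₂).card with hb₂
  obtain ⟨Cg, hCg, hgc⟩ := exists_graphCost_le p J b₂ K₂ a₂ hd₂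
  obtain ⟨Cp, hCp, hpc⟩ := exists_pieceCost_le p J b₁ K₁ (a₁ + a₃) hd₁
  -- All constant factors in the requirements on `X`, which will be `S * 2 ^ (c₁ (l₁ + l₂))`.
  obtain ⟨S, hS⟩ := exists_upper_bound [2, 2 + a₃ + 4 * p + 13, 6 * ((A₁ : ℝ) + 1) ^ 2,
    6 * ((A₂ : ℝ) + 1) ^ 2, 2 * (K₂ : ℝ) + 3, 2 * (K₁ : ℝ) + 3, 2 * (J : ℝ) + 3,
    F * (3 * b₂) + 1, 2 ^ J * (3 * (b₁ : ℝ)) + 3, 2 ^ (a₃ + a₁ + 2), F, A₁, A₂,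
    64 * F ^ 2 * (p + 1) * (A₁ + A₂), 32 * F ^ 2 * J, 32 * F]
  simp only [List.mem_cons, List.not_mem_nil, or_false, forall_eq_or_imp, forall_eq] at hS
  obtain ⟨hS2, s1, s2, s3, s4, s5, s6, s7, s8, s9, s10, s11, s12, s13, s14, s15⟩ := hS
  -- The number of copies absorbs the constants depending on `p`, `F` and `J`, so that only `K₀ ^ 6`
  -- and the power of two constrain `B`.
  obtain ⟨m, hm⟩ := exists_nat_ge (32 * S ^ 13 * 4 ^ (13 * c₁))
  have hm1 : 1 ≤ m := by
    have h1 : (1 : ℝ) ≤ S ^ 13 := one_le_pow₀ (by linarith)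
    have h2 : (1 : ℝ) ≤ 4 ^ (13 * c₁) := one_le_pow₀ (by norm_num)
    have h3 : (1 : ℝ) * 1 ≤ S ^ 13 * 4 ^ (13 * c₁) := mul_le_mul h1 h2 (by norm_num) (by positivity)
    have : (1 : ℝ) ≤ m := by linarith
    exact_mod_cast this
  refine ⟨48 * m ^ 2 * (Cg * 4 + Cp + 1), by positivity, fun η K₀ hη M f hf l₁ l₂ hl₁ hl₂ B hKB hB => ?_⟩
  obtain ⟨N₁, hN₁, e1, e2, e3, e4, e5⟩ := hgrid₁ l₁ hl₁
  -- Twice as many binary places for the graphs, because their error is the volume of a slab and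
  -- enters the distance under a square root.
  obtain ⟨N₂, hN₂, i1, i2, i3, i4, i5⟩ := hgrid₂ (2 * l₂) (by omega)
  have : NeZero N₁ := ⟨by omega⟩
  have : NeZero N₂ := ⟨by omega⟩
  obtain ⟨X, hX⟩ : ∃ X : ℝ, X = S * 2 ^ (c₁ * (l₁ + l₂)) := ⟨_, rfl⟩
  have hcl : ∀ c' l' : ℕ, c' ≤ c₁ → l' ≤ l₁ + l₂ → c' * l' ≤ c₁ * (l₁ + l₂) :=
    fun _ _ h h' => Nat.mul_le_mul h h'
  have hXle : ∀ (k : ℝ) (e : ℕ), k ≤ S → e ≤ c₁ * (l₁ + l₂) → k * 2 ^ e ≤ X := by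
    intro k e hk he
    have hp2 : (2 : ℝ) ^ e ≤ 2 ^ (c₁ * (l₁ + l₂)) := pow_le_pow_right₀ (by norm_num) he
    rw [hX]
    exact mul_le_mul hk hp2 (by positivity) (by linarith)
  have hXc : ∀ k : ℝ, k ≤ S → k ≤ X := fun k hk => by simpa using hXle k 0 hk (by omega)
  have hX0 : 0 < X := by linarith [hXc 2 hS2]
  have hone : ∀ e : ℕ, (1 : ℝ) ≤ 2 ^ e := fun e => one_le_pow₀ (by norm_num)
  have hl : ((l₁ + 2 * l₂ + (l₁ + a₃) + 4 * p + 13 : ℕ) : ℝ) ≤ X := by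
    refine le_trans ?_ (hXle (2 + a₃ + 4 * p + 13) (l₁ + l₂) s1
      (by simpa using hcl 1 (l₁ + l₂) (by omega) le_rfl))
    · have h1 : ((l₁ + l₂ : ℕ) : ℝ) ≤ 2 ^ (l₁ + l₂) := by
        exact_mod_cast (Nat.lt_two_pow_self).le
      have h2 := mul_le_mul_of_nonneg_left (hone (l₁ + l₂)) (by positivity : (0 : ℝ) ≤ a₃ + 4 * p + 13)
      push_cast at h1 ⊢
      linarith
  have hsq : ∀ (A N q : ℕ), (N : ℝ) ≤ A * 2 ^ q → 6 * ((A : ℝ) + 1) ^ 2 ≤ S →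
      2 * q ≤ c₁ * (l₁ + l₂) → (N : ℝ) ^ 2 + N + 4 ≤ X := by
    intro A N q hN hA hq
    refine le_trans ?_ (hXle _ _ hA hq)
    set y : ℝ := (A + 1) * 2 ^ q
    have h1 : (N : ℝ) ≤ y := hN.trans (mul_le_mul_of_nonneg_right (by linarith) (by positivity))
    have h2 : 1 ≤ y := by
      have : (1 : ℝ) * 1 ≤ (A + 1) * 2 ^ q := mul_le_mul (by linarith [Nat.cast_nonneg (α := ℝ) A])
        (hone q) (by norm_num) (by positivity)
      linarith
    have h3 : 6 * ((A : ℝ) + 1) ^ 2 * 2 ^ (2 * q) = 6 * y ^ 2 := by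
      simp only [y]; rw [mul_pow, ← pow_mul, mul_comm q 2]; ring
    rw [h3]
    have h4 : (N : ℝ) ^ 2 ≤ y ^ 2 := by gcongr
    have h5 : y ≤ y ^ 2 := le_self_pow₀ h2 (by norm_num)
    linarith
  have hE₁ : ⌈1 / β⌉₊ * l₁ + l₁ + 2 * l₂ ≤ c₁ * (l₁ + l₂) := by
    have := hcl (⌈1 / β⌉₊ + 3) (l₁ + l₂) (by omega) le_rfl
    have h2 : ⌈1 / β⌉₊ * l₁ ≤ ⌈1 / β⌉₊ * (l₁ + l₂) := Nat.mul_le_mul_left _ (by omega)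
    rw [add_mul] at this
    omega
  have hE₂ : ⌈1 / α⌉₊ * (2 * l₂) + 2 * l₂ + 2 * l₂ ≤ c₁ * (l₁ + l₂) := by
    have := hcl (2 * ⌈1 / α⌉₊ + 4) l₂ (by omega) (by omega)
    have h2 : ⌈1 / α⌉₊ * (2 * l₂) = 2 * ⌈1 / α⌉₊ * l₂ := by ring
    rw [add_mul] at this
    omega
  have hM₁ : (N₁ : ℝ) * 2 ^ l₁ ≤ A₁ * 2 ^ (⌈1 / β⌉₊ * l₁ + l₁) := by
    rw [pow_add, ← mul_assoc]; gcongr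
  have hM₂ : (N₂ : ℝ) * 2 ^ (2 * l₂) ≤ A₂ * 2 ^ (⌈1 / α⌉₊ * (2 * l₂) + 2 * l₂) := by
    rw [pow_add, ← mul_assoc]; gcongr
  have hB' : 32 * K₀ ^ 6 * X ^ 13 ≤ m * B := by
    have hB0 : 0 ≤ B := (zero_le_one.trans hη.1).trans hKB
    have h1 : X ^ 13 = S ^ 13 * 2 ^ (13 * c₁ * (l₁ + l₂)) := by
      rw [hX, mul_pow, ← pow_mul]; congr 2; ring
    rw [h1]
    calc 32 * K₀ ^ 6 * (S ^ 13 * 2 ^ (13 * c₁ * (l₁ + l₂)))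
        = 32 * S ^ 13 * (K₀ ^ 6 * 2 ^ (13 * c₁ * (l₁ + l₂))) := by ring
      _ ≤ 32 * S ^ 13 * (4 ^ (13 * c₁) * B) := by gcongr
      _ = 32 * S ^ 13 * 4 ^ (13 * c₁) * B := by ring
      _ ≤ m * B := by gcongr
  obtain ⟨N, g1, g2, g3, g4, g5⟩ := exists_net_l2Dist_le hη hα hβ hF hf N₁ l₁ (l₁ + a₁) N₂ (2 * l₂)
    (2 * l₂ + a₂) (l₁ + a₃) (X := X) (hXc 2 hS2) hl
    (hsq A₁ N₁ _ e5 s2 (by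
      rw [← mul_assoc]; exact hcl _ _ (by omega) (by omega)))
    (hsq A₂ N₂ _ i5 s3 (by
      have h2 : 2 * (⌈1 / α⌉₊ * (2 * l₂)) = 4 * ⌈1 / α⌉₊ * l₂ := by ring
      rw [h2]; exact hcl _ _ (by omega) (by omega)))
    (hXc _ s4) (hXc _ s5) (hXc _ s6) (hXc _ s7) (hXc _ s8)
    (by
      have h1 : l₁ + a₃ + (l₁ + a₁ + l₁ * K₁) + 2 = (a₃ + a₁ + 2) + (2 + K₁) * l₁ := by ring
      rw [h1, pow_add]
      exact hXle _ _ s9 (hcl _ _ (by omega) (by omega)))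
    (hXc _ s10) (hM₁.trans (hXle _ _ s11 (by omega))) (hM₂.trans (hXle _ _ s12 (by omega)))
    hm1 hKB hB'
  refine ⟨N, g1, ?_, ?_, g4, g5.trans (ENNReal.ofReal_le_ofReal ?_)⟩
  · rw [g2]
    have h1 : (a₃ + 4 * p + 15) * 1 ≤ (a₃ + 4 * p + 15) * (l₁ + l₂) := Nat.mul_le_mul_left _ (by omega)
    have h2 : (a₃ + 4 * p + 17) * (l₁ + l₂) = (a₃ + 4 * p + 15) * (l₁ + l₂) + 2 * (l₁ + l₂) := by ring
    omega
  · have hR₁ : (1 : ℝ) ≤ 2 ^ (l₁ * (((p + 1 : ℕ) : ℝ) / β)) :=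
      Real.one_le_rpow (by norm_num) (by positivity)
    have hR₂ : (1 : ℝ) ≤ 2 ^ (((2 * l₂ : ℕ) : ℝ) * (p / α)) :=
      Real.one_le_rpow (by norm_num) (by positivity)
    have h1 := hgc N₂ (2 * l₂) (2 * l₂ + a₂) (2 * l₂) _ (by omega) hR₂ (by omega) (by omega) i2 i3 i4
    have h2 := hpc N₁ l₁ (l₁ + a₁) (l₁ + a₃) l₁ _ hl₁ hR₁ le_rfl (by omega) (by omega) e2 e3 e4
    have h3 : ((2 * l₂ : ℕ) : ℝ) * (p / α) = l₂ * (2 * p / α) := by push_cast; ring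
    have h4 : (N.numParams : ℝ) ≤ 48 * m ^ 2 * (graphCost p J b₂ K₂ N₂ (2 * l₂) (2 * l₂ + a₂) +
        pieceCost p J b₁ K₁ N₁ l₁ (l₁ + a₁) (l₁ + a₃)) := by exact_mod_cast g3
    rw [h3] at h1
    push_cast at h1 h2
    set r₁ : ℝ := 2 ^ (l₁ * ((p + 1) / β)) * l₁ ^ 2
    set r₂ : ℝ := 2 ^ (l₂ * (2 * p / α)) * l₂ ^ 2
    have hr₁ : 0 ≤ r₁ := by positivity
    have hr₂ : 0 ≤ r₂ := by positivity
    refine h4.trans ?_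
    rw [mul_assoc _ (Cg * 4 + Cp + 1)]
    refine mul_le_mul_of_nonneg_left ?_ (by positivity)
    have h5 : Cg * (2 ^ (l₂ * (2 * p / α)) * (2 * (l₂ : ℝ)) ^ 2) = Cg * 4 * r₂ := by
      simp only [r₂]; ring
    rw [h5] at h1
    have h6 : (Cg * 4 + Cp + 1) * (r₁ + r₂) = Cg * 4 * r₂ + Cp * r₁ + 4 * (Cg * r₁) + Cp * r₂ + r₁ + r₂ := by
      ring
    linarith [mul_nonneg hCg hr₁, mul_nonneg hCp hr₂]
  · have hq₁ : (0 : ℝ) < (1 / 2) ^ l₁ := by positivity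
    have hq₂ : (0 : ℝ) < (1 / 2) ^ l₂ := by positivity
    have hinv : ∀ e : ℕ, (1 / 2 : ℝ) ^ e * 2 ^ e = 1 := fun e => by rw [← mul_pow]; norm_num
    have t1 : 4 * F * (1 / X) ≤ 1 / 8 * (1 / 2) ^ l₁ := by
      rw [mul_one_div, div_le_iff₀ hX0]
      have h1 := hXle (32 * F) l₁ s15 (by omega)
      have h2 := mul_le_mul_of_nonneg_left h1 hq₁.le
      have h3 : (1 / 2 : ℝ) ^ l₁ * (32 * F * 2 ^ l₁) = 32 * F * ((1 / 2) ^ l₁ * 2 ^ l₁) := by ring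
      rw [h3, hinv] at h2
      linarith
    have t2 : 4 * F * (1 / 2) ^ (l₁ + a₃) ≤ 1 / 8 * (1 / 2) ^ l₁ := by
      have := mul_le_mul_of_nonneg_right ha₃ hq₁.le
      rw [pow_add]
      linarith
    set W : ℝ := 4 * (p + 1) * ((N₁ * 2 ^ l₁ + N₂ * 2 ^ (2 * l₂)) * (1 / X)) +
      2 * J * (1 / X + gridErr p α F N₂ (2 * l₂) (2 * l₂ + a₂)) with hW
    have hq₄ : (1 / 2 : ℝ) ^ (2 * l₂) * 2 ^ (2 * l₂) = 1 := hinv _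
    have t3 : 4 * F ^ 2 * (4 * (p + 1) * ((N₁ * 2 ^ l₁ + N₂ * 2 ^ (2 * l₂)) * (1 / X))) ≤
        1 / 4 * (1 / 2) ^ (2 * l₂) := by
      have h1 : 64 * F ^ 2 * (p + 1) * (N₁ * 2 ^ l₁ + N₂ * 2 ^ (2 * l₂)) * 2 ^ (2 * l₂) ≤ X := by
        have h2 : (N₁ * 2 ^ l₁ : ℝ) * 2 ^ (2 * l₂) ≤ A₁ * 2 ^ (c₁ * (l₁ + l₂)) := by
          calc _ ≤ (A₁ * 2 ^ (⌈1 / β⌉₊ * l₁ + l₁) : ℝ) * 2 ^ (2 * l₂) := by gcongr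
            _ = A₁ * 2 ^ (⌈1 / β⌉₊ * l₁ + l₁ + 2 * l₂) := by rw [pow_add _ _ (2 * l₂)]; ring
            _ ≤ _ := mul_le_mul_of_nonneg_left (pow_le_pow_right₀ (by norm_num) hE₁) (Nat.cast_nonneg _)
        have h3 : (N₂ * 2 ^ (2 * l₂) : ℝ) * 2 ^ (2 * l₂) ≤ A₂ * 2 ^ (c₁ * (l₁ + l₂)) := by
          calc _ ≤ (A₂ * 2 ^ (⌈1 / α⌉₊ * (2 * l₂) + 2 * l₂) : ℝ) * 2 ^ (2 * l₂) := by gcongr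
            _ = A₂ * 2 ^ (⌈1 / α⌉₊ * (2 * l₂) + 2 * l₂ + 2 * l₂) := by
              rw [pow_add _ (_ + _) (2 * l₂)]; ring
            _ ≤ _ := mul_le_mul_of_nonneg_left (pow_le_pow_right₀ (by norm_num) hE₂) (Nat.cast_nonneg _)
        calc _ = 64 * F ^ 2 * (p + 1) * ((N₁ * 2 ^ l₁ : ℝ) * 2 ^ (2 * l₂) +
              (N₂ * 2 ^ (2 * l₂) : ℝ) * 2 ^ (2 * l₂)) := by ring
          _ ≤ 64 * F ^ 2 * (p + 1) * (A₁ * 2 ^ (c₁ * (l₁ + l₂)) + A₂ * 2 ^ (c₁ * (l₁ + l₂))) := by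
            gcongr
          _ = 64 * F ^ 2 * (p + 1) * (A₁ + A₂) * 2 ^ (c₁ * (l₁ + l₂)) := by ring
          _ ≤ X := hXle _ _ s13 le_rfl
      have h2 : 4 * F ^ 2 * (4 * (p + 1) * ((N₁ * 2 ^ l₁ + N₂ * 2 ^ (2 * l₂)) * (1 / X))) =
          (16 * F ^ 2 * (p + 1) * (N₁ * 2 ^ l₁ + N₂ * 2 ^ (2 * l₂))) / X := by
        field_simp; ring
      rw [h2, div_le_iff₀ hX0]
      have h3 := mul_le_mul_of_nonneg_left h1 (by positivity : (0 : ℝ) ≤ (1 / 2) ^ (2 * l₂))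
      have h4 : (1 / 2 : ℝ) ^ (2 * l₂) * (64 * F ^ 2 * (p + 1) *
          (N₁ * 2 ^ l₁ + N₂ * 2 ^ (2 * l₂)) * 2 ^ (2 * l₂)) = 64 * F ^ 2 * (p + 1) *
          (N₁ * 2 ^ l₁ + N₂ * 2 ^ (2 * l₂)) * ((1 / 2) ^ (2 * l₂) * 2 ^ (2 * l₂)) := by ring
      rw [h4, hq₄] at h3
      linarith
    have t4 : 4 * F ^ 2 * (2 * J * (1 / X)) ≤ 1 / 4 * (1 / 2) ^ (2 * l₂) := by
      have h1 := hXle (32 * F ^ 2 * J) (2 * l₂) s14 (by omega)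
      have h2 : 4 * F ^ 2 * (2 * J * (1 / X)) = (8 * F ^ 2 * J) / X := by field_simp; ring
      rw [h2, div_le_iff₀ hX0]
      have h3 := mul_le_mul_of_nonneg_left h1 (by positivity : (0 : ℝ) ≤ (1 / 2) ^ (2 * l₂))
      have h4 : (1 / 2 : ℝ) ^ (2 * l₂) * (32 * F ^ 2 * J * 2 ^ (2 * l₂)) = 32 * F ^ 2 * J *
          ((1 / 2) ^ (2 * l₂) * 2 ^ (2 * l₂)) := by ring
      rw [h4, hq₄] at h3
      linarith
    have t5 : 4 * F ^ 2 * (2 * J * gridErr p α F N₂ (2 * l₂) (2 * l₂ + a₂)) ≤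
        1 / 4 * (1 / 2) ^ (2 * l₂) := by
      calc _ ≤ 4 * F ^ 2 * (2 * J * (1 / (32 * F ^ 2 * (J + 1)) * (1 / 2) ^ (2 * l₂))) := by gcongr
        _ = (J / (J + 1) : ℝ) * (1 / 4 * (1 / 2) ^ (2 * l₂)) := by field_simp; ring
        _ ≤ _ := by
          refine mul_le_of_le_one_left (by positivity) ?_
          rw [div_le_one (by positivity)]
          linarith
    -- After squaring, the three contributions to the volume take a quarter of `2 ^ (-2 l₂)` each.
    have t6 : 2 * F * √W ≤ (1 / 2) ^ l₂ := by
      refine le_of_sq_le_sq ?_ hq₂.le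
      have hW0 : 0 ≤ W := by
        have : 0 ≤ gridErr p α F N₂ (2 * l₂) (2 * l₂ + a₂) := by unfold gridErr; positivity
        rw [hW]; positivity
      rw [mul_pow, Real.sq_sqrt hW0, ← pow_mul, mul_comm l₂ 2]
      have : (0 : ℝ) < (1 / 2) ^ (2 * l₂) := by positivity
      rw [hW]
      linarith
    linarith

/-! ### From dyadic to arbitrary accuracies -/

theorem exists_dyadic {ε : ℝ} (h0 : 0 < ε) (h1 : ε < 1) :
    ∃ l : ℕ, 1 ≤ l ∧ (1 / 2 : ℝ) ^ l ≤ ε ∧ (l : ℝ) ≤ Real.logb 2 (1 / ε) + 1 ∧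
      (2 : ℝ) ^ l ≤ 2 / ε := by
  have hlog : 0 ≤ Real.logb 2 (1 / ε) :=
    Real.logb_nonneg (by norm_num) (by rw [le_div_iff₀ h0]; linarith)
  have hpow : (2 : ℝ) ^ Real.logb 2 (1 / ε) = 1 / ε :=
    Real.rpow_logb (by norm_num) (by norm_num) (by positivity)
  refine ⟨⌊Real.logb 2 (1 / ε)⌋₊ + 1, by omega, ?_, ?_, ?_⟩
  · have h2 : 1 / ε ≤ (2 : ℝ) ^ (⌊Real.logb 2 (1 / ε)⌋₊ + 1) := by
      rw [← Real.rpow_natCast]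
      refine hpow.symm.le.trans (Real.rpow_le_rpow_of_exponent_le (by norm_num) ?_)
      push_cast
      exact (Nat.lt_floor_add_one (Real.logb 2 (1 / ε))).le
    rw [one_div_pow, one_div_le (by positivity) h0]
    exact h2
  · push_cast
    have := Nat.floor_le hlog
    linarith
  · have h2 : (2 : ℝ) ^ ⌊Real.logb 2 (1 / ε)⌋₊ ≤ 1 / ε := by
      rw [← Real.rpow_natCast]
      exact (Real.rpow_le_rpow_of_exponent_le (by norm_num) (Nat.floor_le hlog)).trans hpow.le
    rw [pow_succ, show 2 / ε = 1 / ε * 2 by ring]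
    linarith

/-- For `ε ≤ 1 / 2` the logarithm is at least `1`, so `l` is at most twice the logarithm. For `ε`
near `1` the logarithm tends to zero while `l` does not; there the left side is bounded, which the
summand `1` covers. -/
theorem two_rpow_mul_sq_le {ε s : ℝ} (h0 : 0 < ε) (h1 : ε < 1) (hs : 0 < s) {l : ℕ}
    (hl : (l : ℝ) ≤ Real.logb 2 (1 / ε) + 1) (hl' : (2 : ℝ) ^ l ≤ 2 / ε) :
    (2 : ℝ) ^ (l * s) * l ^ 2 ≤ 4 * 4 ^ s * (ε ^ (-s) * Real.logb 2 (1 / ε) ^ 2 + 1) := by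
  have hlog : 0 ≤ Real.logb 2 (1 / ε) :=
    Real.logb_nonneg (by norm_num) (by rw [le_div_iff₀ h0]; linarith)
  have e1 : (2 : ℝ) ^ (l * s) ≤ 2 ^ s * ε ^ (-s) := by
    rw [Real.rpow_mul (by norm_num), Real.rpow_natCast, Real.rpow_neg h0.le, ← div_eq_mul_inv,
      ← Real.div_rpow (by norm_num) h0.le]
    gcongr
  have e2 : (2 : ℝ) ^ s ≤ 4 ^ s := by gcongr; norm_num
  have hε : 0 < ε ^ (-s) := Real.rpow_pos_of_pos h0 _
  have h4 : (0 : ℝ) < 4 ^ s := by positivity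
  rcases le_or_gt ε (1 / 2) with h | h
  · have h2 : 1 ≤ Real.logb 2 (1 / ε) := by
      rw [Real.le_logb_iff_rpow_le (by norm_num) (by positivity), Real.rpow_one, le_div_iff₀ h0]
      linarith
    have e3 : (l : ℝ) ^ 2 ≤ (2 * Real.logb 2 (1 / ε)) ^ 2 := by
      gcongr; linarith
    calc (2 : ℝ) ^ (l * s) * l ^ 2 ≤ (4 ^ s * ε ^ (-s)) * (2 * Real.logb 2 (1 / ε)) ^ 2 := by
          gcongr
          exact e1.trans (by gcongr)
      _ = 4 * 4 ^ s * (ε ^ (-s) * Real.logb 2 (1 / ε) ^ 2) := by ring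
      _ ≤ _ := by gcongr; linarith
  · have h2 : Real.logb 2 (1 / ε) ≤ 1 := by
      rw [Real.logb_le_iff_le_rpow (by norm_num) (by positivity), Real.rpow_one, div_le_iff₀ h0]
      linarith
    have e3 : (l : ℝ) ^ 2 ≤ 2 ^ 2 := by gcongr; linarith
    have e4 : ε ^ (-s) ≤ 2 ^ s := by
      have := Real.rpow_le_rpow_of_nonpos (by norm_num : (0 : ℝ) < 1 / 2) h.le
        (by linarith : -s ≤ 0)
      refine this.trans (le_of_eq ?_)
      rw [one_div, Real.inv_rpow (by norm_num), Real.rpow_neg (by norm_num), inv_inv]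
    calc (2 : ℝ) ^ (l * s) * l ^ 2 ≤ (2 ^ s * 2 ^ s) * 2 ^ 2 := by
          gcongr
          exact e1.trans (by gcongr)
      _ = 4 * 4 ^ s * 1 := by
          rw [← Real.mul_rpow (by norm_num) (by norm_num)]; norm_num; ring
      _ ≤ _ := by
          gcongr
          have : 0 ≤ ε ^ (-s) * Real.logb 2 (1 / ε) ^ 2 := by positivity
          linarith

/-- The quantifiers are arranged so that the constants can be chosen as functions of their permitted
arguments; outside the admissible range dummy values are taken. -/
theorem exists_approx_constants (α β : ℝ) : ∃ c : ℕ, ∀ (D : ℕ) (F : ℝ), ∃ CL : ℕ, ∀ J : ℕ,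
    ∃ CS : ℝ, 0 < CS ∧ (0 < α → 0 < β → 0 < F → 2 ≤ D → ∀ (η : ℝ → ℝ) (K₀ : ℝ), HasGadgets η K₀ →
      ∀ (M : ℕ), ∀ f ∈ piecewiseSmooth D J M α β F, ∀ l₁ l₂ : ℕ, 1 ≤ l₁ → 1 ≤ l₂ → ∀ B : ℝ,
        K₀ ≤ B → K₀ ^ 6 * 2 ^ (c * (l₁ + l₂)) ≤ 4 ^ c * B →
        ∃ N : Net D 1, (∀ x, |N.eval η x 0| ≤ F) ∧ N.numLayers ≤ CL * (l₁ + l₂) ∧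
          (N.numParams : ℝ) ≤ CS * (2 ^ (l₁ * (D / β)) * l₁ ^ 2 +
            2 ^ (l₂ * (2 * ((D : ℝ) - 1) / α)) * l₂ ^ 2) ∧ (N.maxParam : ℝ) ≤ B ∧
          l2Dist (fun x => N.eval η x 0) f ≤ ENNReal.ofReal ((1 / 2) ^ l₁ + (1 / 2) ^ l₂)) := by
  by_cases hα : 0 < α
  swap
  · exact ⟨0, fun _ _ => ⟨0, fun _ => ⟨1, one_pos, fun h => (hα h).elim⟩⟩⟩
  by_cases hβ : 0 < β
  swap
  · exact ⟨0, fun _ _ => ⟨0, fun _ => ⟨1, one_pos, fun _ h => (hβ h).elim⟩⟩⟩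
  obtain ⟨c, hc⟩ := exists_approx hα hβ
  refine ⟨c, fun D F => ?_⟩
  by_cases hF : 0 < F
  swap
  · exact ⟨0, fun _ => ⟨1, one_pos, fun _ _ h => (hF h).elim⟩⟩
  by_cases hD : 2 ≤ D
  swap
  · exact ⟨0, fun _ => ⟨1, one_pos, fun _ _ _ h => (hD h).elim⟩⟩
  obtain ⟨p, rfl⟩ : ∃ p, D = p + 1 := ⟨D - 1, by omega⟩
  have : NeZero p := ⟨by omega⟩
  obtain ⟨CL, hCL⟩ := hc p F hF
  refine ⟨CL, fun J => ?_⟩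
  obtain ⟨CS, h0, hCS⟩ := hCL J
  refine ⟨CS, h0, fun _ _ _ _ η K₀ hη M f hf l₁ l₂ h1 h2 B hK hB => ?_⟩
  have := hCS η K₀ hη M f hf l₁ l₂ h1 h2 B hK hB
  have e : ((p + 1 : ℕ) : ℝ) - 1 = p := by push_cast; ring
  rw [e]
  push_cast
  exact this

end

theorem theorem1 :
    ∃ (CL : (α β : ℝ) → (D : ℕ) → (F : ℝ) → ℝ)
      (CS : (α β : ℝ) → (D : ℕ) → (F : ℝ) → (J : ℕ) → ℝ)
      (CB : (F : ℝ) → (M : ℕ) → (η : ℝ → ℝ) → ℝ)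
      (c : (α β : ℝ) → ℝ),
      ∀ (α β F : ℝ) (D J M N : ℕ) (η : ℝ → ℝ),
        0 < α → 0 < β → 0 < F → 2 ≤ D → 1 ≤ M →
        max α β < N → ActivationAssumption N η →
        0 < CL α β D F ∧ 0 < CS α β D F J ∧ 0 < CB F M η ∧ 0 < c α β ∧
        ∀ ε₁ ∈ Set.Ioo (0 : ℝ) 1, ∀ ε₂ ∈ Set.Ioo (0 : ℝ) 1, ∀ L S B : ℕ,
          CL α β D F * (⌊α⌋₊ + ⌊β⌋₊ + Real.logb 2 (1 / ε₁) + Real.logb 2 (M / ε₂) + 1) ≤ L →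
          CS α β D F J *
              (M * ε₁ ^ (-(D : ℝ) / β) * Real.logb 2 (1 / ε₁) ^ 2 +
                (ε₂ / M) ^ (-(2 * ((D : ℝ) - 1)) / α) * Real.logb 2 (M / ε₂) ^ 2 + 1) ≤ S →
          CB F M η * (min ε₁ ε₂) ^ (min (-16) (-(c α β))) ≤ B →
          (⨆ f ∈ piecewiseSmooth D J M α β F, ⨅ g ∈ netClass D η F L S B, l2Dist g f)
            ≤ ENNReal.ofReal (ε₁ + ε₂) := by
  classical
  choose c CL CS hCS happrox using exists_approx_constants
  -- `C_B` is the sixth power of the gadget constant and depends on `η` alone. The exponent `2 c`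
  -- comes from `2 ^ (l₁ + l₂) ≤ 4 / min(ε₁, ε₂) ^ 2`. The summands `1` in `C_L` and in the exponent
  -- ensure positivity.
  refine ⟨fun α β D F => 2 * CL α β D F + 1,
    fun α β D F J => CS α β D F J * (4 * (4 ^ ((D : ℝ) / β) + 4 ^ (2 * ((D : ℝ) - 1) / α))),
    fun _ _ η => if h : ∃ K, HasGadgets η K then h.choose ^ 6 else 1,
    fun α β => 2 * c α β + 1, fun α β F D J M N η hα hβ hF hD hM hN hη => ?_⟩
  have hN1 : 1 ≤ N := by
    have : (0 : ℝ) < N := (hα.trans_le (le_max_left α β)).trans hN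
    exact_mod_cast this
  have hK : ∃ K, HasGadgets η K := hη.exists_hasGadgets hN1
  beta_reduce
  rw [dif_pos hK]
  have hη' := hK.choose_spec
  set K := hK.choose
  have hK1 : 1 ≤ K := hη'.1
  refine ⟨by positivity, mul_pos (hCS α β D F J) (by positivity), by positivity, by positivity, ?_⟩
  intro ε₁ h₁ ε₂ h₂ L S B hL hS hB
  obtain ⟨l₁, p1, p2, p3, p4⟩ := exists_dyadic h₁.1 h₁.2
  obtain ⟨l₂, q1, q2, q3, q4⟩ := exists_dyadic h₂.1 h₂.2
  have hD1 : (2 : ℝ) ≤ D := by exact_mod_cast hD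
  have hM1 : (1 : ℝ) ≤ M := by exact_mod_cast hM
  have hs₁ : 0 < (D : ℝ) / β := div_pos (by linarith) hβ
  have hs₂ : 0 < 2 * ((D : ℝ) - 1) / α := div_pos (by linarith) hα
  have hlog₁ : 0 ≤ Real.logb 2 (1 / ε₁) :=
    Real.logb_nonneg (by norm_num) (by rw [le_div_iff₀ h₁.1]; linarith [h₁.2])
  have hlog₂ : 0 ≤ Real.logb 2 (1 / ε₂) :=
    Real.logb_nonneg (by norm_num) (by rw [le_div_iff₀ h₂.1]; linarith [h₂.2])
  have hlogM : Real.logb 2 (1 / ε₂) ≤ Real.logb 2 (M / ε₂) := by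
    have := h₂.1
    exact Real.logb_le_logb_of_le (by norm_num) (by positivity) (by gcongr)
  have hμ0 : 0 < min ε₁ ε₂ := lt_min h₁.1 h₂.1
  have hμ1 : min ε₁ ε₂ ≤ 1 := (min_le_left _ _).trans h₁.2.le
  have hBμ : K ^ 6 * ((min ε₁ ε₂) ^ 2)⁻¹ ^ c α β ≤ B := by
    refine le_trans (mul_le_mul_of_nonneg_left ?_ (by positivity)) hB
    rw [← Real.rpow_natCast, ← Real.rpow_two, ← Real.rpow_neg hμ0.le, ← Real.rpow_mul hμ0.le]
    refine Real.rpow_le_rpow_of_exponent_ge hμ0 hμ1 ((min_le_right _ _).trans ?_)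
    linarith
  have hKB : K ≤ B := by
    refine le_trans ?_ hBμ
    have e1 : K ≤ K ^ 6 := le_self_pow₀ hK1 (by norm_num)
    have e2 : (1 : ℝ) ≤ ((min ε₁ ε₂) ^ 2)⁻¹ ^ c α β :=
      one_le_pow₀ (one_le_inv_iff₀.2 ⟨by positivity, pow_le_one₀ hμ0.le hμ1⟩)
    exact e1.trans (le_mul_of_one_le_right (by positivity) e2)
  have hB' : K ^ 6 * 2 ^ (c α β * (l₁ + l₂)) ≤ 4 ^ c α β * (B : ℝ) := by
    have e1 : (2 : ℝ) ^ (l₁ + l₂) ≤ 4 * ((min ε₁ ε₂) ^ 2)⁻¹ := by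
      rw [pow_add]
      have f1 : 2 / ε₁ ≤ 2 / min ε₁ ε₂ :=
        div_le_div_of_nonneg_left (by norm_num) hμ0 (min_le_left _ _)
      have f2 : 2 / ε₂ ≤ 2 / min ε₁ ε₂ :=
        div_le_div_of_nonneg_left (by norm_num) hμ0 (min_le_right _ _)
      refine (mul_le_mul (p4.trans f1) (q4.trans f2) (by positivity) (by positivity)).trans
        (le_of_eq ?_)
      field_simp
      norm_num
    calc K ^ 6 * 2 ^ (c α β * (l₁ + l₂)) = K ^ 6 * (2 ^ (l₁ + l₂)) ^ c α β := by
          rw [← pow_mul, mul_comm (l₁ + l₂)]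
      _ ≤ K ^ 6 * (4 * ((min ε₁ ε₂) ^ 2)⁻¹) ^ c α β := by gcongr
      _ = 4 ^ c α β * (K ^ 6 * ((min ε₁ ε₂) ^ 2)⁻¹ ^ c α β) := by rw [mul_pow]; ring
      _ ≤ 4 ^ c α β * B := by gcongr
  have hL' : ((CL α β D F * (l₁ + l₂) : ℕ) : ℝ) ≤ L := by
    refine le_trans ?_ hL
    push_cast
    have hf : (0 : ℝ) ≤ ⌊α⌋₊ + ⌊β⌋₊ := by positivity
    have e1 : (l₁ + l₂ : ℝ) ≤
        2 * (⌊α⌋₊ + ⌊β⌋₊ + Real.logb 2 (1 / ε₁) + Real.logb 2 (M / ε₂) + 1) := by linarith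
    have e2 := mul_le_mul_of_nonneg_left e1 (Nat.cast_nonneg (α := ℝ) (CL α β D F))
    linarith
  have hS' : CS α β D F J * (2 ^ (l₁ * ((D : ℝ) / β)) * (l₁ : ℝ) ^ 2 +
      2 ^ (l₂ * (2 * ((D : ℝ) - 1) / α)) * (l₂ : ℝ) ^ 2) ≤ S := by
    refine le_trans ?_ hS
    rw [mul_assoc (CS α β D F J)]
    refine mul_le_mul_of_nonneg_left ?_ (hCS α β D F J).le
    have e1 := two_rpow_mul_sq_le h₁.1 h₁.2 hs₁ p3 p4
    have e2 := two_rpow_mul_sq_le h₂.1 h₂.2 hs₂ q3 q4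
    rw [neg_div, neg_div]
    have hε₁ : 0 < ε₁ ^ (-((D : ℝ) / β)) := Real.rpow_pos_of_pos h₁.1 _
    have hε₂ : 0 < ε₂ ^ (-(2 * ((D : ℝ) - 1) / α)) := Real.rpow_pos_of_pos h₂.1 _
    -- As `M ≥ 1`, the factors `M` only enlarge the permitted number of parameters.
    have e3 : ε₁ ^ (-((D : ℝ) / β)) * Real.logb 2 (1 / ε₁) ^ 2 ≤
        M * ε₁ ^ (-((D : ℝ) / β)) * Real.logb 2 (1 / ε₁) ^ 2 := by
      rw [mul_assoc]
      exact le_mul_of_one_le_left (by positivity) hM1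
    have e4 : ε₂ ^ (-(2 * ((D : ℝ) - 1) / α)) * Real.logb 2 (1 / ε₂) ^ 2 ≤
        (ε₂ / M) ^ (-(2 * ((D : ℝ) - 1) / α)) * Real.logb 2 (M / ε₂) ^ 2 := by
      have := h₂.1
      have f1 : ε₂ ^ (-(2 * ((D : ℝ) - 1) / α)) ≤ (ε₂ / M) ^ (-(2 * ((D : ℝ) - 1) / α)) :=
        Real.rpow_le_rpow_of_nonpos (by positivity) (div_le_self h₂.1.le hM1) (by linarith)
      gcongr
    set a₁ := ε₁ ^ (-((D : ℝ) / β)) * Real.logb 2 (1 / ε₁) ^ 2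
    set a₂ := ε₂ ^ (-(2 * ((D : ℝ) - 1) / α)) * Real.logb 2 (1 / ε₂) ^ 2
    have ha₁ : 0 ≤ a₁ := by positivity
    have ha₂ : 0 ≤ a₂ := by positivity
    set x₁ : ℝ := 4 ^ ((D : ℝ) / β)
    set x₂ : ℝ := 4 ^ (2 * ((D : ℝ) - 1) / α)
    have hx₁ : 0 ≤ x₁ := by positivity
    have hx₂ : 0 ≤ x₂ := by positivity
    calc _ ≤ 4 * x₁ * (a₁ + 1) + 4 * x₂ * (a₂ + 1) := add_le_add e1 e2
      _ ≤ 4 * (x₁ + x₂) * (a₁ + a₂ + 1) := by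
        linarith [mul_nonneg hx₁ ha₂, mul_nonneg hx₂ ha₁]
      _ ≤ _ := by gcongr
  refine iSup₂_le fun f hf => ?_
  obtain ⟨net, g1, g2, g3, g4, g5⟩ := happrox α β D F J hα hβ hF hD η K hη' M f hf l₁ l₂ p1 q1 B
    hKB hB'
  refine iInf₂_le_of_le (fun x => net.eval η x 0) ⟨⟨net, fun x => rfl, ?_, ?_, g4⟩, fun x _ => g1 x⟩
    (g5.trans (ENNReal.ofReal_le_ofReal (add_le_add p2 q2)))
  · have : (net.numLayers : ℝ) ≤ L := le_trans (by exact_mod_cast g2) hL'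
    exact_mod_cast this
  · exact_mod_cast g3.trans hS'
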